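/- Let $\mathcal{D}=\{[m2^k,(m+1)2^k):k,m\in\mathbb{Z}\}$ be the set of dyadic intervals of $\mathbb{R}$ and $\boldsymbol{\mathcal{D}}=\{I\times J: I,J\in\mathcal{D}\}$ the set of dyadic rectangles of $\mathbb{R}^2$. For $I\in\mathcal{D}$ with left half $I_-$ and right half $I_+$ put $h_I=|I|^{-1/2}(\mathbf 1_{I_+}-\mathbf 1_{I_-})$; for $R=I\times J\in\boldsymbol{\mathcal{D}}$ put $h_R(t,s)=h_I(t)h_J(s)$, and for $f\in L^1_{\mathrm{loc}}(\mathbb{R}^2)$ (complex valued) put $f_R=\int_{\mathbb{R}^2} f\,h_R$. Write $\langle v\rangle_R=|R|^{-1}\int_R v$. Let $1<p<\infty$ and let $w$ be a dyadic biparameter $A_p$ weight on $\mathbb{R}^2$, that is, a locally integrable, a.e. positive function with $$[w]_{A_p,\boldsymbol{\mathcal{D}}}:=\sup_{R\in\boldsymbol{\mathcal{D}}}\langle w\rangle_R\,\langle w^{-1/(p-1)}\rangle_R^{\,p-1}<\infty .$$ Define, with values in $[0,\infty]$, $$Sf=\Big(\sum_{R\in\boldsymbol{\mathcal{D}}}|f_R|^2\frac{\mathbf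 1_R}{|R|}\Big)^{1/2},\qquad S_wf=\Big(\sum_{R\in\boldsymbol{\mathcal{D}}}|f_R|^2\langle w\rangle_R^{2/p}\frac{\mathbf 1_R}{|R|}\Big)^{1/2},\qquad \|g\|_{L^p(w)}=\Big(\int_{\mathbb{R}^2}|g|^p\,w\,dx\Big)^{1/p},$$ and $\|g\|_{L^p}=\|g\|_{L^p(1)}$. Then there is a finite constant $C$ depending only on $p$ and $[w]_{A_p,\boldsymbol{\mathcal{D}}}$ such that 1. $\|S_wf\|_{L^p}\le C\,\|Sf\|_{L^p(w)}$ for every $f\in L^1_{\mathrm{loc}}(\mathbb{R}^2)$ (both sides may be infinite); 2. $\|S_wf\|_{L^p}\le C\,\|f\|_{L^p(w)}$ for every bounded compactly supported measurable $f$ on $\mathbb{R}^2$; 3. $\|f\|_{L^p(w)}\le C\,\|S_wf\|_{L^p}$ for every bounded compactly supported measurable $f$ on $\mathbb{R}^2$. -/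

import Mathlib

open MeasureTheory Set
open scoped ENNReal NNReal

namespace Biparam

/-- The dyadic interval `[m 2 ^ k, (m + 1) 2 ^ k)`, given by its scale `k` and its position `m`. -/
@[ext]
structure DyadicInterval where
  k : ℤ
  m : ℤ

namespace DyadicInterval

/-- The length `|I| = 2 ^ k`. -/
noncomputable def length (I : DyadicInterval) : ℝ := 2 ^ I.k

/-- The underlying set `[m 2 ^ k, (m + 1) 2 ^ k)`. -/
noncomputable def toSet (I : DyadicInterval) : Set ℝ :=
  Ico (I.m * I.length) ((I.m + 1) * I.length)

/-- The left half `I₋`. -/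
noncomputable def left (I : DyadicInterval) : Set ℝ :=
  Ico (I.m * I.length) ((I.m + 1 / 2) * I.length)

/-- The right half `I₊`. -/
noncomputable def right (I : DyadicInterval) : Set ℝ :=
  Ico ((I.m + 1 / 2) * I.length) ((I.m + 1) * I.length)

/-- The cancellative Haar function `h_I = (1_{I₊} - 1_{I₋}) / √|I|`. -/
noncomputable def haar (I : DyadicInterval) (x : ℝ) : ℝ :=
  (I.right.indicator (fun _ => (1 : ℝ)) x - I.left.indicator (fun _ => (1 : ℝ)) x) /
    Real.sqrt I.length

/-- Different parameters give different intervals, so that a sum over the type `DyadicInterval`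
is a sum over the set of dyadic intervals, without repetition. -/
theorem toSet_injective : Function.Injective toSet := by
  intro I J h
  have hI : 0 < I.length := zpow_pos two_pos _
  have hJ : 0 < J.length := zpow_pos two_pos _
  have h1 : (I.m : ℝ) * I.length < (I.m + 1) * I.length := by nlinarith
  have h2 : (J.m : ℝ) * J.length < (J.m + 1) * J.length := by nlinarith
  obtain ⟨ha, hb⟩ := (Ico_eq_Ico_iff (Or.inl h1)).1 h
  have hl : I.length = J.length := by linarith
  have hk : I.k = J.k := zpow_right_injective₀ (a := (2 : ℝ)) two_pos (by norm_num) hl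
  have hm : I.m = J.m := by
    rw [hl] at ha
    exact_mod_cast mul_right_cancel₀ hJ.ne' ha
  exact DyadicInterval.ext hk hm

end DyadicInterval

/-- The dyadic rectangle `R = I × J`. -/
@[ext]
structure DyadicRect where
  I : DyadicInterval
  J : DyadicInterval

namespace DyadicRect

/-- The underlying subset `I × J` of the plane. -/
noncomputable def toSet (R : DyadicRect) : Set (ℝ × ℝ) := R.I.toSet ×ˢ R.J.toSet

/-- The bi-cancellative Haar function `h_R = h_I ⊗ h_J`. -/
noncomputable def haar (R : DyadicRect) (x : ℝ × ℝ) : ℝ := R.I.haar x.1 * R.J.haar x.2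

/-- The average `⟨v⟩_R = |R|⁻¹ ∫_R v` of a function that is nonnegative almost everywhere,
as an extended nonnegative real (so `∞` if `v` is not integrable on `R`). -/
noncomputable def avg (R : DyadicRect) (v : ℝ × ℝ → ℝ) : ℝ≥0∞ :=
  (volume R.toSet)⁻¹ * ∫⁻ x in R.toSet, ENNReal.ofReal (v x)

end DyadicRect

/-- The Haar coefficient `f_R = ⟨f, h_R⟩`. -/
noncomputable def haarCoeff (f : ℝ × ℝ → ℂ) (R : DyadicRect) : ℂ :=
  ∫ x, f x * (R.haar x : ℂ)

/-- The dyadic biparameter square function `S f = (∑_R |f_R|² 1_R / |R|) ^ (1 / 2)`. -/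
noncomputable def squareFn (f : ℝ × ℝ → ℂ) (x : ℝ × ℝ) : ℝ≥0∞ :=
  (∑' R : DyadicRect, ‖haarCoeff f R‖ₑ ^ 2 *
    R.toSet.indicator (fun _ => (volume R.toSet)⁻¹) x) ^ (1 / 2 : ℝ)

/-- The Triebel–Lizorkin square function
`S_w f = (∑_R |f_R|² ⟨w⟩_R ^ (2 / p) 1_R / |R|) ^ (1 / 2)`. -/
noncomputable def tlSquareFn (p : ℝ) (w : ℝ × ℝ → ℝ) (f : ℝ × ℝ → ℂ) (x : ℝ × ℝ) : ℝ≥0∞ :=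
  (∑' R : DyadicRect, ‖haarCoeff f R‖ₑ ^ 2 * R.avg w ^ (2 / p) *
    R.toSet.indicator (fun _ => (volume R.toSet)⁻¹) x) ^ (1 / 2 : ℝ)

/-- The dyadic biparameter Muckenhoupt characteristic
`[w]_{A_p} = sup_R ⟨w⟩_R ⟨w ^ (-1 / (p - 1))⟩_R ^ (p - 1)`. -/
noncomputable def apChar (p : ℝ) (w : ℝ × ℝ → ℝ) : ℝ≥0∞ :=
  ⨆ R : DyadicRect, R.avg w * R.avg (fun x => w x ^ (-1 / (p - 1))) ^ (p - 1)

/-- `w` is a dyadic biparameter `A_p` weight: a locally integrable, almost everywhere positive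
function whose characteristic is finite. -/
structure IsDyadicApWeight (p : ℝ) (w : ℝ × ℝ → ℝ) : Prop where
  locallyIntegrable : LocallyIntegrable w
  ae_pos : ∀ᵐ x, 0 < w x
  apChar_lt_top : apChar p w < ∞

/-- The measure `w(x) dx`, whose `L^p` space is `L^p(w)`. -/
noncomputable def weightMeasure (w : ℝ × ℝ → ℝ) : Measure (ℝ × ℝ) :=
  volume.withDensity (fun x => ENNReal.ofReal (w x))

end Biparam

/-! All the analysis takes place on a grid of cells of side `2 ^ a`. There `f` and `w` are replaced
by their cell averages, only rectangles with sides from `2 ^ (a + 1)` to `2 ^ (a + n)` enter, and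
every integral is a finite average. The grid bounds do not depend on `a` or `n`, so they survive the
limits.

The tool on the grid is Rubio de Francia extrapolation from `L ^ 2` (`extrapolation`). It rests on
the weighted bound for the iterated maximal function, which follows from Doob's inequality used
twice in each variable (`bavg_rmax_rpow_le`, `ravg_smax_rpow_le`).

For the first estimate, `A_p` and Hölder give `⟨w⟩_R ≤ Q ⟨w ^ (1 / p)⟩_R ^ p` (`ravg_le_rpow_root`).
Hence `S_w f` is dominated by `(∑ |f_R|² ⟨v⟩_R² 1_R / |R|) ^ (1 / 2)` with `v = w ^ (1 / p)`.
Stein's inequality, immediate in `L ^ 2 (W)` for `W` in `A_2` and extrapolated to unweighted `L ^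
p`, moves `v` out of the averages and leaves `v * S f`, whose `L ^ p` norm is that of `S f` in `L ^
p (w)` (`ravg_tl_le`).

The second estimate adds the bound of `S` on `L ^ p (w)` (`ravg_square_le`). By extrapolation only
`p = 2` is needed. There a Bellman function settles one parameter (`sum_bdiff_sq_le`), and iterating
in the two variables settles rectangles.

The third estimate is dual to the second (`ravg_norm_rpow_le_tl`). Pair `f` with `g = conj f * |f| ^
(p - 2) * w`, expand by Parseval, insert `1 ≤ ⟨w⟩_R ^ (1 / p) ⟨σ⟩_R ^ (1 - 1 / p)` where `σ = w ^
(-1 / (p - 1))`, and apply the second estimate to `g`, `σ` and the dual exponent. The Haar system on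
a bounded square misses the non-cancellative terms. For compactly supported `f` they vanish as the
square grows (`lintegral_cellFn_le_tl`), and Lebesgue differentiation then removes the cells. -/

namespace Biparam

/-! ### Averages over dyadic intervals of integers. -/

/-- The average of a function on the integers over the `2 ^ k` points of
`[m 2 ^ k, (m + 1) 2 ^ k)`. -/
noncomputable def bavg {E : Type*} [AddCommGroup E] [Module ℝ E] : ℕ → ℤ → (ℤ → E) → E
  | 0, m, f => f m
  | k + 1, m, f => (1 / 2 : ℝ) • (bavg k (2 * m) f + bavg k (2 * m + 1) f)

section Module

variable {E F : Type*} [AddCommGroup E] [Module ℝ E] [AddCommGroup F] [Module ℝ F]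

@[simp] theorem bavg_zero (m : ℤ) (f : ℤ → E) : bavg 0 m f = f m := rfl

theorem bavg_succ (k : ℕ) (m : ℤ) (f : ℤ → E) :
    bavg (k + 1) m f = (1 / 2 : ℝ) • (bavg k (2 * m) f + bavg k (2 * m + 1) f) := rfl

theorem ediv_two_pow_succ (x : ℤ) (k : ℕ) : x / 2 ^ (k + 1) = x / 2 ^ k / 2 := by
  rw [pow_succ, Int.ediv_ediv_of_nonneg (by positivity)]

theorem ediv_left {x m : ℤ} {k : ℕ} (h : x / 2 ^ k = 2 * m) : x / 2 ^ (k + 1) = m := by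
  rw [ediv_two_pow_succ, h]; omega

theorem ediv_right {x m : ℤ} {k : ℕ} (h : x / 2 ^ k = 2 * m + 1) : x / 2 ^ (k + 1) = m := by
  rw [ediv_two_pow_succ, h]; omega

theorem bavg_congr {k : ℕ} {m : ℤ} {f g : ℤ → E} (h : ∀ x, x / 2 ^ k = m → f x = g x) :
    bavg k m f = bavg k m g := by
  induction k generalizing m with
  | zero => exact h m (by simp)
  | succ k ih =>
    rw [bavg_succ, bavg_succ, ih fun x hx => h x (ediv_left hx),
      ih fun x hx => h x (ediv_right hx)]

theorem bavg_const (k : ℕ) (m : ℤ) (c : E) : bavg k m (fun _ => c) = c := by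
  induction k generalizing m with
  | zero => rfl
  | succ k ih => rw [bavg_succ, ih, ih, ← two_smul ℝ c, smul_smul]; norm_num

theorem bavg_add (k : ℕ) (m : ℤ) (f g : ℤ → E) :
    bavg k m (fun x => f x + g x) = bavg k m f + bavg k m g := by
  induction k generalizing m with
  | zero => rfl
  | succ k ih => simp only [bavg_succ, ih, smul_add]; abel

theorem bavg_map (L : E →ₗ[ℝ] F) (k : ℕ) (m : ℤ) (f : ℤ → E) :
    bavg k m (fun x => L (f x)) = L (bavg k m f) := by
  induction k generalizing m with
  | zero => rfl
  | succ k ih => simp only [bavg_succ, ih, map_smul, map_add]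

theorem bavg_smul (k : ℕ) (m : ℤ) (c : ℝ) (f : ℤ → E) :
    bavg k m (fun x => c • f x) = c • bavg k m f :=
  bavg_map (c • LinearMap.id) k m f

theorem bavg_sub (k : ℕ) (m : ℤ) (f g : ℤ → E) :
    bavg k m (fun x => f x - g x) = bavg k m f - bavg k m g := by
  induction k generalizing m with
  | zero => rfl
  | succ k ih => simp only [bavg_succ, ih, smul_add, smul_sub]; abel

theorem bavg_sum {ι : Type*} (s : Finset ι) (k : ℕ) (m : ℤ) (f : ι → ℤ → E) :
    bavg k m (fun x => ∑ i ∈ s, f i x) = ∑ i ∈ s, bavg k m (f i) := by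
  classical
  induction s using Finset.induction_on with
  | empty => simp [bavg_const]
  | insert a s ha ih => simp [Finset.sum_insert ha, bavg_add, ih]

theorem bavg_comm (k l : ℕ) (m n : ℤ) (f : ℤ → ℤ → E) :
    bavg k m (fun x => bavg l n (fun y => f x y)) =
      bavg l n (fun y => bavg k m (fun x => f x y)) := by
  induction k generalizing m with
  | zero => rfl
  | succ k ih => simp only [bavg_succ, ih, ← bavg_add, ← bavg_smul]

/-- The tower property. -/
theorem bavg_bavg {i k : ℕ} (h : i ≤ k) (m : ℤ) (f : ℤ → E) :
    bavg k m (fun x => bavg i (x / 2 ^ i) f) = bavg k m f := by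
  induction k, h using Nat.le_induction generalizing m with
  | base =>
    rw [bavg_congr (g := fun _ => bavg i m f) (fun x hx => by rw [hx]), bavg_const]
  | succ k hk ih => rw [bavg_succ, bavg_succ, ih, ih]

end Module

theorem bavg_succ' (k : ℕ) (m : ℤ) (f : ℤ → ℝ) :
    bavg (k + 1) m f = (bavg k (2 * m) f + bavg k (2 * m + 1) f) / 2 := by
  rw [bavg_succ, smul_eq_mul]; ring

theorem bavg_mul_left (k : ℕ) (m : ℤ) (c : ℝ) (f : ℤ → ℝ) :
    bavg k m (fun x => c * f x) = c * bavg k m f := bavg_smul k m c f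

theorem bavg_mul_right (k : ℕ) (m : ℤ) (c : ℝ) (f : ℤ → ℝ) :
    bavg k m (fun x => f x * c) = bavg k m f * c := by
  simp_rw [mul_comm _ c]; exact bavg_mul_left k m c f

theorem bavg_mono {k : ℕ} {m : ℤ} {f g : ℤ → ℝ} (h : ∀ x, x / 2 ^ k = m → f x ≤ g x) :
    bavg k m f ≤ bavg k m g := by
  induction k generalizing m with
  | zero => exact h m (by simp)
  | succ k ih =>
    rw [bavg_succ', bavg_succ']
    linarith [ih fun x hx => h x (ediv_left hx), ih fun x hx => h x (ediv_right hx)]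

theorem bavg_le {k : ℕ} {m : ℤ} {f : ℤ → ℝ} {c : ℝ} (h : ∀ x, x / 2 ^ k = m → f x ≤ c) :
    bavg k m f ≤ c := (bavg_mono h).trans_eq (bavg_const k m c)

theorem le_bavg {k : ℕ} {m : ℤ} {f : ℤ → ℝ} {c : ℝ} (h : ∀ x, x / 2 ^ k = m → c ≤ f x) :
    c ≤ bavg k m f := (bavg_const k m c).symm.trans_le (bavg_mono h)

theorem bavg_nonneg {k : ℕ} {m : ℤ} {f : ℤ → ℝ} (h : ∀ x, 0 ≤ f x) : 0 ≤ bavg k m f :=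
  le_bavg fun x _ => h x

theorem bavg_pos {k : ℕ} {m : ℤ} {f : ℤ → ℝ} (h : ∀ x, 0 < f x) : 0 < bavg k m f := by
  induction k generalizing m with
  | zero => exact h m
  | succ k ih => rw [bavg_succ']; linarith [@ih (2 * m), @ih (2 * m + 1)]

/-- One point carries the fraction `2 ^ (-k)` of the mass. This crude bound serves only for
qualitative boundedness and for error terms. -/
theorem le_two_pow_mul_bavg {k : ℕ} {f : ℤ → ℝ} (h : ∀ x, 0 ≤ f x) (x : ℤ) :
    f x ≤ 2 ^ k * bavg k (x / 2 ^ k) f := by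
  induction k with
  | zero => simp
  | succ k ih =>
    refine ih.trans ?_
    have e := ediv_two_pow_succ x k
    rw [bavg_succ', pow_succ]
    have h2 : (0 : ℝ) < 2 ^ k := by positivity
    have hc : x / 2 ^ k = 2 * (x / 2 ^ (k + 1)) ∨ x / 2 ^ k = 2 * (x / 2 ^ (k + 1)) + 1 := by
      omega
    have hl := bavg_nonneg (k := k) (m := 2 * (x / 2 ^ (k + 1))) h
    have hr := bavg_nonneg (k := k) (m := 2 * (x / 2 ^ (k + 1)) + 1) h
    rcases hc with hc | hc <;> rw [hc] <;> nlinarith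

/-- A function that is constant on the intervals of level `i` only sees the averages over these
intervals of the other factor. -/
theorem bavg_mul_bavg {i k : ℕ} (h : i ≤ k) (m : ℤ) (φ f : ℤ → ℝ) :
    bavg k m (fun x => φ (x / 2 ^ i) * bavg i (x / 2 ^ i) f) =
      bavg k m (fun x => φ (x / 2 ^ i) * f x) := by
  rw [← bavg_bavg h m fun x => φ (x / 2 ^ i) * f x]
  congr 1; ext x
  rw [← bavg_mul_left]
  exact bavg_congr fun y hy => by rw [hy]

theorem rpow_mul_rpow_add_le {θ a b c d : ℝ} (h0 : 0 < θ) (h1 : θ < 1) (ha : 0 ≤ a) (hb : 0 ≤ b)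
    (hc : 0 ≤ c) (hd : 0 ≤ d) :
    a ^ θ * b ^ (1 - θ) + c ^ θ * d ^ (1 - θ) ≤ (a + c) ^ θ * (b + d) ^ (1 - θ) := by
  have h1' : 0 < 1 - θ := by linarith
  have hpq : Real.HolderConjugate (1 / θ) (1 / (1 - θ)) := by
    rw [Real.holderConjugate_iff]
    refine ⟨by rw [lt_div_iff₀ h0]; linarith, by simp⟩
  have := Real.inner_le_Lp_mul_Lq_of_nonneg (s := Finset.univ) (f := ![a ^ θ, c ^ θ])
    (g := ![b ^ (1 - θ), d ^ (1 - θ)]) hpq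
    (fun i _ => by fin_cases i <;> simp <;> positivity)
    (fun i _ => by fin_cases i <;> simp <;> positivity)
  simp only [Fin.sum_univ_two, Matrix.cons_val_zero, Matrix.cons_val_one, one_div, inv_inv] at this
  rwa [Real.rpow_rpow_inv ha h0.ne', Real.rpow_rpow_inv hc h0.ne', Real.rpow_rpow_inv hb h1'.ne',
    Real.rpow_rpow_inv hd h1'.ne'] at this

/-- Hölder's inequality for averages. -/
theorem bavg_rpow_mul_rpow_le {θ : ℝ} (h0 : 0 < θ) (h1 : θ < 1) {k : ℕ} {m : ℤ} {f g : ℤ → ℝ}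
    (hf : ∀ x, 0 ≤ f x) (hg : ∀ x, 0 ≤ g x) :
    bavg k m (fun x => f x ^ θ * g x ^ (1 - θ)) ≤ bavg k m f ^ θ * bavg k m g ^ (1 - θ) := by
  induction k generalizing m with
  | zero => rfl
  | succ k ih =>
    simp only [bavg_succ']
    rw [Real.div_rpow, Real.div_rpow, div_mul_div_comm, ← Real.rpow_add two_pos]
    · have := rpow_mul_rpow_add_le h0 h1 (bavg_nonneg (k := k) (m := 2 * m) hf)
        (bavg_nonneg (k := k) (m := 2 * m) hg) (bavg_nonneg (k := k) (m := 2 * m + 1) hf)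
        (bavg_nonneg (k := k) (m := 2 * m + 1) hg)
      simp only [add_sub_cancel, Real.rpow_one]
      linarith [@ih (2 * m), @ih (2 * m + 1)]
    all_goals first | positivity | exact add_nonneg (bavg_nonneg ‹_›) (bavg_nonneg ‹_›)

/-! ### The one-parameter dyadic maximal function. -/

/-- The largest of the numbers `s i I` over the intervals `I` of level `i ≤ n` that contain the
point `x`. -/
noncomputable def rmax (s : ℕ → ℤ → ℝ) : ℕ → ℤ → ℝ
  | 0, x => s 0 x
  | n + 1, x => max (rmax s n x) (s (n + 1) (x / 2 ^ (n + 1)))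

theorem le_rmax {s : ℕ → ℤ → ℝ} {i n : ℕ} (h : i ≤ n) (x : ℤ) : s i (x / 2 ^ i) ≤ rmax s n x := by
  induction n with
  | zero => obtain rfl : i = 0 := by omega
            simp [rmax]
  | succ n ih =>
    rcases Nat.le_succ_iff.1 h with h | rfl
    · exact (ih h).trans (le_max_left _ _)
    · exact le_max_right _ _

theorem rmax_le {s : ℕ → ℤ → ℝ} {n : ℕ} {x : ℤ} {c : ℝ} (h : ∀ i ≤ n, s i (x / 2 ^ i) ≤ c) :
    rmax s n x ≤ c := by
  induction n with
  | zero => simpa [rmax] using h 0 le_rfl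
  | succ n ih => exact max_le (ih fun i hi => h i (by omega)) (h _ le_rfl)

theorem rmax_nonneg {s : ℕ → ℤ → ℝ} (h : ∀ i k, 0 ≤ s i k) (n : ℕ) (x : ℤ) : 0 ≤ rmax s n x :=
  (h 0 _).trans (le_rmax (Nat.zero_le n) x)

/-- The elementary inequality behind one step of Doob's inequality. -/
theorem doob_step {q s t : ℝ} (hq : 1 < q) (hs : 0 ≤ s) (ht : 0 ≤ t) :
    q * max t s ^ q - q * (q / (q - 1)) * max t s ^ (q - 1) * s ≤
      q * t ^ q - q * (q / (q - 1)) * t ^ (q - 1) * s := by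
  rcases le_total s t with h | h
  · rw [max_eq_left h]
  · rw [max_eq_right h]
    have hq1 : 0 < q - 1 := by linarith
    have hpq : Real.HolderConjugate (q / (q - 1)) q :=
      (Real.HolderConjugate.conjExponent hq).symm
    have y := Real.young_inequality_of_nonneg (a := t ^ (q - 1)) (b := s)
      (by positivity) hs hpq
    rw [← Real.rpow_mul ht, mul_div_cancel₀ _ hq1.ne'] at y
    have e : s ^ (q - 1) * s = s ^ q := by
      rw [← Real.rpow_add_one' hs (by linarith)]; ring_nf
    have e2 : q * (q / (q - 1)) * s ^ (q - 1) * s = q * (q / (q - 1)) * s ^ q := by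
      rw [mul_assoc, e]
    rw [e2]
    have hc : 0 ≤ q * (q / (q - 1)) := by positivity
    have := mul_le_mul_of_nonneg_left y hc
    have e3 : q * (q / (q - 1)) * (t ^ q / (q / (q - 1)) + s ^ q / q) =
        q * t ^ q + (q / (q - 1)) * s ^ q := by field_simp
    rw [e3] at this
    have e4 : q / (q - 1) = 1 + 1 / (q - 1) := by field_simp; ring
    have e5 : q * (q / (q - 1)) * s ^ q = q * s ^ q + (q / (q - 1)) * s ^ q := by
      field_simp; ring
    linarith

/-- Young's inequality for `t ^ (q - 1)` and `q / (q - 1) * s`. It is the terminal condition of the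
induction in `doob_aux`. -/
theorem doob_leaf {q s t : ℝ} (hq : 1 < q) (hs : 0 ≤ s) (ht : 0 ≤ t) :
    t ^ q + q * (q / (q - 1)) * t ^ (q - 1) * s ≤ (q / (q - 1)) ^ q * s ^ q + q * t ^ q := by
  have hq1 : 0 < q - 1 := by linarith
  have hpq : Real.HolderConjugate (q / (q - 1)) q :=
    (Real.HolderConjugate.conjExponent hq).symm
  have y := Real.young_inequality_of_nonneg (a := t ^ (q - 1)) (b := (q / (q - 1)) * s)
    (by positivity) (by positivity) hpq
  rw [← Real.rpow_mul ht, mul_div_cancel₀ _ hq1.ne', Real.mul_rpow (by positivity) hs] at y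
  have := mul_le_mul_of_nonneg_left y (by linarith : 0 ≤ q)
  have e : q * (t ^ q / (q / (q - 1)) + (q / (q - 1)) ^ q * s ^ q / q) =
      (q - 1) * t ^ q + (q / (q - 1)) ^ q * s ^ q := by field_simp
  rw [e] at this
  linarith

/-- Doob's inequality for the dyadic maximal function of a weight, in the form that is proved by
induction on the generations. -/
theorem doob_aux {q : ℝ} (hq : 1 < q) {φ μ : ℤ → ℝ} (hφ : ∀ x, 0 ≤ φ x) (hμ : ∀ x, 0 < μ x)
    (n : ℕ) (m : ℤ) {t : ℝ} (ht : 0 ≤ t) :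
    bavg n m (fun x =>
        max t (rmax (fun i k => bavg i k φ / bavg i k μ) n x) ^ q * μ x) +
      q * (q / (q - 1)) * max t (bavg n m φ / bavg n m μ) ^ (q - 1) * bavg n m φ ≤
    (q / (q - 1)) ^ q * bavg n m (fun x => φ x ^ q * μ x ^ (1 - q)) +
      q * max t (bavg n m φ / bavg n m μ) ^ q * bavg n m μ := by
  induction n generalizing m t with
  | zero =>
    simp only [bavg_zero, rmax]
    have hs : 0 ≤ φ m / μ m := div_nonneg (hφ m) (hμ m).le
    have h := mul_le_mul_of_nonneg_right
      (doob_leaf hq hs (ht.trans (le_max_left t (φ m / μ m)))) (hμ m).le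
    have e : (φ m / μ m) ^ q * μ m = φ m ^ q * μ m ^ (1 - q) := by
      rw [Real.div_rpow (hφ m) (hμ m).le, Real.rpow_sub (hμ m), Real.rpow_one]; ring
    have e2 : φ m / μ m * μ m = φ m := div_mul_cancel₀ _ (hμ m).ne'
    rw [← e]
    linear_combination h + q * (q / (q - 1)) * max t (φ m / μ m) ^ (q - 1) * (-e2)
  | succ n ih =>
    set s := bavg (n + 1) m φ / bavg (n + 1) m μ with hs
    have ht' : 0 ≤ max t s := ht.trans (le_max_left _ _)
    have child : ∀ j : ℤ, (∀ x, x / 2 ^ n = j → x / 2 ^ (n + 1) = m) →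
        bavg n j (fun x =>
            max t (rmax (fun i k => bavg i k φ / bavg i k μ) (n + 1) x) ^ q * μ x) +
          q * (q / (q - 1)) * max t s ^ (q - 1) * bavg n j φ ≤
        (q / (q - 1)) ^ q * bavg n j (fun x => φ x ^ q * μ x ^ (1 - q)) +
          q * max t s ^ q * bavg n j μ := by
      intro j hj
      have h1 := ih j ht'
      have hμj : 0 < bavg n j μ := bavg_pos hμ
      have h2 := mul_le_mul_of_nonneg_right
        (doob_step hq (div_nonneg (bavg_nonneg hφ) hμj.le : 0 ≤ bavg n j φ / bavg n j μ) ht') hμj.le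
      have e2 : bavg n j φ / bavg n j μ * bavg n j μ = bavg n j φ := div_mul_cancel₀ _ hμj.ne'
      -- On a half of the interval the ratio of the parent is constant, so it can be moved into the
      -- running maximum and the induction hypothesis applies with `max t s` for `t`.
      have e3 : bavg n j (fun x =>
            max t (rmax (fun i k => bavg i k φ / bavg i k μ) (n + 1) x) ^ q * μ x) =
          bavg n j (fun x =>
            max (max t s) (rmax (fun i k => bavg i k φ / bavg i k μ) n x) ^ q * μ x) := by
        refine bavg_congr fun x hx => ?_
        rw [rmax, hj x hx, max_assoc, max_comm s]
      rw [e3]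
      set T := max (max t s) (bavg n j φ / bavg n j μ)
      linear_combination h1 + h2 + (q * (q / (q - 1)) * T ^ (q - 1) -
        q * (q / (q - 1)) * max t s ^ (q - 1)) * e2
    have hl := child (2 * m) fun x => ediv_left
    have hr := child (2 * m + 1) fun x => ediv_right
    simp only [bavg_succ' n m]
    linarith

/-- Start the induction with running maximum zero. The two boundary terms then compare in the right
direction, because `s` times the average of `μ` is the average of `φ` and `q / (q - 1) ≥ 1`. -/
theorem doob {q : ℝ} (hq : 1 < q) {φ μ : ℤ → ℝ} (hφ : ∀ x, 0 ≤ φ x) (hμ : ∀ x, 0 < μ x)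
    (n : ℕ) (m : ℤ) :
    bavg n m (fun x => rmax (fun i k => bavg i k φ / bavg i k μ) n x ^ q * μ x) ≤
      (q / (q - 1)) ^ q * bavg n m (fun x => φ x ^ q * μ x ^ (1 - q)) := by
  have h := doob_aux hq hφ hμ n m le_rfl
  have hμj : 0 < bavg n m μ := bavg_pos hμ
  set s := bavg n m φ / bavg n m μ with hs
  have hs0 : 0 ≤ s := div_nonneg (bavg_nonneg hφ) hμj.le
  have e2 : s * bavg n m μ = bavg n m φ := div_mul_cancel₀ _ hμj.ne'
  have e : s ^ (q - 1) * s = s ^ q := by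
    rw [← Real.rpow_add_one' hs0 (by linarith)]; ring_nf
  have hr : ∀ x, max 0 (rmax (fun i k => bavg i k φ / bavg i k μ) n x) =
      rmax (fun i k => bavg i k φ / bavg i k μ) n x := fun x =>
    max_eq_right (rmax_nonneg (fun i k => div_nonneg (bavg_nonneg hφ) (bavg_pos hμ).le) n x)
  simp only [hr, max_eq_right hs0] at h
  have hq' : 1 ≤ q / (q - 1) := by rw [le_div_iff₀ (by linarith)]; linarith
  have h3 : q * s ^ q * bavg n m μ ≤ q * (q / (q - 1)) * s ^ (q - 1) * bavg n m φ := by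
    rw [← e2, ← e]
    have : 0 ≤ q * (s ^ (q - 1) * s) * bavg n m μ := by positivity
    nlinarith
  linarith


/-- The operator norm bound, raised to the power `p`, for the one-parameter dyadic maximal
function on `L ^ p (w)`. -/
noncomputable def maxConst (p Q : ℝ) : ℝ :=
  Q ^ (p / (p - 1)) * ((p / (p - 1)) / (p / (p - 1) - 1)) ^ (p / (p - 1)) * (p / (p - 1)) ^ p

/-- The weighted bound for the one-parameter dyadic maximal function. -/
theorem bavg_rmax_rpow_le {p Q : ℝ} (hp : 1 < p) {n : ℕ} {w f : ℤ → ℝ} (hw : ∀ x, 0 < w x)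
    (hf : ∀ x, 0 ≤ f x)
    (hQ : ∀ i ≤ n, ∀ a, bavg i a w * bavg i a (fun x => w x ^ (-1 / (p - 1))) ^ (p - 1) ≤ Q)
    (m : ℤ) :
    bavg n m (fun x => rmax (fun i k => bavg i k f) n x ^ p * w x) ≤
      maxConst p Q * bavg n m (fun x => f x ^ p * w x) := by
  have hp1 : 0 < p - 1 := by linarith
  set σ : ℤ → ℝ := fun x => w x ^ (-1 / (p - 1)) with hσ
  have hσ0 : ∀ x, 0 < σ x := fun x => Real.rpow_pos_of_pos (hw x) _
  set r := p / (p - 1) with hr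
  have hr1 : 1 < r := by rw [hr, lt_div_iff₀ hp1]; linarith
  have hQ0 : 0 ≤ Q := le_trans (by have := (bavg_pos hw : 0 < bavg 0 0 w).le
                                   have := (bavg_pos hσ0 : 0 < bavg 0 0 σ).le
                                   positivity) (hQ 0 (Nat.zero_le n) 0)
  set Ms : ℤ → ℝ := rmax (fun i k => bavg i k f / bavg i k σ) n with hMs
  have hMs0 : ∀ x, 0 ≤ Ms x := rmax_nonneg (fun i k =>
    div_nonneg (bavg_nonneg hf) (bavg_pos hσ0).le) n
  set ψ : ℤ → ℝ := fun x => Ms x ^ (p - 1) with hψ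
  have hψ0 : ∀ x, 0 ≤ ψ x := fun x => Real.rpow_nonneg (hMs0 x) _
  set Mw : ℤ → ℝ := rmax (fun i k => bavg i k ψ / bavg i k w) n with hMw
  have hMw0 : ∀ x, 0 ≤ Mw x := rmax_nonneg (fun i k =>
    div_nonneg (bavg_nonneg hψ0) (bavg_pos hw).le) n
  -- Lerner's pointwise bound. On an interval `I` the maximal function `Ms` relative to `σ` is at
  -- least `⟨f⟩_I / ⟨σ⟩_I`, and `A_p` trades `⟨σ⟩_I ^ (p - 1)` for `Q / ⟨w⟩_I`. What remains is an
  -- average relative to `w` of `Ms ^ (p - 1)`. Doob is then used for `w` with exponent `p / (p -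
  -- 1)` and for `σ` with exponent `p`; neither application needs a weight condition.
  have key : ∀ x, rmax (fun i k => bavg i k f) n x ≤ (Q * Mw x) ^ (1 / (p - 1)) := by
    intro x
    refine rmax_le fun i hi => ?_
    have hI := hQ i hi (x / 2 ^ i)
    have hwI : 0 < bavg i (x / 2 ^ i) w := bavg_pos hw
    have hsI : 0 < bavg i (x / 2 ^ i) σ := bavg_pos hσ0
    have hfI : 0 ≤ bavg i (x / 2 ^ i) f := bavg_nonneg hf
    have h1 : (bavg i (x / 2 ^ i) f / bavg i (x / 2 ^ i) σ) ^ (p - 1) ≤ bavg i (x / 2 ^ i) ψ := by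
      refine le_bavg fun y hy => Real.rpow_le_rpow (by positivity) ?_ hp1.le
      have := le_rmax (s := fun i k => bavg i k f / bavg i k σ) hi y
      rwa [hy] at this
    have h2 : bavg i (x / 2 ^ i) ψ / bavg i (x / 2 ^ i) w ≤ Mw x :=
      le_rmax (s := fun i k => bavg i k ψ / bavg i k w) hi x
    have h3 : bavg i (x / 2 ^ i) f ^ (p - 1) ≤ Q * Mw x := by
      calc bavg i (x / 2 ^ i) f ^ (p - 1)
          = (bavg i (x / 2 ^ i) f / bavg i (x / 2 ^ i) σ) ^ (p - 1) *
              bavg i (x / 2 ^ i) σ ^ (p - 1) := by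
            rw [← Real.mul_rpow (by positivity) hsI.le, div_mul_cancel₀ _ hsI.ne']
        _ ≤ bavg i (x / 2 ^ i) ψ * (Q / bavg i (x / 2 ^ i) w) := by
            refine mul_le_mul h1 ?_ (by positivity) (bavg_nonneg hψ0)
            rw [le_div_iff₀ hwI]; linarith
        _ = Q * (bavg i (x / 2 ^ i) ψ / bavg i (x / 2 ^ i) w) := by ring
        _ ≤ _ := mul_le_mul_of_nonneg_left h2 hQ0
    calc bavg i (x / 2 ^ i) f = (bavg i (x / 2 ^ i) f ^ (p - 1)) ^ (1 / (p - 1)) := by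
          rw [one_div, Real.rpow_rpow_inv hfI hp1.ne']
      _ ≤ _ := Real.rpow_le_rpow (by positivity) h3 (by positivity)
  have hM0 : ∀ x, 0 ≤ rmax (fun i k => bavg i k f) n x := rmax_nonneg (fun i k => bavg_nonneg hf) n
  calc bavg n m (fun x => rmax (fun i k => bavg i k f) n x ^ p * w x)
      ≤ bavg n m (fun x => Q ^ r * (Mw x ^ r * w x)) := by
        refine bavg_mono fun x _ => ?_
        rw [← mul_assoc]
        refine mul_le_mul_of_nonneg_right ?_ (hw x).le
        calc _ ≤ ((Q * Mw x) ^ (1 / (p - 1))) ^ p :=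
              Real.rpow_le_rpow (hM0 x) (key x) (by linarith)
          _ = Q ^ r * Mw x ^ r := by
              rw [← Real.rpow_mul (mul_nonneg hQ0 (hMw0 x)), Real.mul_rpow hQ0 (hMw0 x), hr]
              ring_nf
    _ = Q ^ r * bavg n m (fun x => Mw x ^ r * w x) := bavg_mul_left _ _ _ _
    _ ≤ Q ^ r * ((r / (r - 1)) ^ r * bavg n m (fun x => ψ x ^ r * w x ^ (1 - r))) :=
        mul_le_mul_of_nonneg_left (doob hr1 hψ0 hw n m) (Real.rpow_nonneg hQ0 _)
    _ = Q ^ r * ((r / (r - 1)) ^ r * bavg n m (fun x => Ms x ^ p * σ x)) := by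
        congr 3; ext x
        rw [hψ, hσ]
        dsimp only
        rw [← Real.rpow_mul (hMs0 x), hr, mul_div_cancel₀ _ hp1.ne']
        congr 2; field_simp; ring
    _ ≤ Q ^ r * ((r / (r - 1)) ^ r * (r ^ p * bavg n m (fun x => f x ^ p * σ x ^ (1 - p)))) := by
        have hrr : 0 ≤ r / (r - 1) := div_nonneg (by linarith) (by linarith)
        exact mul_le_mul_of_nonneg_left (mul_le_mul_of_nonneg_left (doob hp hf hσ0 n m)
          (Real.rpow_nonneg hrr _)) (Real.rpow_nonneg hQ0 _)
    _ = _ := by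
        rw [maxConst, ← hr, mul_assoc, mul_assoc]
        congr 4; ext x
        rw [hσ]; dsimp only
        rw [← Real.rpow_mul (hw x).le]
        have : -1 / (p - 1) * (1 - p) = 1 := by field_simp; ring
        rw [this, Real.rpow_one]

/-! ### Rectangles, the grid `A_p` condition and the iterated maximal function. -/

/-- The average over the dyadic rectangle with sides `(i, a)` and `(j, b)`. -/
noncomputable def ravg {E : Type*} [AddCommGroup E] [Module ℝ E] (i : ℕ) (a : ℤ) (j : ℕ) (b : ℤ)
    (f : ℤ → ℤ → E) : E :=
  bavg i a fun x => bavg j b fun y => f x y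

section ravg

variable {i j n : ℕ} {a b : ℤ}

theorem ravg_congr {E : Type*} [AddCommGroup E] [Module ℝ E] {f g : ℤ → ℤ → E}
    (h : ∀ x y, x / 2 ^ i = a → y / 2 ^ j = b → f x y = g x y) :
    ravg i a j b f = ravg i a j b g :=
  bavg_congr fun x hx => bavg_congr fun y hy => h x y hx hy

theorem ravg_swap {E : Type*} [AddCommGroup E] [Module ℝ E] (i j : ℕ) (a b : ℤ) (f : ℤ → ℤ → E) :
    ravg i a j b f = ravg j b i a fun y x => f x y := bavg_comm _ _ _ _ _

theorem ravg_mono {f g : ℤ → ℤ → ℝ}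
    (h : ∀ x y, x / 2 ^ i = a → y / 2 ^ j = b → f x y ≤ g x y) :
    ravg i a j b f ≤ ravg i a j b g :=
  bavg_mono fun x hx => bavg_mono fun y hy => h x y hx hy

theorem ravg_nonneg {f : ℤ → ℤ → ℝ} (h : ∀ x y, 0 ≤ f x y) : 0 ≤ ravg i a j b f :=
  bavg_nonneg fun x => bavg_nonneg fun y => h x y

theorem ravg_pos {f : ℤ → ℤ → ℝ} (h : ∀ x y, 0 < f x y) : 0 < ravg i a j b f :=
  bavg_pos fun x => bavg_pos fun y => h x y

theorem ravg_mul_left (c : ℝ) (f : ℤ → ℤ → ℝ) :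
    ravg i a j b (fun x y => c * f x y) = c * ravg i a j b f := by
  simp only [ravg, bavg_mul_left]

theorem ravg_mul_right (c : ℝ) (f : ℤ → ℤ → ℝ) :
    ravg i a j b (fun x y => f x y * c) = ravg i a j b f * c := by
  simp only [ravg, bavg_mul_right]

theorem ravg_add {E : Type*} [AddCommGroup E] [Module ℝ E] (f g : ℤ → ℤ → E) :
    ravg i a j b (fun x y => f x y + g x y) = ravg i a j b f + ravg i a j b g := by
  simp only [ravg, bavg_add]

theorem ravg_sum {E ι : Type*} [AddCommGroup E] [Module ℝ E] (s : Finset ι) (f : ι → ℤ → ℤ → E) :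
    ravg i a j b (fun x y => ∑ k ∈ s, f k x y) = ∑ k ∈ s, ravg i a j b (f k) := by
  simp only [ravg, bavg_sum]

theorem ravg_map {E F : Type*} [AddCommGroup E] [Module ℝ E] [AddCommGroup F] [Module ℝ F]
    (L : E →ₗ[ℝ] F) (f : ℤ → ℤ → E) :
    ravg i a j b (fun x y => L (f x y)) = L (ravg i a j b f) := by
  simp only [ravg, bavg_map]

theorem ravg_rpow_mul_rpow_le {θ : ℝ} (h0 : 0 < θ) (h1 : θ < 1) {f g : ℤ → ℤ → ℝ}
    (hf : ∀ x y, 0 ≤ f x y) (hg : ∀ x y, 0 ≤ g x y) :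
    ravg i a j b (fun x y => f x y ^ θ * g x y ^ (1 - θ)) ≤
      ravg i a j b f ^ θ * ravg i a j b g ^ (1 - θ) :=
  (bavg_mono fun x _ => bavg_rpow_mul_rpow_le h0 h1 (hf x) (hg x)).trans
    (bavg_rpow_mul_rpow_le h0 h1 (fun x => bavg_nonneg (hf x)) fun x => bavg_nonneg (hg x))

theorem le_four_pow_mul_ravg {f : ℤ → ℤ → ℝ} (h : ∀ x y, 0 ≤ f x y) (x y : ℤ) :
    f x y ≤ 2 ^ n * (2 ^ n * ravg n (x / 2 ^ n) n (y / 2 ^ n) f) :=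
  (le_two_pow_mul_bavg (k := n) (h x) y).trans <| mul_le_mul_of_nonneg_left
    (le_two_pow_mul_bavg (f := fun x => bavg n (y / 2 ^ n) (f x))
      (fun x => bavg_nonneg (h x)) x) (by positivity)

theorem ravg_mul_ravg (hi : i ≤ n) (hj : j ≤ n) (φ : ℤ → ℤ → ℝ) (f : ℤ → ℤ → ℝ) :
    ravg n a n b (fun x y => φ (x / 2 ^ i) (y / 2 ^ j) * ravg i (x / 2 ^ i) j (y / 2 ^ j) f) =
      ravg n a n b (fun x y => φ (x / 2 ^ i) (y / 2 ^ j) * f x y) := by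
  have h1 : ∀ x, bavg n b (fun y => φ (x / 2 ^ i) (y / 2 ^ j) *
      ravg i (x / 2 ^ i) j (y / 2 ^ j) f) =
      bavg n b (fun y => φ (x / 2 ^ i) (y / 2 ^ j) * bavg i (x / 2 ^ i) (fun x' => f x' y)) := by
    intro x
    rw [← bavg_mul_bavg hj b (φ (x / 2 ^ i)) fun y => bavg i (x / 2 ^ i) (fun x' => f x' y)]
    congr 1; ext y; rw [ravg, bavg_comm]
  simp only [ravg] at h1 ⊢
  simp_rw [h1]
  rw [bavg_comm, bavg_comm (f := fun x y => φ (x / 2 ^ i) (y / 2 ^ j) * f x y)]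
  congr 1; ext y
  exact bavg_mul_bavg hi a (fun a' => φ a' (y / 2 ^ j)) fun x => f x y

theorem continuous_bavg {k : ℕ} {m : ℤ} {f : ℝ → ℤ → ℝ} (h : ∀ x, Continuous fun e => f e x) :
    Continuous fun e => bavg k m (f e) := by
  induction k generalizing m with
  | zero => exact h m
  | succ k ih =>
    simp only [bavg_succ']
    exact (ih.add ih).div_const 2

theorem continuous_ravg {f : ℝ → ℤ → ℤ → ℝ} (h : ∀ x y, Continuous fun e => f e x y) :
    Continuous fun e => ravg i a j b (f e) :=
  continuous_bavg fun x => continuous_bavg fun y => h x y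

end ravg

/-- The dyadic `A_p` condition on a grid of cells, for rectangles of side length at most
`2 ^ n`. -/
def IsGridAp (n : ℕ) (p Q : ℝ) (w : ℤ → ℤ → ℝ) : Prop :=
  ∀ i ≤ n, ∀ j ≤ n, ∀ a b, ravg i a j b w *
    ravg i a j b (fun x y => w x y ^ (-1 / (p - 1))) ^ (p - 1) ≤ Q

/-- Raise the condition to the power `1 / (p - 1)`. The two averages trade places, since the dual of
the dual weight is `w`. -/
theorem IsGridAp.dual {n : ℕ} {p Q : ℝ} {w : ℤ → ℤ → ℝ} (hp : 1 < p) (hw : ∀ x y, 0 < w x y)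
    (h : IsGridAp n p Q w) :
    IsGridAp n (p / (p - 1)) (Q ^ (1 / (p - 1))) (fun x y => w x y ^ (-1 / (p - 1))) := by
  intro i hi j hj a b
  have hp1 : 0 < p - 1 := by linarith
  have e : p / (p - 1) - 1 = 1 / (p - 1) := by field_simp; ring
  have e2 : ∀ x y, (w x y ^ (-1 / (p - 1))) ^ (-1 / (p / (p - 1) - 1)) = w x y := fun x y => by
    rw [e, ← Real.rpow_mul (hw x y).le]
    have : -1 / (p - 1) * (-1 / (1 / (p - 1))) = 1 := by field_simp
    rw [this, Real.rpow_one]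
  simp_rw [e2, e]
  have hσ : 0 < ravg i a j b (fun x y => w x y ^ (-1 / (p - 1))) :=
    ravg_pos fun x y => Real.rpow_pos_of_pos (hw x y) _
  have hw' : 0 < ravg i a j b w := ravg_pos hw
  have := Real.rpow_le_rpow (by positivity) (h i hi j hj a b) (one_div_nonneg.2 hp1.le)
  rwa [Real.mul_rpow hw'.le (by positivity), ← Real.rpow_mul hσ.le, mul_one_div_cancel hp1.ne',
    Real.rpow_one, mul_comm] at this

/-- The iterated dyadic maximal function on a grid of cells. -/
noncomputable def smax (n : ℕ) (f : ℤ → ℤ → ℝ) (x y : ℤ) : ℝ :=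
  rmax (fun i a => bavg i a fun x' => rmax (fun j b => bavg j b (f x')) n y) n x

section smax

variable {n : ℕ} {f g : ℤ → ℤ → ℝ}

/-- Averages and maxima are monotone and commute with adding constants. This is the sup-norm
Lipschitz bound behind the contraction in `exists_majorant`. -/
theorem smax_le_add {c : ℝ} (h : ∀ x y, f x y ≤ g x y + c) (x y : ℤ) :
    smax n f x y ≤ smax n g x y + c := by
  have h1 : ∀ x', rmax (fun j b => bavg j b (f x')) n y ≤
      rmax (fun j b => bavg j b (g x')) n y + c := by
    refine fun x' => rmax_le fun j hj => ?_
    calc bavg j (y / 2 ^ j) (f x') ≤ bavg j (y / 2 ^ j) (fun y => g x' y + c) :=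
          bavg_mono fun y _ => h x' y
      _ = bavg j (y / 2 ^ j) (g x') + c := by rw [bavg_add, bavg_const]
      _ ≤ _ := by gcongr; exact le_rmax (s := fun j b => bavg j b (g x')) hj y
  refine rmax_le fun i hi => ?_
  refine (bavg_mono fun x' _ => h1 x').trans ?_
  rw [bavg_add, bavg_const, smax]
  gcongr
  exact le_rmax (s := fun i a => bavg i a fun x' => rmax (fun j b => bavg j b (g x')) n y) hi x

theorem smax_le {c : ℝ} (h : ∀ x y, f x y ≤ c) (x y : ℤ) : smax n f x y ≤ c :=
  rmax_le fun _ _ => bavg_le fun _ _ => rmax_le fun _ _ => bavg_le fun _ _ => h _ _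

theorem ravg_le_smax {i j : ℕ} (hi : i ≤ n) (hj : j ≤ n) (f : ℤ → ℤ → ℝ) (x y : ℤ) :
    ravg i (x / 2 ^ i) j (y / 2 ^ j) f ≤ smax n f x y := by
  refine le_trans (bavg_mono fun x' _ => ?_)
    (le_rmax (s := fun i a => bavg i a fun x' => rmax (fun j b => bavg j b (f x')) n y) hi x)
  exact le_rmax (s := fun j b => bavg j b (f x')) hj y

theorem smax_nonneg (h : ∀ x y, 0 ≤ f x y) (x y : ℤ) : 0 ≤ smax n f x y :=
  (h _ _).trans (ravg_le_smax (Nat.zero_le n) (Nat.zero_le n) f x y)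

theorem maxConst_nonneg {p Q : ℝ} (hp : 1 < p) (hQ : 0 ≤ Q) : 0 ≤ maxConst p Q := by
  have hp1 : 0 < p - 1 := by linarith
  have hr : 0 < p / (p - 1) - 1 := by
    have : p / (p - 1) - 1 = 1 / (p - 1) := by field_simp; ring
    rw [this]; positivity
  have : 0 < p / (p - 1) := by positivity
  unfold maxConst
  positivity

theorem IsGridAp.nonneg {p Q : ℝ} {w : ℤ → ℤ → ℝ} (hw : ∀ x y, 0 < w x y)
    (h : IsGridAp n p Q w) : 0 ≤ Q :=
  (mul_nonneg (ravg_pos hw).le (Real.rpow_nonneg (ravg_nonneg fun x y =>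
    (Real.rpow_nonneg (hw x y).le _)) _)).trans (h 0 (Nat.zero_le n) 0 (Nat.zero_le n) 0 0)

/-- The weighted bound for the iterated dyadic maximal function. -/
theorem ravg_smax_rpow_le {p Q : ℝ} (hp : 1 < p) {w : ℤ → ℤ → ℝ} (hw : ∀ x y, 0 < w x y)
    (hf : ∀ x y, 0 ≤ f x y) (hQ : IsGridAp n p Q w) (m m' : ℤ) :
    ravg n m n m' (fun x y => smax n f x y ^ p * w x y) ≤
      maxConst p Q ^ 2 * ravg n m n m' (fun x y => f x y ^ p * w x y) := by
  have hK := maxConst_nonneg hp (hQ.nonneg hw)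
  -- Rectangles of side one in one variable are slices, so `w` satisfies the one-parameter `A_p`
  -- condition with the same constant on every line.
  have h1 : ∀ x, bavg n m' (fun y => rmax (fun j b => bavg j b (f x)) n y ^ p * w x y) ≤
      maxConst p Q * bavg n m' (fun y => f x y ^ p * w x y) := fun x =>
    bavg_rmax_rpow_le hp (hw x) (hf x) (fun j hj b => hQ 0 (Nat.zero_le n) j hj x b) m'
  have h2 : ∀ y, bavg n m (fun x => smax n f x y ^ p * w x y) ≤
      maxConst p Q * bavg n m (fun x => rmax (fun j b => bavg j b (f x)) n y ^ p * w x y) :=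
    fun y => bavg_rmax_rpow_le hp (fun x => hw x y)
      (fun x => rmax_nonneg (fun i k => bavg_nonneg (hf x)) n y)
      (fun i hi a => hQ i hi 0 (Nat.zero_le n) a y) m
  calc ravg n m n m' (fun x y => smax n f x y ^ p * w x y)
      = bavg n m' fun y => bavg n m fun x => smax n f x y ^ p * w x y := bavg_comm _ _ _ _ _
    _ ≤ bavg n m' fun y => maxConst p Q *
          bavg n m (fun x => rmax (fun j b => bavg j b (f x)) n y ^ p * w x y) :=
        bavg_mono fun y _ => h2 y
    _ = maxConst p Q * bavg n m fun x => bavg n m' fun y =>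
          rmax (fun j b => bavg j b (f x)) n y ^ p * w x y := by
        rw [bavg_mul_left, bavg_comm]
    _ ≤ maxConst p Q * bavg n m fun x => maxConst p Q * bavg n m' fun y => f x y ^ p * w x y :=
        mul_le_mul_of_nonneg_left (bavg_mono fun x _ => h1 x) hK
    _ = _ := by rw [bavg_mul_left, ravg]; ring

end smax

/-! ### Rubio de Francia extrapolation on the grid. -/

/-- A bound for the norm of the iterated dyadic maximal function on `L ^ p (w)`. -/
noncomputable def smaxConst (p Q : ℝ) : ℝ := max 1 (maxConst p Q ^ 2)

theorem add_rpow_le_two_rpow_mul {p a b : ℝ} (hp : 1 ≤ p) (ha : 0 ≤ a) (hb : 0 ≤ b) :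
    (a + b) ^ p ≤ 2 ^ (p - 1) * (a ^ p + b ^ p) := by
  have := NNReal.rpow_add_le_mul_rpow_add_rpow ⟨a, ha⟩ ⟨b, hb⟩ hp
  exact_mod_cast this

/-- Rubio de Francia's iteration: every function has an `A_1` majorant with comparable norm. -/
theorem exists_majorant {p Q : ℝ} (hp : 1 < p) {n : ℕ} {w g : ℤ → ℤ → ℝ} (hw : ∀ x y, 0 < w x y)
    (hQ : IsGridAp n p Q w) {δ B : ℝ} (hδ : 0 < δ) (hg : ∀ x y, δ ≤ g x y)
    (hB : ∀ x y, g x y ≤ B) (m m' : ℤ) :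
    ∃ G : ℤ → ℤ → ℝ, (∀ x y, g x y ≤ G x y) ∧
      (∀ x y, smax n G x y ≤ 8 * smaxConst p Q * G x y) ∧
      ravg n m n m' (fun x y => G x y ^ p * w x y) ≤
        2 ^ p * ravg n m n m' (fun x y => g x y ^ p * w x y) := by
  set A := smaxConst p Q with hA
  have hA1 : 1 ≤ A := le_max_left _ _
  have hg0 : ∀ x y, 0 ≤ g x y := fun x y => hδ.le.trans (hg x y)
  have hB0 : 0 < B := hδ.trans_le ((hg 0 0).trans (hB 0 0))
  -- In place of an infinite series, a finite iteration of `h ↦ g + smax n h / (4 * A)`. This map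
  -- contracts the sup norm by at least `1 / 4`, so an iterate that is almost fixed suffices.
  let G : ℕ → ℤ → ℤ → ℝ := fun j => Nat.rec g (fun _ h x y => g x y + 1 / (4 * A) * smax n h x y) j
  have hG0 : G 0 = g := rfl
  have hGs : ∀ j x y, G (j + 1) x y = g x y + 1 / (4 * A) * smax n (G j) x y := fun j x y => rfl
  have hpos : ∀ j x y, 0 ≤ G j x y := by
    intro j
    induction j with
    | zero => exact hg0
    | succ j ih =>
      intro x y
      rw [hGs]
      have := smax_nonneg (n := n) ih x y
      have := hg0 x y
      positivity
  have hgG : ∀ j x y, g x y ≤ G j x y := by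
    intro j x y
    cases j with
    | zero => exact le_rfl
    | succ j =>
      rw [hGs]
      have := smax_nonneg (n := n) (hpos j) x y
      have : 0 ≤ 1 / (4 * A) * smax n (G j) x y := by positivity
      linarith
  have hinc : ∀ j x y, G (j + 1) x y ≤ G j x y + (1 / 4) ^ j * B := by
    intro j
    have h4 : 1 / (4 * A) ≤ 1 / 4 := by
      apply one_div_le_one_div_of_le <;> linarith
    induction j with
    | zero =>
      intro x y
      rw [hGs, hG0]
      have := smax_le (n := n) hB x y
      have h0 := smax_nonneg (n := n) hg0 x y
      have : 1 / (4 * A) * smax n g x y ≤ 1 / 4 * B := mul_le_mul h4 this h0 (by norm_num)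
      rw [pow_zero, one_mul]
      linarith
    | succ j ih =>
      intro x y
      rw [hGs (j + 1), hGs j]
      have := smax_le_add (n := n) ih x y
      have hc : 0 ≤ (1 / 4 : ℝ) ^ j * B := by positivity
      have h5 : 1 / (4 * A) * smax n (G (j + 1)) x y ≤
          1 / (4 * A) * (smax n (G j) x y + (1 / 4) ^ j * B) :=
        mul_le_mul_of_nonneg_left this (by positivity)
      have h6 := mul_le_mul_of_nonneg_right h4 hc
      rw [pow_succ]
      linarith
  have hnorm : ∀ j, ravg n m n m' (fun x y => G j x y ^ p * w x y) ≤
      2 ^ p * ravg n m n m' (fun x y => g x y ^ p * w x y) := by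
    intro j
    have hX : 0 ≤ ravg n m n m' (fun x y => g x y ^ p * w x y) :=
      ravg_nonneg fun x y => mul_nonneg (Real.rpow_nonneg (hg0 x y) _) (hw x y).le
    induction j with
    | zero =>
      have : (1 : ℝ) ≤ 2 ^ p := Real.one_le_rpow (by norm_num) (by linarith)
      exact le_mul_of_one_le_left hX this
    | succ j ih =>
      have hY : 0 ≤ ravg n m n m' (fun x y => G j x y ^ p * w x y) :=
        ravg_nonneg fun x y => mul_nonneg (Real.rpow_nonneg (hpos j x y) _) (hw x y).le
      have hM := ravg_smax_rpow_le hp hw (hpos j) hQ m m'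
      have hpt : ∀ x y, G (j + 1) x y ^ p * w x y ≤ 2 ^ (p - 1) * (g x y ^ p * w x y) +
          2 ^ (p - 1) * (1 / (4 * A)) ^ p * (smax n (G j) x y ^ p * w x y) := by
        intro x y
        have h0 := smax_nonneg (n := n) (hpos j) x y
        have := add_rpow_le_two_rpow_mul hp.le (hg0 x y)
          (show 0 ≤ 1 / (4 * A) * smax n (G j) x y by positivity)
        rw [Real.mul_rpow (z := p) (by positivity) h0] at this
        rw [hGs]
        have := mul_le_mul_of_nonneg_right this (hw x y).le
        linarith
      have hstep := ravg_mono (i := n) (j := n) (a := m) (b := m') fun x y _ _ => hpt x y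
      rw [ravg_add, ravg_mul_left, ravg_mul_left] at hstep
      -- Since `A` is at least one, `A ^ p` dominates `maxConst p Q ^ 2`. The factor `1 / 2` closes
      -- the induction: `2 ^ (p - 1) + 2 ^ p / 2 = 2 ^ p`.
      have hc : 2 ^ (p - 1) * (1 / (4 * A)) ^ p * maxConst p Q ^ 2 ≤ 1 / 2 := by
        have h1 : maxConst p Q ^ 2 ≤ A ^ p :=
          (le_max_right _ _).trans (Real.self_le_rpow_of_one_le hA1 hp.le)
        have h2 : 2 ^ (p - 1) * (1 / (4 * A)) ^ p * A ^ p = 2 ^ (p - 1) * (1 / 4) ^ p := by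
          rw [mul_assoc, ← Real.mul_rpow (by positivity) (by positivity)]
          congr 2; field_simp
        have h3 : (2 : ℝ) ^ (p - 1) * (1 / 4) ^ p ≤ 1 / 2 := by
          rw [Real.rpow_sub_one (by norm_num), div_mul_eq_mul_div,
            ← Real.mul_rpow (by norm_num) (by norm_num)]
          have : ((2 : ℝ) * (1 / 4)) ^ p ≤ 1 :=
            Real.rpow_le_one (by norm_num) (by norm_num) (by linarith)
          linarith
        refine (mul_le_mul_of_nonneg_left h1 (by positivity)).trans ?_
        rw [h2]; exact h3
      have e2 : (2 : ℝ) ^ p = 2 * 2 ^ (p - 1) := by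
        rw [Real.rpow_sub_one (by norm_num)]; ring
      have h4 := mul_le_mul_of_nonneg_left hM
        (show 0 ≤ (2 : ℝ) ^ (p - 1) * (1 / (4 * A)) ^ p by positivity)
      have h5 := mul_le_mul_of_nonneg_right hc hY
      rw [e2] at ih ⊢
      linarith
  -- Stop when the increment is below `δ`. As `δ ≤ g`, the error is absorbed by the function itself.
  obtain ⟨j, hj⟩ := exists_pow_lt_of_lt_one (show 0 < δ / B by positivity)
    (show (1 / 4 : ℝ) < 1 by norm_num)
  refine ⟨G j, hgG j, fun x y => ?_, hnorm j⟩
  have h1 : (1 / 4) ^ j * B ≤ δ := by rw [lt_div_iff₀ hB0] at hj; exact hj.le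
  have h2 := hinc j x y
  rw [hGs] at h2
  have h3 := hgG j x y
  have h4 := hg x y
  have h5 : 1 / (4 * A) * smax n (G j) x y ≤ 2 * G j x y := by linarith [hg0 x y]
  rw [one_div, inv_mul_le_iff₀ (by positivity)] at h5
  linarith


/-- The quotient of two `A_1` weights is an `A_2` weight. -/
theorem isGridAp_two_div {n : ℕ} {K R : ℤ → ℤ → ℝ} {c d : ℝ}
    (hK : ∀ x y, 0 < K x y) (hR : ∀ x y, 0 < R x y) (hd : 0 < d) (hc : 0 < c)
    (hKc : ∀ x y, smax n K x y ≤ c * K x y) (hRd : ∀ x y, smax n R x y ≤ d * R x y) :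
    IsGridAp n 2 (c * d) (fun x y => K x y / R x y) := by
  intro i hi j hj a b
  have hRR : 0 < ravg i a j b R := ravg_pos hR
  have hKK : 0 < ravg i a j b K := ravg_pos hK
  have h1 : ravg i a j b (fun x y => K x y / R x y) ≤ ravg i a j b K * (d / ravg i a j b R) := by
    rw [← ravg_mul_right]
    refine ravg_mono fun x y hx hy => ?_
    have := (ravg_le_smax hi hj R x y).trans (hRd x y)
    rw [hx, hy] at this
    rw [div_eq_mul_inv]
    refine mul_le_mul_of_nonneg_left ?_ (hK x y).le
    rw [inv_eq_one_div, div_le_div_iff₀ (hR x y) hRR]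
    linarith
  have h2 : ravg i a j b (fun x y => (K x y / R x y) ^ (-1 / (2 - 1) : ℝ)) ≤
      ravg i a j b R * (c / ravg i a j b K) := by
    rw [← ravg_mul_right]
    refine ravg_mono fun x y hx hy => ?_
    have := (ravg_le_smax hi hj K x y).trans (hKc x y)
    rw [hx, hy] at this
    have e : (-1 / (2 - 1) : ℝ) = -1 := by norm_num
    rw [e, Real.rpow_neg_one, inv_div, div_eq_mul_inv]
    refine mul_le_mul_of_nonneg_left ?_ (hR x y).le
    rw [inv_eq_one_div, div_le_div_iff₀ (hK x y) hKK]
    linarith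
  have e : (2 - 1 : ℝ) = 1 := by norm_num
  have h3 : 0 ≤ ravg i a j b (fun x y => (K x y / R x y) ^ (-1 / (2 - 1) : ℝ)) :=
    ravg_nonneg fun x y => Real.rpow_nonneg (div_nonneg (hK x y).le (hR x y).le) _
  rw [e, Real.rpow_one]
  simp only [e] at h2 h3 ⊢
  change ravg i a j b (fun x y => K x y / R x y) *
    ravg i a j b (fun x y => (K x y / R x y) ^ (-1 / 1 : ℝ)) ≤ _
  calc _ ≤ (ravg i a j b K * (d / ravg i a j b R)) * (ravg i a j b R * (c / ravg i a j b K)) :=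
        mul_le_mul h1 h2 h3 (by positivity)
    _ = c * d := by field_simp

/-- The bound for the characteristic of the auxiliary `A_2` weights in the extrapolation
theorem. -/
noncomputable def extraConst (p Q : ℝ) : ℝ :=
  (8 * smaxConst (p / (p - 1)) (Q ^ (1 / (p - 1)))) * (8 * smaxConst p Q)

theorem smaxConst_pos (p Q : ℝ) : 0 < smaxConst p Q :=
  zero_lt_one.trans_le (le_max_left _ _)

/-- Hölder's inequality between `L ^ p (w)` and its dual. -/
theorem ravg_mul_le {p : ℝ} (hp : 1 < p) {i j : ℕ} {a b : ℤ} {w f g : ℤ → ℤ → ℝ}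
    (hw : ∀ x y, 0 < w x y) (hf : ∀ x y, 0 ≤ f x y) (hg : ∀ x y, 0 ≤ g x y) :
    ravg i a j b (fun x y => f x y * g x y) ≤
      ravg i a j b (fun x y => f x y ^ p * w x y) ^ (1 / p) *
        ravg i a j b (fun x y => g x y ^ (p / (p - 1)) * w x y ^ (-1 / (p - 1))) ^ (1 - 1 / p) := by
  have hp1 : 0 < p - 1 := by linarith
  have hp0 : 0 < p := by linarith
  have h := ravg_rpow_mul_rpow_le (i := i) (j := j) (a := a) (b := b) (θ := 1 / p)
    (f := fun x y => f x y ^ p * w x y)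
    (g := fun x y => g x y ^ (p / (p - 1)) * w x y ^ (-1 / (p - 1)))
    (by positivity) (by rw [div_lt_one hp0]; exact hp)
    (fun x y => mul_nonneg (Real.rpow_nonneg (hf x y) _) (hw x y).le)
    (fun x y => mul_nonneg (Real.rpow_nonneg (hg x y) _) (Real.rpow_nonneg (hw x y).le _))
  refine le_trans (le_of_eq (ravg_congr fun x y _ _ => ?_)) h
  have hwx := hw x y
  have hfx := hf x y
  have hgx := hg x y
  rw [Real.mul_rpow (by positivity) hwx.le, Real.mul_rpow (by positivity) (by positivity),
    ← Real.rpow_mul hfx, ← Real.rpow_mul hgx, ← Real.rpow_mul hwx.le,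
    mul_one_div_cancel hp0.ne', Real.rpow_one]
  have e1 : p / (p - 1) * (1 - 1 / p) = 1 := by field_simp
  have e2 : -1 / (p - 1) * (1 - 1 / p) = -(1 / p) := by field_simp
  rw [e1, e2, Real.rpow_one, Real.rpow_neg hwx.le]
  have : w x y ^ (1 / p) ≠ 0 := (Real.rpow_pos_of_pos hwx _).ne'
  field_simp

/-- Let `R` and `K` be the majorants of `g` in `L ^ p (w)` and of `k` in the dual space. Then `K /
R` is an `A_2` weight. Cauchy–Schwarz for `F * K = (F * (K / R) ^ (1 / 2)) * (R * K) ^ (1 / 2)` and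
the assumed `L ^ 2` bound reduce the claim to the pairing of `R` and `K`, because `G ≤ R` gives `G ^
2 * (K / R) ≤ R * K`. Each majorant costs a factor `2` in norm, whence `4`. Exponents below and
above `2` are treated alike. -/
theorem extrapolation_bilinear {p Q N : ℝ} (hp : 1 < p) (hN : 0 ≤ N) {n : ℕ}
    {w F G g k : ℤ → ℤ → ℝ} (hw : ∀ x y, 0 < w x y) (hQ : IsGridAp n p Q w)
    (hF : ∀ x y, 0 ≤ F x y) (hG : ∀ x y, 0 ≤ G x y) {m m' : ℤ}
    (h : ∀ W : ℤ → ℤ → ℝ, (∀ x y, 0 < W x y) → IsGridAp n 2 (extraConst p Q) W →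
      ravg n m n m' (fun x y => F x y ^ 2 * W x y) ≤
        N * ravg n m n m' (fun x y => G x y ^ 2 * W x y))
    {δ B : ℝ} (hδ : 0 < δ) (hg : ∀ x y, δ ≤ g x y) (hgB : ∀ x y, g x y ≤ B)
    (hk : ∀ x y, δ ≤ k x y) (hkB : ∀ x y, k x y ≤ B)
    (hGg : ∀ x y, x / 2 ^ n = m → y / 2 ^ n = m' → G x y ≤ g x y) :
    ravg n m n m' (fun x y => F x y * k x y) ≤ 4 * √N *
      (ravg n m n m' (fun x y => g x y ^ p * w x y) ^ (1 / p) *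
        ravg n m n m' (fun x y => k x y ^ (p / (p - 1)) * w x y ^ (-1 / (p - 1))) ^
          (1 - 1 / p)) := by
  have hp1 : 0 < p - 1 := by linarith
  have hp0 : 0 < p := by linarith
  have hp' : 1 < p / (p - 1) := by rw [lt_div_iff₀ hp1]; linarith
  have hσ : ∀ x y, 0 < w x y ^ (-1 / (p - 1)) := fun x y => Real.rpow_pos_of_pos (hw x y) _
  obtain ⟨R, hgR, hRs, hRn⟩ := exists_majorant hp hw hQ hδ hg hgB m m'
  obtain ⟨K, hkK, hKs, hKn⟩ := exists_majorant hp' hσ (hQ.dual hp hw) hδ hk hkB m m'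
  have hR0 : ∀ x y, 0 < R x y := fun x y => hδ.trans_le ((hg x y).trans (hgR x y))
  have hK0 : ∀ x y, 0 < K x y := fun x y => hδ.trans_le ((hk x y).trans (hkK x y))
  have hW := h (fun x y => K x y / R x y) (fun x y => div_pos (hK0 x y) (hR0 x y))
    (isGridAp_two_div hK0 hR0 (by have := smaxConst_pos p Q; positivity)
      (by have := smaxConst_pos (p / (p - 1)) (Q ^ (1 / (p - 1))); positivity) hKs hRs)
  set T := ravg n m n m' (fun x y => R x y * K x y) with hT
  have hT0 : 0 ≤ T := ravg_nonneg fun x y => (mul_pos (hR0 x y) (hK0 x y)).le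
  have hGT : ravg n m n m' (fun x y => G x y ^ 2 * (K x y / R x y)) ≤ T := by
    refine ravg_mono fun x y hx hy => ?_
    have h1 : G x y ^ 2 ≤ R x y ^ 2 :=
      pow_le_pow_left₀ (hG x y) ((hGg x y hx hy).trans (hgR x y)) 2
    refine (mul_le_mul_of_nonneg_right h1 (div_pos (hK0 x y) (hR0 x y)).le).trans_eq ?_
    have := (hR0 x y).ne'
    field_simp
  have hFK : ravg n m n m' (fun x y => F x y * K x y) ≤ √N * T := by
    have hcs := ravg_rpow_mul_rpow_le (i := n) (j := n) (a := m) (b := m') (θ := 1 / 2)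
      (f := fun x y => F x y ^ 2 * (K x y / R x y)) (g := fun x y => R x y * K x y)
      (by norm_num) (by norm_num)
      (fun x y => mul_nonneg (sq_nonneg _) (div_pos (hK0 x y) (hR0 x y)).le)
      (fun x y => (mul_pos (hR0 x y) (hK0 x y)).le)
    have e : (1 - 1 / 2 : ℝ) = 1 / 2 := by norm_num
    rw [e] at hcs
    refine le_trans (le_of_eq (ravg_congr fun x y _ _ => ?_)) (hcs.trans ?_)
    · have h1 := hR0 x y
      have h2 := hK0 x y
      have h3 := hF x y
      rw [← Real.mul_rpow (by positivity) (by positivity), ← Real.sqrt_eq_rpow]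
      have : F x y ^ 2 * (K x y / R x y) * (R x y * K x y) = (F x y * K x y) ^ 2 := by
        field_simp
      rw [this, Real.sqrt_sq (by positivity)]
    · rw [← Real.mul_rpow (ravg_nonneg fun x y =>
        mul_nonneg (sq_nonneg _) (div_pos (hK0 x y) (hR0 x y)).le) hT0, ← Real.sqrt_eq_rpow]
      refine (Real.sqrt_le_sqrt (mul_le_mul_of_nonneg_right
        (hW.trans (mul_le_mul_of_nonneg_left hGT hN)) hT0)).trans_eq ?_
      rw [mul_assoc, Real.sqrt_mul hN, Real.sqrt_mul_self hT0]
  have hTle := ravg_mul_le (i := n) (j := n) (a := m) (b := m') hp hw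
    (fun x y => (hR0 x y).le) (fun x y => (hK0 x y).le)
  have hg0 : 0 ≤ ravg n m n m' (fun x y => g x y ^ p * w x y) := ravg_nonneg fun x y =>
    mul_nonneg (Real.rpow_nonneg (hδ.le.trans (hg x y)) _) (hw x y).le
  have hk0 : 0 ≤ ravg n m n m' (fun x y => k x y ^ (p / (p - 1)) * w x y ^ (-1 / (p - 1))) :=
    ravg_nonneg fun x y => mul_nonneg (Real.rpow_nonneg (hδ.le.trans (hk x y)) _) (hσ x y).le
  have h1 : ravg n m n m' (fun x y => R x y ^ p * w x y) ^ (1 / p) ≤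
      2 * ravg n m n m' (fun x y => g x y ^ p * w x y) ^ (1 / p) := by
    refine (Real.rpow_le_rpow (ravg_nonneg fun x y =>
      mul_nonneg (Real.rpow_nonneg (hR0 x y).le _) (hw x y).le) hRn (by positivity)).trans_eq ?_
    rw [Real.mul_rpow (by positivity) hg0, ← Real.rpow_mul (by norm_num),
      mul_one_div_cancel hp0.ne', Real.rpow_one]
  have hθ : 0 < 1 - 1 / p := by rw [sub_pos, div_lt_one hp0]; exact hp
  have h2 : ravg n m n m' (fun x y => K x y ^ (p / (p - 1)) * w x y ^ (-1 / (p - 1))) ^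
        (1 - 1 / p) ≤
      2 * ravg n m n m' (fun x y => k x y ^ (p / (p - 1)) * w x y ^ (-1 / (p - 1))) ^
        (1 - 1 / p) := by
    refine (Real.rpow_le_rpow (ravg_nonneg fun x y =>
      mul_nonneg (Real.rpow_nonneg (hK0 x y).le _) (hσ x y).le) hKn hθ.le).trans_eq ?_
    rw [Real.mul_rpow (by positivity) hk0, ← Real.rpow_mul (by norm_num)]
    have e1 : p / (p - 1) * (1 - 1 / p) = 1 := by field_simp
    rw [e1, Real.rpow_one]
  calc ravg n m n m' (fun x y => F x y * k x y)
      ≤ ravg n m n m' (fun x y => F x y * K x y) :=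
        ravg_mono fun x y _ _ => mul_le_mul_of_nonneg_left (hkK x y) (hF x y)
    _ ≤ √N * T := hFK
    _ ≤ √N * ((2 * ravg n m n m' (fun x y => g x y ^ p * w x y) ^ (1 / p)) *
          (2 * ravg n m n m' (fun x y => k x y ^ (p / (p - 1)) * w x y ^ (-1 / (p - 1))) ^
            (1 - 1 / p))) := by
        refine mul_le_mul_of_nonneg_left (hTle.trans ?_) (Real.sqrt_nonneg _)
        exact mul_le_mul h1 h2 (Real.rpow_nonneg (ravg_nonneg fun x y =>
          mul_nonneg (Real.rpow_nonneg (hK0 x y).le _) (hσ x y).le) _) (by positivity)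
    _ = _ := by ring

/-- An elementary absorption. -/
theorem le_rpow_mul_of_le {p c X Y : ℝ} (hp : 1 < p) (hc : 0 ≤ c) (hX : 0 ≤ X) (hY : 0 ≤ Y)
    (h : X ≤ c * (Y ^ (1 / p) * X ^ (1 - 1 / p))) : X ≤ c ^ p * Y := by
  have hp0 : 0 < p := by linarith
  rcases hX.eq_or_lt with rfl | hX
  · positivity
  have h1 : X ^ (1 / p) ≤ c * Y ^ (1 / p) := by
    have hpos : 0 < X ^ (1 - 1 / p) := Real.rpow_pos_of_pos hX _
    refine le_of_mul_le_mul_right ?_ hpos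
    rw [← Real.rpow_add hX, add_sub_cancel, Real.rpow_one]
    linarith
  calc X = (X ^ (1 / p)) ^ p := by rw [one_div, Real.rpow_inv_rpow hX.le hp0.ne']
    _ ≤ (c * Y ^ (1 / p)) ^ p := Real.rpow_le_rpow (by positivity) h1 hp0.le
    _ = _ := by
      rw [Real.mul_rpow hc (by positivity), one_div, Real.rpow_inv_rpow hY hp0.ne']

/-- Rubio de Francia extrapolation from `p = 2` on a grid of cells. -/
theorem extrapolation {p Q N : ℝ} (hp : 1 < p) (hN : 0 ≤ N) {n : ℕ}
    {w F G : ℤ → ℤ → ℝ} (hw : ∀ x y, 0 < w x y) (hQ : IsGridAp n p Q w)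
    (hF : ∀ x y, 0 ≤ F x y) (hG : ∀ x y, 0 ≤ G x y) {m m' : ℤ}
    (h : ∀ W : ℤ → ℤ → ℝ, (∀ x y, 0 < W x y) → IsGridAp n 2 (extraConst p Q) W →
      ravg n m n m' (fun x y => F x y ^ 2 * W x y) ≤
        N * ravg n m n m' (fun x y => G x y ^ 2 * W x y)) :
    ravg n m n m' (fun x y => F x y ^ p * w x y) ≤
      (4 * √N) ^ p * ravg n m n m' (fun x y => G x y ^ p * w x y) := by
  have hp1 : 0 < p - 1 := by linarith
  have hp0 : 0 < p := by linarith
  have hθ : 0 < 1 - 1 / p := by rw [sub_pos, div_lt_one hp0]; exact hp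
  set X := ravg n m n m' (fun x y => F x y ^ p * w x y) with hX
  have hX0 : 0 ≤ X := ravg_nonneg fun x y => mul_nonneg (Real.rpow_nonneg (hF x y) _) (hw x y).le
  have hY0 : 0 ≤ ravg n m n m' (fun x y => G x y ^ p * w x y) :=
    ravg_nonneg fun x y => mul_nonneg (Real.rpow_nonneg (hG x y) _) (hw x y).le
  refine le_rpow_mul_of_le hp (by positivity) hX0 hY0 ?_
  -- The dual function that recovers the norm of `F`: `F * k₀ = F ^ p * w`.
  let k₀ : ℤ → ℤ → ℝ := fun x y => F x y ^ (p - 1) * w x y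
  have hk₀ : ∀ x y, 0 ≤ k₀ x y := fun x y => mul_nonneg (Real.rpow_nonneg (hF x y) _) (hw x y).le
  -- Majorants require a positive lower bound, so `G` and `k₀` are shifted by `ε`. Continuity in `ε`
  -- undoes this at the end.
  let Φ : ℝ → ℝ := fun ε => 4 * √N *
    (ravg n m n m' (fun x y => (G x y + ε) ^ p * w x y) ^ (1 / p) *
      ravg n m n m' (fun x y => (k₀ x y + ε) ^ (p / (p - 1)) * w x y ^ (-1 / (p - 1))) ^
        (1 - 1 / p))
  have hΦ : Continuous Φ := by
    refine continuous_const.mul ((Continuous.rpow_const (continuous_ravg fun x y => ?_)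
      fun _ => Or.inr (by positivity)).mul (Continuous.rpow_const (continuous_ravg fun x y => ?_)
      fun _ => Or.inr hθ.le))
    · exact ((continuous_const.add continuous_id).rpow_const fun _ => Or.inr hp0.le).mul
        continuous_const
    · exact ((continuous_const.add continuous_id).rpow_const fun _ => Or.inr (by positivity)).mul
        continuous_const
  have hΦ0 : Φ 0 = 4 * √N * (ravg n m n m' (fun x y => G x y ^ p * w x y) ^ (1 / p) *
      X ^ (1 - 1 / p)) := by
    simp only [Φ, add_zero, hX]
    congr 4; ext x y
    simp only [k₀]
    have h1 := hF x y
    have h2 := hw x y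
    rw [Real.mul_rpow (by positivity) h2.le, ← Real.rpow_mul h1, mul_div_cancel₀ _ hp1.ne',
      mul_assoc, ← Real.rpow_add h2]
    have : p / (p - 1) + -1 / (p - 1) = 1 := by field_simp; ring
    rw [this, Real.rpow_one]
  rw [← hΦ0]
  refine ge_of_tendsto (hΦ.continuousWithinAt (s := Ioi 0) (x := 0)) ?_
  filter_upwards [self_mem_nhdsWithin] with ε hε
  rw [mem_Ioi] at hε
  classical
  -- The majorants also require a global upper bound. Functions are changed to the constant `ε` off
  -- the large rectangle, where their values do not enter the averages, and are bounded on its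
  -- finitely many cells.
  have loc : ∀ f : ℤ → ℤ → ℝ, (∀ x y, 0 ≤ f x y) → ∃ f' : ℤ → ℤ → ℝ, ∃ B,
      (∀ x y, x / 2 ^ n = m → y / 2 ^ n = m' → f' x y = f x y + ε) ∧
      (∀ x y, ε ≤ f' x y) ∧ ∀ x y, f' x y ≤ B := by
    intro f hf
    refine ⟨fun x y => if x / 2 ^ n = m ∧ y / 2 ^ n = m' then f x y + ε else ε,
      2 ^ n * (2 ^ n * ravg n m n m' f) + ε, fun x y hx hy => if_pos ⟨hx, hy⟩, fun x y => ?_,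
      fun x y => ?_⟩
    · dsimp only
      split_ifs
      · linarith [hf x y]
      · exact le_rfl
    · dsimp only
      split_ifs with hxy
      · have := le_four_pow_mul_ravg (n := n) hf x y
        rw [hxy.1, hxy.2] at this
        linarith
      · have : 0 ≤ ravg n m n m' f := ravg_nonneg hf
        have : 0 ≤ (2 : ℝ) ^ n * (2 ^ n * ravg n m n m' f) := by positivity
        linarith
  obtain ⟨g, B₁, hg, hgε, hgB⟩ := loc G hG
  obtain ⟨k, B₂, hk, hkε, hkB⟩ := loc k₀ hk₀
  have key := extrapolation_bilinear hp hN hw hQ hF hG h hε hgε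
    (fun x y => (hgB x y).trans (le_max_left B₁ B₂)) hkε
    (fun x y => (hkB x y).trans (le_max_right B₁ B₂))
    (fun x y hx hy => by rw [hg x y hx hy]; linarith)
  rw [ravg_congr (f := fun x y => g x y ^ p * w x y)
      (g := fun x y => (G x y + ε) ^ p * w x y) fun x y hx hy => by rw [hg x y hx hy],
    ravg_congr (f := fun x y => k x y ^ (p / (p - 1)) * w x y ^ (-1 / (p - 1)))
      (g := fun x y => (k₀ x y + ε) ^ (p / (p - 1)) * w x y ^ (-1 / (p - 1)))
      fun x y hx hy => by rw [hk x y hx hy]] at key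
  refine le_trans (ravg_mono fun x y hx hy => ?_) key
  rw [hk x y hx hy]
  have h1 : F x y ^ p * w x y = F x y * k₀ x y := by
    simp only [k₀]
    have : F x y ^ p = F x y * F x y ^ (p - 1) := by
      rw [← Real.rpow_one_add' (hF x y) (by linarith)]; ring_nf
    rw [this, mul_assoc]
  rw [h1]
  exact mul_le_mul_of_nonneg_left (by linarith) (hF x y)


/-! ### The one-parameter weighted square function in `L ^ 2`. -/

/-- Half the difference of the averages over the two halves of an interval of level `i ≥ 1`. -/
noncomputable def bdiff {E : Type*} [AddCommGroup E] [Module ℝ E] (i : ℕ) (a : ℤ) (f : ℤ → E) : E :=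
  (1 / 2 : ℝ) • (bavg (i - 1) (2 * a + 1) f - bavg (i - 1) (2 * a) f)

/-- The Bellman function for the weighted square function in `L ^ 2`. -/
noncomputable def bellman (Q f u v : ℝ) : ℝ :=
  2 * Q * (f ^ 2 / u) +
    4 * (1 + Q + 2 * Q ^ 2) ^ 2 * (f ^ 2 / ((1 + Q + 2 * Q ^ 2) * u - u ^ 2 * v - 2 * Q ^ 2 / v))

/-- On the domain `1 ≤ u * v ≤ Q` the subtracted terms are at most `Q * u` and `2 * Q ^ 2 * u`. The
coefficient `1 + Q + 2 * Q ^ 2` is chosen to leave exactly one `u`. -/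
theorem le_bellman_denom {Q u v : ℝ} (hu : 0 < u) (hv : 0 < v) (h1 : 1 ≤ u * v) (hQ : u * v ≤ Q) :
    u ≤ (1 + Q + 2 * Q ^ 2) * u - u ^ 2 * v - 2 * Q ^ 2 / v := by
  have h2 : u ^ 2 * v ≤ Q * u := by nlinarith
  have h3 : 1 / v ≤ u := by rw [div_le_iff₀ hv]; exact h1
  have h4 : 2 * Q ^ 2 / v ≤ 2 * Q ^ 2 * u := by
    rw [div_eq_mul_one_div]; exact mul_le_mul_of_nonneg_left h3 (by positivity)
  nlinarith

theorem bellman_denom_le {Q u v : ℝ} (hv : 0 < v) :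
    (1 + Q + 2 * Q ^ 2) * u - u ^ 2 * v - 2 * Q ^ 2 / v ≤ (1 + Q + 2 * Q ^ 2) * u := by
  have : 0 ≤ u ^ 2 * v := by positivity
  have : 0 ≤ 2 * Q ^ 2 / v := by positivity
  linarith

theorem bellman_nonneg {Q f u v : ℝ} (hu : 0 < u) (hv : 0 < v) (h1 : 1 ≤ u * v) (hQ : u * v ≤ Q) :
    0 ≤ bellman Q f u v := by
  have hG := hu.trans_le (le_bellman_denom hu hv h1 hQ)
  have : 0 ≤ Q := by linarith
  unfold bellman
  positivity

theorem bellman_le {Q f u v : ℝ} (hu : 0 < u) (hv : 0 < v) (h1 : 1 ≤ u * v) (hQ : u * v ≤ Q) :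
    bellman Q f u v ≤ (2 * Q + 4 * (1 + Q + 2 * Q ^ 2) ^ 2) * (f ^ 2 / u) := by
  have := div_le_div_of_nonneg_left (sq_nonneg f) hu (le_bellman_denom hu hv h1 hQ)
  unfold bellman
  have h := mul_le_mul_of_nonneg_left this
    (show 0 ≤ 4 * (1 + Q + 2 * Q ^ 2) ^ 2 by positivity)
  linarith

/-- Joint convexity of `f ^ 2 / u`. -/
theorem sq_div_midpoint_le {f g u v : ℝ} (hu : 0 < u) (hv : 0 < v) :
    ((f + g) / 2) ^ 2 / ((u + v) / 2) ≤ (f ^ 2 / u + g ^ 2 / v) / 2 := by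
  rw [div_add_div _ _ hu.ne' hv.ne', div_div, div_le_div_iff₀ (by positivity) (by positivity)]
  nlinarith [mul_nonneg (add_pos hu hv).le (sq_nonneg (f * v - g * u)), sq_nonneg (f * v - g * u),
    mul_nonneg (mul_pos hu hv).le (sq_nonneg (f * v - g * u))]

/-- Quantitative convexity of `f ^ 2 / u`. -/
theorem sq_div_midpoint_add_le {f d u e : ℝ} (h1 : 0 < u + e) (h2 : 0 < u - e) :
    f ^ 2 / u + (d - f * e / u) ^ 2 / u ≤ ((f + d) ^ 2 / (u + e) + (f - d) ^ 2 / (u - e)) / 2 := by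
  have hu : 0 < u := by linarith
  have key : ((f + d) ^ 2 / (u + e) + (f - d) ^ 2 / (u - e)) / 2 - f ^ 2 / u =
      (d - f * e / u) ^ 2 * (u / ((u + e) * (u - e))) := by
    field_simp
    ring
  have : 1 / u ≤ u / ((u + e) * (u - e)) := by
    rw [div_le_div_iff₀ hu (by positivity)]
    nlinarith [sq_nonneg e]
  have := mul_le_mul_of_nonneg_left this (sq_nonneg (d - f * e / u))
  rw [← key, mul_one_div] at this
  linarith

/-- The main property of the denominator of the Bellman function. -/
theorem bellman_denom_step {Q u e v c : ℝ} (hu1 : 0 < u + e) (hu2 : 0 < u - e) (hv1 : 0 < v + c)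
    (hv2 : 0 < v - c) (hQ : u * v ≤ Q) :
    (((1 + Q + 2 * Q ^ 2) * (u + e) - (u + e) ^ 2 * (v + c) - 2 * Q ^ 2 / (v + c)) +
      ((1 + Q + 2 * Q ^ 2) * (u - e) - (u - e) ^ 2 * (v - c) - 2 * Q ^ 2 / (v - c))) / 2 +
        e ^ 2 * v / 2 ≤
      (1 + Q + 2 * Q ^ 2) * u - u ^ 2 * v - 2 * Q ^ 2 / v := by
  have hu : 0 < u := by linarith
  have hv : 0 < v := by linarith
  -- The mean of `(u ± e) ^ 2 * (v ± c)` exceeds `u ^ 2 * v` by `e ^ 2 * v + 2 * u * e * c`. Half of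
  -- `e ^ 2 * v` is the gain to be kept. The other half, with the convexity gain `c ^ 2 / v ^ 3` of
  -- `1 / v` weighted by `2 * Q ^ 2`, completes the square around the mixed term of unknown sign.
  have h1 : 1 / v + c ^ 2 / v ^ 3 ≤ (1 / (v + c) + 1 / (v - c)) / 2 := by
    have e1 : (1 / (v + c) + 1 / (v - c)) / 2 - 1 / v = c ^ 2 * (1 / (v * ((v + c) * (v - c)))) := by
      field_simp; ring
    have e2 : 1 / v ^ 3 ≤ 1 / (v * ((v + c) * (v - c))) := by
      apply one_div_le_one_div_of_le (by positivity)
      nlinarith [mul_nonneg hv.le (sq_nonneg c)]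
    have := mul_le_mul_of_nonneg_left e2 (sq_nonneg c)
    rw [← e1, mul_one_div] at this
    linarith
  have h2 : u ^ 2 * c ^ 2 / v ≤ Q ^ 2 * (c ^ 2 / v ^ 3) := by
    have : (u * v) ^ 2 ≤ Q ^ 2 := pow_le_pow_left₀ (by positivity) hQ 2
    have := mul_le_mul_of_nonneg_right this (show 0 ≤ c ^ 2 / v ^ 3 by positivity)
    refine le_trans (le_of_eq ?_) this
    field_simp
  have h3 : 0 ≤ e ^ 2 * v / 2 + 2 * (u * e * c) + 2 * (u ^ 2 * c ^ 2 / v) := by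
    have : e ^ 2 * v / 2 + 2 * (u * e * c) + 2 * (u ^ 2 * c ^ 2 / v) =
        (e * v + 2 * (u * c)) ^ 2 / (2 * v) := by field_simp; ring
    rw [this]; positivity
  have h4 := mul_le_mul_of_nonneg_left h1 (show 0 ≤ 2 * Q ^ 2 by positivity)
  have e5 : 2 * Q ^ 2 / v = 2 * Q ^ 2 * (1 / v) := by ring
  have e6 : 2 * Q ^ 2 / (v + c) = 2 * Q ^ 2 * (1 / (v + c)) := by ring
  have e7 : 2 * Q ^ 2 / (v - c) = 2 * Q ^ 2 * (1 / (v - c)) := by ring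
  rw [e5, e6, e7]
  linarith

/-- Write `d = (d - f * e / u) + f * e / u`. The convexity of `f ^ 2 / u` pays for the first part,
as `v ≤ Q / u`. The second part is paid for by the other summand of `bellman`: its denominator is
concave with a gain of `e ^ 2 * v / 2` and is at most `(1 + Q + 2 * Q ^ 2) * u`, which fixes the
factor in front. -/
theorem bellman_step {Q f d u e v c : ℝ} (hu1 : 0 < u + e) (hu2 : 0 < u - e) (hv1 : 0 < v + c)
    (hv2 : 0 < v - c) (h1 : 1 ≤ u * v) (hQ : u * v ≤ Q)
    (h1p : 1 ≤ (u + e) * (v + c)) (hQp : (u + e) * (v + c) ≤ Q)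
    (h1m : 1 ≤ (u - e) * (v - c)) (hQm : (u - e) * (v - c) ≤ Q) :
    bellman Q f u v + d ^ 2 * v ≤
      (bellman Q (f + d) (u + e) (v + c) + bellman Q (f - d) (u - e) (v - c)) / 2 := by
  have hu : 0 < u := by linarith
  have hv : 0 < v := by linarith
  have hQ1 : 1 ≤ Q := h1.trans hQ
  have hstep := bellman_denom_step hu1 hu2 hv1 hv2 hQ
  have hG := le_bellman_denom hu hv h1 hQ
  have hG' := bellman_denom_le (Q := Q) (u := u) hv
  have hGp := hu1.trans_le (le_bellman_denom hu1 hv1 h1p hQp)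
  have hGm := hu2.trans_le (le_bellman_denom hu2 hv2 h1m hQm)
  unfold bellman
  set K := 1 + Q + 2 * Q ^ 2 with hK
  have hK0 : 0 < K := by positivity
  set G := K * u - u ^ 2 * v - 2 * Q ^ 2 / v
  set Gp := K * (u + e) - (u + e) ^ 2 * (v + c) - 2 * Q ^ 2 / (v + c)
  set Gm := K * (u - e) - (u - e) ^ 2 * (v - c) - 2 * Q ^ 2 / (v - c)
  have hG0 : 0 < G := hu.trans_le hG
  have i1 := sq_div_midpoint_add_le (f := f) (d := d) hu1 hu2
  have i2 := sq_div_midpoint_le (f := f + d) (g := f - d) hGp hGm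
  have e1 : (f + d + (f - d)) / 2 = f := by ring
  rw [e1] at i2
  have hs : 0 < (Gp + Gm) / 2 := by positivity
  have i3 : f ^ 2 / G + f ^ 2 * (e ^ 2 * v) / (2 * (K * u) ^ 2) ≤ f ^ 2 / ((Gp + Gm) / 2) := by
    set S := (Gp + Gm) / 2
    have hSG : S + e ^ 2 * v / 2 ≤ G := hstep
    have j1 : f ^ 2 / G + f ^ 2 * (e ^ 2 * v) / (2 * G ^ 2) ≤ f ^ 2 / S := by
      have k1 : 1 / G + (e ^ 2 * v) / (2 * G ^ 2) ≤ 1 / S := by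
        have : 1 / G + (e ^ 2 * v) / (2 * G ^ 2) = (G + e ^ 2 * v / 2) / G ^ 2 := by
          field_simp
        rw [this, div_le_div_iff₀ (by positivity) hs]
        have hev : 0 ≤ e ^ 2 * v := by positivity
        nlinarith
      have := mul_le_mul_of_nonneg_left k1 (sq_nonneg f)
      refine le_trans (le_of_eq ?_) (this.trans (le_of_eq ?_)) <;> ring
    have j2 : f ^ 2 * (e ^ 2 * v) / (2 * (K * u) ^ 2) ≤ f ^ 2 * (e ^ 2 * v) / (2 * G ^ 2) := by
      apply div_le_div_of_nonneg_left (by positivity) (by positivity)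
      have := pow_le_pow_left₀ hG0.le hG' 2
      linarith
    linarith
  have i4 : d ^ 2 * v ≤ 2 * Q * ((d - f * e / u) ^ 2 / u) +
      4 * K ^ 2 * (f ^ 2 * (e ^ 2 * v) / (2 * (K * u) ^ 2)) := by
    have e2 : 4 * K ^ 2 * (f ^ 2 * (e ^ 2 * v) / (2 * (K * u) ^ 2)) = 2 * (f * e / u) ^ 2 * v := by
      field_simp; ring
    rw [e2]
    have k1 : v ≤ Q / u := by rw [le_div_iff₀ hu]; linarith
    have k2 := mul_le_mul_of_nonneg_left k1 (show 0 ≤ 2 * (d - f * e / u) ^ 2 by positivity)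
    have k3 : 2 * (d - f * e / u) ^ 2 * (Q / u) = 2 * Q * ((d - f * e / u) ^ 2 / u) := by ring
    rw [k3] at k2
    have k4 : d ^ 2 ≤ 2 * (d - f * e / u) ^ 2 + 2 * (f * e / u) ^ 2 := by
      have := add_sq_le (a := d - f * e / u) (b := f * e / u)
      rw [sub_add_cancel] at this
      rwa [mul_add] at this
    have := mul_le_mul_of_nonneg_right k4 hv.le
    linarith
  have i5 := mul_le_mul_of_nonneg_left i1 (show 0 ≤ 2 * Q by linarith)
  have i6 := mul_le_mul_of_nonneg_left (i3.trans i2) (show 0 ≤ 4 * K ^ 2 by positivity)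
  linarith

/-- Cauchy–Schwarz. It keeps the averages in the domain of the Bellman function. -/
theorem one_le_bavg_mul_bavg {u v : ℤ → ℝ} (hu : ∀ x, 0 < u x) (hv : ∀ x, 0 < v x)
    (h : ∀ x, 1 ≤ u x * v x) (i : ℕ) (a : ℤ) : 1 ≤ bavg i a u * bavg i a v := by
  have := bavg_rpow_mul_rpow_le (θ := 1 / 2) (k := i) (m := a) (by norm_num) (by norm_num)
    (fun x => (hu x).le) (fun x => (hv x).le)
  have h0 : 1 ≤ bavg i a (fun x => u x ^ (1 / 2 : ℝ) * v x ^ (1 - 1 / 2 : ℝ)) := by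
    refine le_bavg fun x _ => ?_
    have e : (1 - 1 / 2 : ℝ) = 1 / 2 := by norm_num
    rw [e, ← Real.mul_rpow (hu x).le (hv x).le]
    exact Real.one_le_rpow (h x) (by norm_num)
  have e : (1 - 1 / 2 : ℝ) = 1 / 2 := by norm_num
  have hp : 0 < bavg i a u * bavg i a v := mul_pos (bavg_pos hu) (bavg_pos hv)
  have h1 := h0.trans this
  rw [e, ← Real.mul_rpow (bavg_pos hu).le (bavg_pos hv).le, ← Real.sqrt_eq_rpow] at h1
  have := pow_le_pow_left₀ zero_le_one h1 2
  rwa [one_pow, Real.sq_sqrt hp.le] at this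

/-- Induction on the generations: `bellman_step` at the top interval pays for the top term of the
sum, and `bellman_le` is the bound at single points. Assuming `1 ≤ u * v` rather than `v = 1 / u` is
essential for two parameters, where `u` and `v` will be averages of `w⁻¹` and `w` in the other
variable. -/
theorem sum_bdiff_sq_aux {n : ℕ} {Q : ℝ} {f u v : ℤ → ℝ} (hu : ∀ x, 0 < u x) (hv : ∀ x, 0 < v x)
    (h : ∀ x, 1 ≤ u x * v x) (hQ : ∀ i ≤ n, ∀ a, bavg i a u * bavg i a v ≤ Q) (m : ℤ) :
    bavg n m (fun x => ∑ i ∈ Finset.Icc 1 n,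
      bdiff i (x / 2 ^ i) f ^ 2 * bavg i (x / 2 ^ i) v) +
        bellman Q (bavg n m f) (bavg n m u) (bavg n m v) ≤
      (2 * Q + 4 * (1 + Q + 2 * Q ^ 2) ^ 2) * bavg n m (fun x => f x ^ 2 / u x) := by
  induction n generalizing m with
  | zero =>
    simp only [bavg_zero]
    simpa using bellman_le (f := f m) (hu m) (hv m) (h m) (hQ 0 le_rfl m)
  | succ n ih =>
    have ih' := ih fun i hi => hQ i (by omega)
    -- `bdiff` is right minus left, so the minus signs make the plus branch the left half.
    have hstep := bellman_step (Q := Q) (f := bavg (n + 1) m f) (d := -bdiff (n + 1) m f)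
      (u := bavg (n + 1) m u) (e := -bdiff (n + 1) m u) (v := bavg (n + 1) m v)
      (c := -bdiff (n + 1) m v)
    have ep : ∀ g : ℤ → ℝ, bavg (n + 1) m g + -bdiff (n + 1) m g = bavg n (2 * m) g := by
      intro g
      simp only [bavg_succ', bdiff, Nat.add_sub_cancel, smul_eq_mul]; ring
    have em : ∀ g : ℤ → ℝ, bavg (n + 1) m g - -bdiff (n + 1) m g = bavg n (2 * m + 1) g := by
      intro g
      simp only [bavg_succ', bdiff, Nat.add_sub_cancel, smul_eq_mul]; ring
    simp only [ep, em] at hstep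
    have hs := hstep (bavg_pos hu) (bavg_pos hu) (bavg_pos hv) (bavg_pos hv)
      (one_le_bavg_mul_bavg hu hv h _ _) (hQ _ le_rfl _)
      (one_le_bavg_mul_bavg hu hv h _ _) (hQ _ (by omega) _)
      (one_le_bavg_mul_bavg hu hv h _ _) (hQ _ (by omega) _)
    have hsum : bavg (n + 1) m (fun x => ∑ i ∈ Finset.Icc 1 (n + 1),
        bdiff i (x / 2 ^ i) f ^ 2 * bavg i (x / 2 ^ i) v) =
        bavg (n + 1) m (fun x => ∑ i ∈ Finset.Icc 1 n,
          bdiff i (x / 2 ^ i) f ^ 2 * bavg i (x / 2 ^ i) v) +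
        bdiff (n + 1) m f ^ 2 * bavg (n + 1) m v := by
      rw [bavg_congr (f := fun x => ∑ i ∈ Finset.Icc 1 (n + 1),
        bdiff i (x / 2 ^ i) f ^ 2 * bavg i (x / 2 ^ i) v)
        (g := fun x => ∑ i ∈ Finset.Icc 1 n,
          bdiff i (x / 2 ^ i) f ^ 2 * bavg i (x / 2 ^ i) v +
          bdiff (n + 1) m f ^ 2 * bavg (n + 1) m v) fun x hx => by
          rw [Finset.sum_Icc_succ_top (by omega), hx], bavg_add, bavg_const]
    rw [hsum, bavg_succ' n m fun x => f x ^ 2 / u x, bavg_succ' n m]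
    have h1 := ih' (2 * m)
    have h2 := ih' (2 * m + 1)
    rw [neg_sq] at hs
    linarith

/-- The constant in the one-parameter weighted square function estimate in `L ^ 2`. -/
noncomputable def sqConst (Q : ℝ) : ℝ := 2 * Q + 4 * (1 + Q + 2 * Q ^ 2) ^ 2

/-- The one-parameter weighted square function estimate in `L ^ 2`. -/
theorem sum_bdiff_sq_le {n : ℕ} {Q : ℝ} {f u v : ℤ → ℝ} (hu : ∀ x, 0 < u x) (hv : ∀ x, 0 < v x)
    (h : ∀ x, 1 ≤ u x * v x) (hQ : ∀ i ≤ n, ∀ a, bavg i a u * bavg i a v ≤ Q) (m : ℤ) :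
    bavg n m (fun x => ∑ i ∈ Finset.Icc 1 n,
      bdiff i (x / 2 ^ i) f ^ 2 * bavg i (x / 2 ^ i) v) ≤
      sqConst Q * bavg n m (fun x => f x ^ 2 / u x) := by
  have h1 := sum_bdiff_sq_aux (f := f) hu hv h hQ m
  have h2 := bellman_nonneg (f := bavg n m f) (bavg_pos hu) (bavg_pos hv)
    (one_le_bavg_mul_bavg hu hv h n m) (hQ n le_rfl m)
  unfold sqConst
  linarith


/-! ### The biparameter weighted square function. -/

/-- The mixed difference of the averages over the four quarters of a dyadic rectangle. -/
noncomputable def rdiff {E : Type*} [AddCommGroup E] [Module ℝ E] (i : ℕ) (a : ℤ) (j : ℕ) (b : ℤ)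
    (f : ℤ → ℤ → E) : E :=
  bdiff i a fun x => bdiff j b fun y => f x y

section Module

variable {E F : Type*} [AddCommGroup E] [Module ℝ E] [AddCommGroup F] [Module ℝ F]

theorem bdiff_map (L : E →ₗ[ℝ] F) (i : ℕ) (a : ℤ) (f : ℤ → E) :
    bdiff i a (fun x => L (f x)) = L (bdiff i a f) := by
  simp only [bdiff, bavg_map, map_smul, map_sub]

theorem rdiff_map (L : E →ₗ[ℝ] F) (i : ℕ) (a : ℤ) (j : ℕ) (b : ℤ) (f : ℤ → ℤ → E) :
    rdiff i a j b (fun x y => L (f x y)) = L (rdiff i a j b f) := by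
  simp only [rdiff, bdiff_map]

theorem bavg_bdiff_comm (i j : ℕ) (a b : ℤ) (f : ℤ → ℤ → E) :
    bavg i a (fun x => bdiff j b fun y => f x y) = bdiff j b fun y => bavg i a fun x => f x y := by
  simp only [bdiff, bavg_smul, bavg_sub]
  rw [bavg_comm, bavg_comm (n := 2 * b)]

theorem rdiff_swap (i j : ℕ) (a b : ℤ) (f : ℤ → ℤ → E) :
    rdiff i a j b f = rdiff j b i a fun y x => f x y := by
  simp only [rdiff, bdiff, bavg_smul, bavg_sub]
  rw [bavg_comm, bavg_comm (n := 2 * b), bavg_comm (m := 2 * a), bavg_comm (m := 2 * a) (n := 2 * b)]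
  module

end Module

/-- The sum of `c R` over the dyadic rectangles `R` with sides at least `2` and at most `2 ^ n` that
contain the cell `(x, y)`. -/
noncomputable def gridSum (n : ℕ) (c : ℕ → ℤ → ℕ → ℤ → ℝ) (x y : ℤ) : ℝ :=
  ∑ k ∈ Finset.Icc 1 n ×ˢ Finset.Icc 1 n, c k.1 (x / 2 ^ k.1) k.2 (y / 2 ^ k.2)

theorem gridSum_nonneg {n : ℕ} {c : ℕ → ℤ → ℕ → ℤ → ℝ} (hc : ∀ i a j b, 0 ≤ c i a j b) (x y : ℤ) :
    0 ≤ gridSum n c x y := Finset.sum_nonneg fun _ _ => hc _ _ _ _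

/-- Each coefficient is constant on its rectangle, so integrating a term against `f` sees only the
average of `f` there. -/
theorem ravg_gridSum_mul {n : ℕ} {m m' : ℤ} (c : ℕ → ℤ → ℕ → ℤ → ℝ) (f : ℤ → ℤ → ℝ) :
    ravg n m n m' (fun x y => gridSum n c x y * f x y) =
      ravg n m n m' (gridSum n fun i a j b => c i a j b * ravg i a j b f) := by
  have h : ∀ (d : ℕ → ℤ → ℕ → ℤ → ℝ), ravg n m n m' (gridSum n d) =
      ∑ k ∈ Finset.Icc 1 n ×ˢ Finset.Icc 1 n,
        ravg n m n m' (fun x y => d k.1 (x / 2 ^ k.1) k.2 (y / 2 ^ k.2)) := fun d =>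
    ravg_sum _ fun (k : ℕ × ℕ) x y => d k.1 (x / 2 ^ k.1) k.2 (y / 2 ^ k.2)
  rw [h]
  simp only [gridSum, Finset.sum_mul]
  rw [ravg_sum (f := fun (k : ℕ × ℕ) x y => c k.1 (x / 2 ^ k.1) k.2 (y / 2 ^ k.2) * f x y)]
  refine Finset.sum_congr rfl fun k hk => ?_
  rw [Finset.mem_product, Finset.mem_Icc, Finset.mem_Icc] at hk
  exact (ravg_mul_ravg hk.1.2 hk.2.2 (fun a b => c k.1 a k.2 b) f).symm

theorem sqConst_nonneg {Q : ℝ} (hQ : 0 ≤ Q) : 0 ≤ sqConst Q := by unfold sqConst; positivity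

/-- The biparameter weighted square function estimate in `L ^ 2`, for real functions. -/
theorem ravg_gridSum_rdiff_sq_le {n : ℕ} {Q : ℝ} {w : ℤ → ℤ → ℝ} (hw : ∀ x y, 0 < w x y)
    (hQ : IsGridAp n 2 Q w) (f : ℤ → ℤ → ℝ) (m m' : ℤ) :
    ravg n m n m' (fun x y => gridSum n (fun i a j b => rdiff i a j b f ^ 2) x y * w x y) ≤
      sqConst Q ^ 2 * ravg n m n m' (fun x y => f x y ^ 2 * w x y) := by
  have hC := sqConst_nonneg (hQ.nonneg hw)
  have hu : ∀ x y, 0 < (w x y)⁻¹ := fun x y => inv_pos.2 (hw x y)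
  have hQ' : ∀ i ≤ n, ∀ j ≤ n, ∀ a b,
      ravg i a j b w * ravg i a j b (fun x y => (w x y)⁻¹) ≤ Q := by
    intro i hi j hj a b
    have := hQ i hi j hj a b
    have e : (2 - 1 : ℝ) = 1 := by norm_num
    simpa only [e, div_one, Real.rpow_neg_one, Real.rpow_one] using this
  -- For a fixed interval `I` in the first variable, the one-parameter bound in the second is
  -- applied to the differences of `f` over `I`, with `u` and `v` the averages of `w⁻¹` and `w` over
  -- `I`. Biparameter `A_2` is exactly the condition this needs, and `1 / u ≤ v` restores the
  -- average of `w`.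
  have inner : ∀ i ≤ n, ∀ x, bavg n m' (fun y => ∑ j ∈ Finset.Icc 1 n,
      rdiff i (x / 2 ^ i) j (y / 2 ^ j) f ^ 2 * ravg i (x / 2 ^ i) j (y / 2 ^ j) w) ≤
      sqConst Q * bavg n m' (fun y =>
        bdiff i (x / 2 ^ i) (fun x' => f x' y) ^ 2 * bavg i (x / 2 ^ i) (fun x' => w x' y)) := by
    intro i hi x
    have hU : ∀ y, 0 < bavg i (x / 2 ^ i) (fun x' => (w x' y)⁻¹) := fun y =>
      bavg_pos fun x' => hu x' y
    have hV : ∀ y, 0 < bavg i (x / 2 ^ i) (fun x' => w x' y) := fun y => bavg_pos fun x' => hw x' y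
    have hUV : ∀ y, 1 ≤ bavg i (x / 2 ^ i) (fun x' => (w x' y)⁻¹) *
        bavg i (x / 2 ^ i) (fun x' => w x' y) := fun y =>
      one_le_bavg_mul_bavg (fun x' => hu x' y) (fun x' => hw x' y)
        (fun x' => (inv_mul_cancel₀ (hw x' y).ne').ge) _ _
    have h := sum_bdiff_sq_le (n := n) (Q := Q) (f := fun y =>
      bdiff i (x / 2 ^ i) (fun x' => f x' y)) hU hV hUV (fun j hj b => by
        have := hQ' i hi j hj (x / 2 ^ i) b
        rwa [ravg_swap, ravg_swap (f := fun x y => (w x y)⁻¹), mul_comm] at this) m'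
    refine le_trans (le_of_eq ?_) (h.trans ?_)
    · congr 1; ext y
      refine Finset.sum_congr rfl fun j _ => ?_
      rw [rdiff_swap, ravg_swap]; rfl
    · refine mul_le_mul_of_nonneg_left (bavg_mono fun y _ => ?_) hC
      rw [div_eq_mul_inv]
      refine mul_le_mul_of_nonneg_left ?_ (sq_nonneg _)
      rw [inv_le_iff_one_le_mul₀ (hU y), mul_comm]
      exact hUV y
  -- The remaining sum over intervals in the first variable is the one-parameter square function on
  -- a line.
  have outer : ∀ y, bavg n m (fun x => ∑ i ∈ Finset.Icc 1 n,
      bdiff i (x / 2 ^ i) (fun x' => f x' y) ^ 2 * bavg i (x / 2 ^ i) (fun x' => w x' y)) ≤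
      sqConst Q * bavg n m (fun x => f x y ^ 2 * w x y) := by
    intro y
    have h := sum_bdiff_sq_le (n := n) (Q := Q) (f := fun x => f x y) (u := fun x => (w x y)⁻¹)
      (v := fun x => w x y) (fun x => hu x y) (fun x => hw x y)
      (fun x => (inv_mul_cancel₀ (hw x y).ne').ge) (fun i hi a => by
        have := hQ' i hi 0 (Nat.zero_le n) a y
        rwa [mul_comm] at this) m
    simpa only [div_inv_eq_mul] using h
  rw [ravg_gridSum_mul]
  calc ravg n m n m' (gridSum n fun i a j b => rdiff i a j b f ^ 2 * ravg i a j b w)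
      = bavg n m fun x => ∑ i ∈ Finset.Icc 1 n, bavg n m' (fun y => ∑ j ∈ Finset.Icc 1 n,
          rdiff i (x / 2 ^ i) j (y / 2 ^ j) f ^ 2 * ravg i (x / 2 ^ i) j (y / 2 ^ j) w) := by
        unfold ravg gridSum
        congr 1; ext x
        simp_rw [Finset.sum_product]
        rw [bavg_sum (f := fun i y => ∑ j ∈ Finset.Icc 1 n, rdiff i (x / 2 ^ i) j (y / 2 ^ j) f ^ 2 *
          bavg i (x / 2 ^ i) fun x => bavg j (y / 2 ^ j) fun y => w x y)]
    _ ≤ bavg n m fun x => ∑ i ∈ Finset.Icc 1 n, sqConst Q * bavg n m' (fun y =>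
          bdiff i (x / 2 ^ i) (fun x' => f x' y) ^ 2 * bavg i (x / 2 ^ i) (fun x' => w x' y)) :=
        bavg_mono fun x _ => Finset.sum_le_sum fun i hi => inner i (Finset.mem_Icc.1 hi).2 x
    _ = sqConst Q * bavg n m' fun y => bavg n m fun x => ∑ i ∈ Finset.Icc 1 n,
          bdiff i (x / 2 ^ i) (fun x' => f x' y) ^ 2 * bavg i (x / 2 ^ i) (fun x' => w x' y) := by
        simp_rw [← Finset.mul_sum]
        rw [bavg_mul_left, ← bavg_comm]
        congr 2; ext x
        rw [bavg_sum (f := fun i y => bdiff i (x / 2 ^ i) (fun x' => f x' y) ^ 2 *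
          bavg i (x / 2 ^ i) (fun x' => w x' y))]
    _ ≤ sqConst Q * bavg n m' fun y => sqConst Q * bavg n m (fun x => f x y ^ 2 * w x y) :=
        mul_le_mul_of_nonneg_left (bavg_mono fun y _ => outer y) hC
    _ = _ := by rw [bavg_mul_left, bavg_comm, ravg]; ring

theorem norm_rdiff_sq (i : ℕ) (a : ℤ) (j : ℕ) (b : ℤ) (f : ℤ → ℤ → ℂ) :
    ‖rdiff i a j b f‖ ^ 2 =
      rdiff i a j b (fun x y => (f x y).re) ^ 2 + rdiff i a j b (fun x y => (f x y).im) ^ 2 := by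
  have h1 := rdiff_map Complex.reLm i a j b f
  have h2 := rdiff_map Complex.imLm i a j b f
  simp only [Complex.reLm_coe, Complex.imLm_coe] at h1 h2
  rw [h1, h2, Complex.sq_norm, Complex.normSq_apply]
  ring

theorem ravg_gridSum_norm_rdiff_sq_le {n : ℕ} {Q : ℝ} {w : ℤ → ℤ → ℝ} (hw : ∀ x y, 0 < w x y)
    (hQ : IsGridAp n 2 Q w) (f : ℤ → ℤ → ℂ) (m m' : ℤ) :
    ravg n m n m' (fun x y => gridSum n (fun i a j b => ‖rdiff i a j b f‖ ^ 2) x y * w x y) ≤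
      sqConst Q ^ 2 * ravg n m n m' (fun x y => ‖f x y‖ ^ 2 * w x y) := by
  have h1 := ravg_gridSum_rdiff_sq_le hw hQ (fun x y => (f x y).re) m m'
  have h2 := ravg_gridSum_rdiff_sq_le hw hQ (fun x y => (f x y).im) m m'
  have e1 : ravg n m n m' (fun x y => gridSum n (fun i a j b => ‖rdiff i a j b f‖ ^ 2) x y * w x y) =
      ravg n m n m' (fun x y => gridSum n (fun i a j b =>
        rdiff i a j b (fun x y => (f x y).re) ^ 2) x y * w x y) +
      ravg n m n m' (fun x y => gridSum n (fun i a j b =>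
        rdiff i a j b (fun x y => (f x y).im) ^ 2) x y * w x y) := by
    rw [← ravg_add]
    congr 1; ext x y
    simp only [gridSum, norm_rdiff_sq, Finset.sum_add_distrib]
    ring
  have e2 : ravg n m n m' (fun x y => ‖f x y‖ ^ 2 * w x y) =
      ravg n m n m' (fun x y => (f x y).re ^ 2 * w x y) +
      ravg n m n m' (fun x y => (f x y).im ^ 2 * w x y) := by
    rw [← ravg_add]
    congr 1; ext x y
    rw [Complex.sq_norm, Complex.normSq_apply]
    ring
  rw [e1, e2, mul_add]
  exact add_le_add h1 h2

/-- The constant in the weighted square function estimate. -/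
noncomputable def squareConst (p Q : ℝ) : ℝ := (4 * √(sqConst (extraConst p Q) ^ 2)) ^ p

theorem sqrt_rpow {x : ℝ} (hx : 0 ≤ x) (p : ℝ) : √x ^ p = x ^ (p / 2) := by
  rw [Real.sqrt_eq_rpow, ← Real.rpow_mul hx]; ring_nf

/-- The weighted estimate for the biparameter square function. -/
theorem ravg_square_le {p Q : ℝ} (hp : 1 < p) {n : ℕ} {w : ℤ → ℤ → ℝ} (hw : ∀ x y, 0 < w x y)
    (hQ : IsGridAp n p Q w) (f : ℤ → ℤ → ℂ) (m m' : ℤ) :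
    ravg n m n m' (fun x y =>
        gridSum n (fun i a j b => ‖rdiff i a j b f‖ ^ 2) x y ^ (p / 2) * w x y) ≤
      squareConst p Q * ravg n m n m' (fun x y => ‖f x y‖ ^ p * w x y) := by
  have h0 : ∀ x y, 0 ≤ gridSum n (fun i a j b => ‖rdiff i a j b f‖ ^ 2) x y :=
    gridSum_nonneg fun _ _ _ _ => sq_nonneg _
  have := extrapolation hp (sq_nonneg (sqConst (extraConst p Q))) hw hQ
    (F := fun x y => √(gridSum n (fun i a j b => ‖rdiff i a j b f‖ ^ 2) x y))
    (G := fun x y => ‖f x y‖) (fun x y => Real.sqrt_nonneg _) (fun x y => norm_nonneg _)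
    (m := m) (m' := m') fun W hW hWQ => by
      simp_rw [Real.sq_sqrt (h0 _ _)]
      exact ravg_gridSum_norm_rdiff_sq_le hW hWQ f m m'
  simpa only [sqrt_rpow (h0 _ _), squareConst] using this

/-! ### Stein's inequality and the comparison of the two square functions. -/

theorem ravg_const (i j : ℕ) (a b : ℤ) (c : ℝ) : ravg i a j b (fun _ _ => c) = c := by
  simp only [ravg, bavg_const]

theorem isGridAp_one (n : ℕ) (p : ℝ) : IsGridAp n p 1 fun _ _ => 1 := by
  intro i _ j _ a b
  simp only [Real.one_rpow, ravg_const, mul_one, le_refl]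

/-- Hölder with `θ = p / (2 * p - 1)`, the exponent for which the powers of `w` in `(w ^ (1 / p)) ^
θ * (w ^ (-1 / (p - 1))) ^ (1 - θ)` cancel. Raised to the power `2 * p - 1` it bounds below the
product of `⟨w ^ (1 / p)⟩ ^ p` and the dual factor of `A_p` by one. -/
theorem ravg_le_rpow_root {p Q : ℝ} (hp : 1 < p) {i j : ℕ} {a b : ℤ} {w : ℤ → ℤ → ℝ}
    (hw : ∀ x y, 0 < w x y)
    (hQ : ravg i a j b w * ravg i a j b (fun x y => w x y ^ (-1 / (p - 1))) ^ (p - 1) ≤ Q) :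
    ravg i a j b w ≤ Q * ravg i a j b (fun x y => w x y ^ (1 / p)) ^ p := by
  have hp1 : 0 < p - 1 := by linarith
  have hp0 : 0 < p := by linarith
  have hq : 0 < 2 * p - 1 := by linarith
  have eθ : 1 - p / (2 * p - 1) = (p - 1) / (2 * p - 1) := by
    rw [eq_div_iff hq.ne', sub_mul, div_mul_cancel₀ _ hq.ne']; ring
  have hv : 0 ≤ ravg i a j b (fun x y => w x y ^ (1 / p)) :=
    ravg_nonneg fun x y => Real.rpow_nonneg (hw x y).le _
  have hs : 0 ≤ ravg i a j b (fun x y => w x y ^ (-1 / (p - 1))) :=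
    ravg_nonneg fun x y => Real.rpow_nonneg (hw x y).le _
  have h := ravg_rpow_mul_rpow_le (i := i) (j := j) (a := a) (b := b) (θ := p / (2 * p - 1))
    (f := fun x y => w x y ^ (1 / p)) (g := fun x y => w x y ^ (-1 / (p - 1))) (by positivity)
    (by rw [div_lt_one hq]; linarith) (fun x y => Real.rpow_nonneg (hw x y).le _)
    (fun x y => Real.rpow_nonneg (hw x y).le _)
  have h1 : ravg i a j b (fun x y => (w x y ^ (1 / p)) ^ (p / (2 * p - 1)) *
      (w x y ^ (-1 / (p - 1))) ^ (1 - p / (2 * p - 1))) = 1 := by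
    refine Eq.trans ?_ (ravg_const i j a b 1)
    congr 1; ext x y
    rw [eθ, ← Real.rpow_mul (hw x y).le, ← Real.rpow_mul (hw x y).le, ← Real.rpow_add (hw x y)]
    have : 1 / p * (p / (2 * p - 1)) + -1 / (p - 1) * ((p - 1) / (2 * p - 1)) = 0 := by
      rw [div_mul_div_cancel₀ hp0.ne', div_mul_div_cancel₀ hp1.ne', ← add_div]
      simp
    rw [this, Real.rpow_zero]
  rw [h1, eθ] at h
  have h2 := Real.rpow_le_rpow zero_le_one h hq.le
  rw [Real.one_rpow, Real.mul_rpow (by positivity) (by positivity), ← Real.rpow_mul hv,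
    ← Real.rpow_mul hs, div_mul_cancel₀ _ hq.ne', div_mul_cancel₀ _ hq.ne'] at h2
  have hw0 : 0 ≤ ravg i a j b w := (ravg_pos hw).le
  calc ravg i a j b w ≤ ravg i a j b w * (ravg i a j b (fun x y => w x y ^ (1 / p)) ^ p *
        ravg i a j b (fun x y => w x y ^ (-1 / (p - 1))) ^ (p - 1)) := le_mul_of_one_le_right hw0 h2
    _ = (ravg i a j b w * ravg i a j b (fun x y => w x y ^ (-1 / (p - 1))) ^ (p - 1)) *
        ravg i a j b (fun x y => w x y ^ (1 / p)) ^ p := by ring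
    _ ≤ _ := mul_le_mul_of_nonneg_right hQ (by positivity)

/-- The constant in the comparison of the two square functions. -/
noncomputable def tlConst (p Q : ℝ) : ℝ := Q * (4 * √(extraConst p 1)) ^ p

/-- The weights in `L ^ 2` for which Stein's inequality holds. -/
theorem ravg_gridSum_avg_sq_le {n : ℕ} {Q : ℝ} {W : ℤ → ℤ → ℝ} (hW : ∀ x y, 0 < W x y)
    (hQ : IsGridAp n 2 Q W) {c : ℕ → ℤ → ℕ → ℤ → ℝ} (hc : ∀ i a j b, 0 ≤ c i a j b)
    {v : ℤ → ℤ → ℝ} (hv : ∀ x y, 0 ≤ v x y) (m m' : ℤ) :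
    ravg n m n m' (fun x y => gridSum n (fun i a j b => c i a j b * ravg i a j b v ^ 2) x y *
        W x y) ≤ Q * ravg n m n m' (fun x y => gridSum n c x y * (v x y ^ 2 * W x y)) := by
  rw [ravg_gridSum_mul, ravg_gridSum_mul, ← ravg_mul_left]
  refine ravg_mono fun x y _ _ => ?_
  unfold gridSum
  rw [Finset.mul_sum]
  refine Finset.sum_le_sum fun k hk => ?_
  rw [Finset.mem_product, Finset.mem_Icc, Finset.mem_Icc] at hk
  set i := k.1
  set j := k.2
  set a := x / 2 ^ i
  set b := y / 2 ^ j
  have h1 := ravg_mul_le (p := 2) (i := i) (j := j) (a := a) (b := b) one_lt_two hW hv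
    (fun x y => zero_le_one)
  have h2 := hQ i hk.1.2 j hk.2.2 a b
  have e1 : (2 - 1 : ℝ) = 1 := by norm_num
  have e2 : (1 - 1 / 2 : ℝ) = 1 / 2 := by norm_num
  simp only [Real.rpow_two, mul_one, one_mul, Real.one_rpow, e1, e2, Real.rpow_one,
    ← Real.sqrt_eq_rpow] at h1 h2
  have hA : 0 ≤ ravg i a j b (fun x y => v x y ^ 2 * W x y) :=
    ravg_nonneg fun x y => mul_nonneg (sq_nonneg _) (hW x y).le
  have hB : 0 ≤ ravg i a j b (fun x y => W x y ^ (-1 / 1 : ℝ)) :=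
    ravg_nonneg fun x y => Real.rpow_nonneg (hW x y).le _
  have hv0 : 0 ≤ ravg i a j b v := ravg_nonneg hv
  have h3 := pow_le_pow_left₀ hv0 h1 2
  rw [mul_pow, Real.sq_sqrt hA, Real.sq_sqrt hB] at h3
  have hWp : 0 ≤ ravg i a j b W := (ravg_pos hW).le
  -- The whole of Stein's inequality at `p = 2`: Cauchy–Schwarz on one rectangle, then `A_2`.
  have h4 : ravg i a j b v ^ 2 * ravg i a j b W ≤
      Q * ravg i a j b (fun x y => v x y ^ 2 * W x y) := by
    have := mul_le_mul_of_nonneg_right h3 hWp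
    have := mul_le_mul_of_nonneg_left h2 hA
    linarith
  have := mul_le_mul_of_nonneg_left h4 (hc i a j b)
  linarith

/-- The comparison of the Triebel–Lizorkin square function with the weighted one. -/
theorem ravg_tl_le {p Q : ℝ} (hp : 1 < p) {n : ℕ} {w : ℤ → ℤ → ℝ} (hw : ∀ x y, 0 < w x y)
    (hQ : IsGridAp n p Q w) {c : ℕ → ℤ → ℕ → ℤ → ℝ} (hc : ∀ i a j b, 0 ≤ c i a j b) (m m' : ℤ) :
    ravg n m n m' (fun x y =>
        gridSum n (fun i a j b => c i a j b * ravg i a j b w ^ (2 / p)) x y ^ (p / 2)) ≤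
      tlConst p Q * ravg n m n m' (fun x y => gridSum n c x y ^ (p / 2) * w x y) := by
  have hp0 : 0 < p := by linarith
  have hQ0 := hQ.nonneg hw
  set v : ℤ → ℤ → ℝ := fun x y => w x y ^ (1 / p) with hv
  have hv0 : ∀ x y, 0 ≤ v x y := fun x y => Real.rpow_nonneg (hw x y).le _
  have hF0 : ∀ x y, 0 ≤ gridSum n (fun i a j b => c i a j b * ravg i a j b v ^ 2) x y :=
    gridSum_nonneg fun i a j b => mul_nonneg (hc i a j b) (sq_nonneg _)
  have hG0 : ∀ x y, 0 ≤ gridSum n c x y := gridSum_nonneg hc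
  have hE : 0 ≤ extraConst p 1 := by
    have := smaxConst_pos p 1
    have := smaxConst_pos (p / (p - 1)) (1 ^ (1 / (p - 1)))
    unfold extraConst
    positivity
  -- Extrapolation goes to the weight `1`. The weight `w` is carried by `G`, through `v ^ p = w`.
  have h := extrapolation hp hE (fun _ _ => zero_lt_one) (isGridAp_one n p)
    (F := fun x y => √(gridSum n (fun i a j b => c i a j b * ravg i a j b v ^ 2) x y))
    (G := fun x y => √(gridSum n c x y) * v x y) (fun x y => Real.sqrt_nonneg _)
    (fun x y => mul_nonneg (Real.sqrt_nonneg _) (hv0 x y)) (m := m) (m' := m') fun W hW hWQ => by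
      simp_rw [mul_pow, Real.sq_sqrt (hF0 _ _), Real.sq_sqrt (hG0 _ _), mul_assoc]
      exact ravg_gridSum_avg_sq_le hW hWQ hc hv0 m m'
  have e : ∀ x y, (√(gridSum n c x y) * v x y) ^ p = gridSum n c x y ^ (p / 2) * w x y := by
    intro x y
    rw [Real.mul_rpow (Real.sqrt_nonneg _) (hv0 x y), sqrt_rpow (hG0 x y), hv, one_div]
    dsimp only
    rw [Real.rpow_inv_rpow (hw x y).le hp0.ne']
  simp only [mul_one, sqrt_rpow (hF0 _ _), e] at h
  rw [tlConst, mul_assoc]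
  refine le_trans ?_ (mul_le_mul_of_nonneg_left h hQ0)
  rw [← ravg_mul_left]
  refine ravg_mono fun x y _ _ => ?_
  have hle : gridSum n (fun i a j b => c i a j b * ravg i a j b w ^ (2 / p)) x y ≤
      Q ^ (2 / p) * gridSum n (fun i a j b => c i a j b * ravg i a j b v ^ 2) x y := by
    unfold gridSum
    rw [Finset.mul_sum]
    refine Finset.sum_le_sum fun k hk => ?_
    rw [Finset.mem_product, Finset.mem_Icc, Finset.mem_Icc] at hk
    have h1 := ravg_le_rpow_root hp hw (hQ k.1 hk.1.2 k.2 hk.2.2 (x / 2 ^ k.1) (y / 2 ^ k.2))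
    have h2 := Real.rpow_le_rpow (ravg_pos hw).le h1 (show 0 ≤ 2 / p by positivity)
    rw [Real.mul_rpow hQ0 (Real.rpow_nonneg (ravg_nonneg hv0) _),
      ← Real.rpow_mul (ravg_nonneg hv0), mul_div_cancel₀ _ hp0.ne', Real.rpow_two] at h2
    have := mul_le_mul_of_nonneg_left h2 (hc k.1 (x / 2 ^ k.1) k.2 (y / 2 ^ k.2))
    linarith
  calc _ ≤ (Q ^ (2 / p) * gridSum n (fun i a j b => c i a j b * ravg i a j b v ^ 2) x y) ^ (p / 2) :=
        Real.rpow_le_rpow (gridSum_nonneg (fun i a j b => mul_nonneg (hc i a j b)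
          (Real.rpow_nonneg (ravg_pos hw).le _)) x y) hle (by positivity)
    _ = _ := by
        rw [Real.mul_rpow (by positivity) (hF0 x y), ← Real.rpow_mul hQ0]
        have : 2 / p * (p / 2) = 1 := by field_simp
        rw [this, Real.rpow_one]

theorem tlConst_nonneg {p Q : ℝ} (hQ : 0 ≤ Q) : 0 ≤ tlConst p Q :=
  mul_nonneg hQ (Real.rpow_nonneg (by positivity) _)

theorem squareConst_nonneg (p Q : ℝ) : 0 ≤ squareConst p Q := Real.rpow_nonneg (by positivity) _

theorem ravg_tl_le_norm {p Q : ℝ} (hp : 1 < p) {n : ℕ} {w : ℤ → ℤ → ℝ} (hw : ∀ x y, 0 < w x y)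
    (hQ : IsGridAp n p Q w) (f : ℤ → ℤ → ℂ) (m m' : ℤ) :
    ravg n m n m' (fun x y => gridSum n
        (fun i a j b => ‖rdiff i a j b f‖ ^ 2 * ravg i a j b w ^ (2 / p)) x y ^ (p / 2)) ≤
      tlConst p Q * squareConst p Q * ravg n m n m' (fun x y => ‖f x y‖ ^ p * w x y) := by
  rw [mul_assoc]
  exact (ravg_tl_le hp hw hQ (fun _ _ _ _ => sq_nonneg _) m m').trans
    (mul_le_mul_of_nonneg_left (ravg_square_le hp hw hQ f m m') (tlConst_nonneg (hQ.nonneg hw)))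


/-! ### The converse estimate on the grid, by duality. -/

theorem norm_bavg_le (k : ℕ) (m : ℤ) (f : ℤ → ℂ) : ‖bavg k m f‖ ≤ bavg k m fun x => ‖f x‖ := by
  induction k generalizing m with
  | zero => rfl
  | succ k ih =>
    rw [bavg_succ, bavg_succ', norm_smul]
    have := norm_add_le (bavg k (2 * m) f) (bavg k (2 * m + 1) f)
    have h1 := ih (2 * m)
    have h2 := ih (2 * m + 1)
    norm_num
    linarith

theorem norm_ravg_le (i : ℕ) (a : ℤ) (j : ℕ) (b : ℤ) (f : ℤ → ℤ → ℂ) :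
    ‖ravg i a j b f‖ ≤ ravg i a j b fun x y => ‖f x y‖ :=
  (norm_bavg_le _ _ _).trans (bavg_mono fun _ _ => norm_bavg_le _ _ _)

/-- Parseval's identity for the Haar system on a dyadic interval. -/
theorem bavg_mul_eq (n : ℕ) (m : ℤ) (f g : ℤ → ℂ) :
    bavg n m (fun x => f x * g x) =
      bavg n m (fun x => ∑ i ∈ Finset.Icc 1 n, bdiff i (x / 2 ^ i) f * bdiff i (x / 2 ^ i) g) +
        bavg n m f * bavg n m g := by
  induction n generalizing m with
  | zero => simp
  | succ n ih =>
    have hsum : bavg (n + 1) m (fun x => ∑ i ∈ Finset.Icc 1 (n + 1),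
        bdiff i (x / 2 ^ i) f * bdiff i (x / 2 ^ i) g) =
        bavg (n + 1) m (fun x => ∑ i ∈ Finset.Icc 1 n,
          bdiff i (x / 2 ^ i) f * bdiff i (x / 2 ^ i) g) +
        bdiff (n + 1) m f * bdiff (n + 1) m g := by
      rw [bavg_congr (f := fun x => ∑ i ∈ Finset.Icc 1 (n + 1),
        bdiff i (x / 2 ^ i) f * bdiff i (x / 2 ^ i) g)
        (g := fun x => ∑ i ∈ Finset.Icc 1 n, bdiff i (x / 2 ^ i) f * bdiff i (x / 2 ^ i) g +
          bdiff (n + 1) m f * bdiff (n + 1) m g) fun x hx => by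
          rw [Finset.sum_Icc_succ_top (by omega), hx], bavg_add, bavg_const]
    rw [hsum, bavg_succ, ih, ih, bavg_succ n m fun x => ∑ i ∈ Finset.Icc 1 n, _, bavg_succ n m f,
      bavg_succ n m g, bdiff, bdiff, Nat.add_sub_cancel]
    simp only [Complex.real_smul]
    push_cast
    ring

/-- Parseval's identity for the product Haar system on a dyadic rectangle. -/
theorem ravg_mul_eq (n : ℕ) (m m' : ℤ) (f g : ℤ → ℤ → ℂ) :
    ravg n m n m' (fun x y => f x y * g x y) =
      ravg n m n m' (fun x y => ∑ k ∈ Finset.Icc 1 n ×ˢ Finset.Icc 1 n,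
        rdiff k.1 (x / 2 ^ k.1) k.2 (y / 2 ^ k.2) f *
          rdiff k.1 (x / 2 ^ k.1) k.2 (y / 2 ^ k.2) g) +
      bavg n m (fun x => bavg n m' (f x) * bavg n m' (g x)) +
      bavg n m' (fun y => bavg n m (fun x => f x y) * bavg n m (fun x => g x y)) -
      ravg n m n m' f * ravg n m n m' g := by
  have h1 : ravg n m n m' (fun x y => f x y * g x y) =
      bavg n m' (fun y => ∑ j ∈ Finset.Icc 1 n, bavg n m (fun x =>
        bdiff j (y / 2 ^ j) (f x) * bdiff j (y / 2 ^ j) (g x))) +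
      bavg n m (fun x => bavg n m' (f x) * bavg n m' (g x)) := by
    simp only [ravg, bavg_mul_eq n m', bavg_add]
    rw [bavg_comm]
    congr 2; ext y
    rw [bavg_sum (f := fun j x => bdiff j (y / 2 ^ j) (f x) * bdiff j (y / 2 ^ j) (g x))]
  -- Parseval for the averages in the first variable. It leaves the product of the total means,
  -- which is counted in both boundary terms and explains the subtraction.
  have h2 := bavg_mul_eq n m' (fun y => bavg n m (fun x => f x y))
    (fun y => bavg n m (fun x => g x y))
  have h3 : bavg n m' (fun y => ∑ j ∈ Finset.Icc 1 n, bavg n m (fun x =>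
        bdiff j (y / 2 ^ j) (f x) * bdiff j (y / 2 ^ j) (g x))) =
      ravg n m n m' (fun x y => ∑ k ∈ Finset.Icc 1 n ×ˢ Finset.Icc 1 n,
        rdiff k.1 (x / 2 ^ k.1) k.2 (y / 2 ^ k.2) f *
          rdiff k.1 (x / 2 ^ k.1) k.2 (y / 2 ^ k.2) g) +
      bavg n m' (fun y => ∑ j ∈ Finset.Icc 1 n,
        bdiff j (y / 2 ^ j) (fun y => bavg n m (fun x => f x y)) *
        bdiff j (y / 2 ^ j) (fun y => bavg n m (fun x => g x y))) := by
    rw [ravg_swap, ravg, ← bavg_add]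
    congr 1; ext y
    simp_rw [Finset.sum_product_right]
    rw [bavg_sum (f := fun j x => ∑ i ∈ Finset.Icc 1 n,
      rdiff i (x / 2 ^ i) j (y / 2 ^ j) f * rdiff i (x / 2 ^ i) j (y / 2 ^ j) g),
      ← Finset.sum_add_distrib]
    refine Finset.sum_congr rfl fun j _ => ?_
    rw [bavg_mul_eq n m, ← bavg_bdiff_comm, ← bavg_bdiff_comm]
    rfl
  rw [h1, h3]
  rw [ravg_swap n n m m' f, ravg_swap n n m m' g]
  change bavg n m' (fun y => bavg n m (fun x => f x y) * bavg n m (fun x => g x y)) =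
    _ + ravg n m' n m (fun y x => f x y) * ravg n m' n m (fun y x => g x y) at h2
  rw [h2]
  ring

/-- A line is one of the `2 ^ n` lines of the square, so an average over it is at most `2 ^ n` times
the average over the square. -/
theorem bavg_mul_bavg_norm_le {n : ℕ} {m m' : ℤ} (f g : ℤ → ℤ → ℂ) :
    ‖bavg n m (fun x => bavg n m' (f x) * bavg n m' (g x))‖ ≤
      2 ^ n * ravg n m n m' (fun x y => ‖f x y‖) * ravg n m n m' (fun x y => ‖g x y‖) := by
  refine (norm_bavg_le _ _ _).trans ?_
  have h : ∀ x, x / 2 ^ n = m → ‖bavg n m' (f x) * bavg n m' (g x)‖ ≤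
      bavg n m' (fun y => ‖f x y‖) * (2 ^ n * ravg n m n m' fun x y => ‖g x y‖) := by
    intro x hx
    rw [norm_mul]
    refine mul_le_mul (norm_bavg_le _ _ _) ((norm_bavg_le _ _ _).trans ?_) (norm_nonneg _)
      (bavg_nonneg fun y => norm_nonneg _)
    have := le_two_pow_mul_bavg (k := n) (f := fun x => bavg n m' fun y => ‖g x y‖)
      (fun x => bavg_nonneg fun y => norm_nonneg _) x
    rwa [hx] at this
  refine (bavg_mono h).trans_eq ?_
  rw [bavg_mul_right, ravg, ravg]
  ring

/-- The three non-cancellative terms of Parseval's identity are estimated crudely. A factor `2 ^ n`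
is affordable: the square has `4 ^ n` cells, and a product of two averages has one such factor more
in the denominator than the integral being estimated. -/
theorem norm_ravg_mul_sub_le {n : ℕ} {m m' : ℤ} (f g : ℤ → ℤ → ℂ) :
    ‖ravg n m n m' (fun x y => f x y * g x y)‖ ≤
      ravg n m n m' (gridSum n fun i a j b => ‖rdiff i a j b f‖ * ‖rdiff i a j b g‖) +
      3 * 2 ^ n * ravg n m n m' (fun x y => ‖f x y‖) * ravg n m n m' (fun x y => ‖g x y‖) := by
  rw [ravg_mul_eq]
  have hA : ‖ravg n m n m' (fun x y => ∑ k ∈ Finset.Icc 1 n ×ˢ Finset.Icc 1 n,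
        rdiff k.1 (x / 2 ^ k.1) k.2 (y / 2 ^ k.2) f *
          rdiff k.1 (x / 2 ^ k.1) k.2 (y / 2 ^ k.2) g)‖ ≤
      ravg n m n m' (gridSum n fun i a j b => ‖rdiff i a j b f‖ * ‖rdiff i a j b g‖) := by
    refine (norm_ravg_le _ _ _ _ _).trans (ravg_mono fun x y _ _ => ?_)
    refine (norm_sum_le _ _).trans_eq (Finset.sum_congr rfl fun k _ => norm_mul _ _)
  have hB := bavg_mul_bavg_norm_le (n := n) (m := m) (m' := m') f g
  have hC := bavg_mul_bavg_norm_le (n := n) (m := m') (m' := m) (fun y x => f x y)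
    (fun y x => g x y)
  rw [← ravg_swap n n m m' (fun x y => ‖f x y‖), ← ravg_swap n n m m' (fun x y => ‖g x y‖)] at hC
  have hf0 : 0 ≤ ravg n m n m' (fun x y => ‖f x y‖) := ravg_nonneg fun _ _ => norm_nonneg _
  have hg0 : 0 ≤ ravg n m n m' (fun x y => ‖g x y‖) := ravg_nonneg fun _ _ => norm_nonneg _
  have hD : ‖ravg n m n m' f * ravg n m n m' g‖ ≤
      2 ^ n * ravg n m n m' (fun x y => ‖f x y‖) * ravg n m n m' (fun x y => ‖g x y‖) := by
    rw [norm_mul, mul_assoc]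
    refine (mul_le_mul (norm_ravg_le _ _ _ _ _) (norm_ravg_le _ _ _ _ _) (norm_nonneg _)
      hf0).trans ?_
    exact le_mul_of_one_le_left (mul_nonneg hf0 hg0) (one_le_pow₀ one_le_two)
  refine (norm_sub_le _ _).trans ?_
  refine (add_le_add (norm_add₃_le) le_rfl).trans ?_
  linarith

/-- The constant in the converse estimate. -/
noncomputable def dualConst (p Q : ℝ) : ℝ :=
  (tlConst (p / (p - 1)) (Q ^ (1 / (p - 1))) * squareConst (p / (p - 1)) (Q ^ (1 / (p - 1)))) ^
    (1 - 1 / p)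

theorem one_le_ravg_rpow_mul {p : ℝ} (hp : 1 < p) {w : ℤ → ℤ → ℝ} (hw : ∀ x y, 0 < w x y)
    (i : ℕ) (a : ℤ) (j : ℕ) (b : ℤ) :
    1 ≤ ravg i a j b w ^ (1 / p) *
      ravg i a j b (fun x y => w x y ^ (-1 / (p - 1))) ^ (1 - 1 / p) := by
  have := ravg_mul_le (i := i) (j := j) (a := a) (b := b) hp hw (fun x y => zero_le_one)
    (fun x y => zero_le_one)
  simpa only [mul_one, ravg_const, Real.one_rpow, one_mul] using this

/-- Insert `1 ≤ ⟨w⟩_R ^ (1 / p) ⟨σ⟩_R ^ (1 - 1 / p)`, which is Hölder for the constant one, in every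
term; then Cauchy–Schwarz over the rectangles. -/
theorem gridSum_mul_le {p : ℝ} (hp : 1 < p) {n : ℕ} {w : ℤ → ℤ → ℝ} (hw : ∀ x y, 0 < w x y)
    {c d : ℕ → ℤ → ℕ → ℤ → ℝ} (hc : ∀ i a j b, 0 ≤ c i a j b) (hd : ∀ i a j b, 0 ≤ d i a j b)
    (x y : ℤ) :
    gridSum n (fun i a j b => c i a j b * d i a j b) x y ≤
      √(gridSum n (fun i a j b => c i a j b ^ 2 * ravg i a j b w ^ (2 / p)) x y) *
      √(gridSum n (fun i a j b => d i a j b ^ 2 *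
        ravg i a j b (fun x y => w x y ^ (-1 / (p - 1))) ^ (2 / (p / (p - 1)))) x y) := by
  have hp0 : 0 < p := by linarith
  have hp1 : 0 < p - 1 := by linarith
  have hs : ∀ i a j b, 0 ≤ ravg i a j b (fun x y => w x y ^ (-1 / (p - 1))) := fun i a j b =>
    ravg_nonneg fun x y => Real.rpow_nonneg (hw x y).le _
  have hw0 : ∀ i a j b, 0 ≤ ravg i a j b w := fun i a j b => (ravg_pos hw).le
  have e1 : ∀ i a j b, c i a j b ^ 2 * ravg i a j b w ^ (2 / p) =
      (c i a j b * ravg i a j b w ^ (1 / p)) ^ 2 := by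
    intro i a j b
    rw [mul_pow, ← Real.rpow_two (ravg i a j b w ^ (1 / p)), ← Real.rpow_mul (hw0 i a j b)]
    ring_nf
  have e2 : ∀ i a j b, d i a j b ^ 2 *
      ravg i a j b (fun x y => w x y ^ (-1 / (p - 1))) ^ (2 / (p / (p - 1))) =
      (d i a j b * ravg i a j b (fun x y => w x y ^ (-1 / (p - 1))) ^ (1 - 1 / p)) ^ 2 := by
    intro i a j b
    rw [mul_pow, ← Real.rpow_two (ravg i a j b _ ^ (1 - 1 / p)), ← Real.rpow_mul (hs i a j b)]
    congr 2
    field_simp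
  simp only [e1, e2]
  unfold gridSum
  refine le_trans (Finset.sum_le_sum fun k _ => ?_) (Real.sum_mul_le_sqrt_mul_sqrt _ _ _)
  have h1 := one_le_ravg_rpow_mul hp hw k.1 (x / 2 ^ k.1) k.2 (y / 2 ^ k.2)
  have := le_mul_of_one_le_right (mul_nonneg (hc k.1 (x / 2 ^ k.1) k.2 (y / 2 ^ k.2))
    (hd k.1 (x / 2 ^ k.1) k.2 (y / 2 ^ k.2))) h1
  linarith

/-- The converse estimate on a grid of cells, with an error that is negligible for large
rectangles. -/
theorem ravg_norm_rpow_le_tl {p Q : ℝ} (hp : 1 < p) {n : ℕ} {w : ℤ → ℤ → ℝ}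
    (hw : ∀ x y, 0 < w x y) (hQ : IsGridAp n p Q w) (f : ℤ → ℤ → ℂ) (m m' : ℤ) :
    ravg n m n m' (fun x y => ‖f x y‖ ^ p * w x y) ≤
      dualConst p Q * (ravg n m n m' (fun x y => gridSum n
        (fun i a j b => ‖rdiff i a j b f‖ ^ 2 * ravg i a j b w ^ (2 / p)) x y ^ (p / 2)) ^ (1 / p) *
        ravg n m n m' (fun x y => ‖f x y‖ ^ p * w x y) ^ (1 - 1 / p)) +
      3 * 2 ^ n * ravg n m n m' (fun x y => ‖f x y‖) *
        ravg n m n m' (fun x y => ‖f x y‖ ^ (p - 1) * w x y) := by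
  have hp0 : 0 < p := by linarith
  have hp1 : 0 < p - 1 := by linarith
  have hp' : 1 < p / (p - 1) := by rw [lt_div_iff₀ hp1]; linarith
  have hθ : 0 < 1 - 1 / p := by rw [sub_pos, div_lt_one hp0]; exact hp
  have hσ : ∀ x y, 0 < w x y ^ (-1 / (p - 1)) := fun x y => Real.rpow_pos_of_pos (hw x y) _
  -- The extremal dual function: `f * g = |f| ^ p * w`, and its dual norm, to the conjugate power,
  -- is the same quantity `X`.
  let g : ℤ → ℤ → ℂ := fun x y =>
    (starRingEnd ℂ) (f x y) * ((‖f x y‖ ^ (p - 2) * w x y : ℝ) : ℂ)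
  have hfg : ∀ x y, f x y * g x y = ((‖f x y‖ ^ p * w x y : ℝ) : ℂ) := by
    intro x y
    simp only [g]
    rw [← mul_assoc, Complex.mul_conj, Complex.normSq_eq_norm_sq, ← Complex.ofReal_mul, ← mul_assoc]
    rcases eq_or_ne (f x y) 0 with h | h
    · simp [h, Real.zero_rpow hp0.ne']
    · rw [← Real.rpow_two, ← Real.rpow_add (norm_pos_iff.2 h), add_sub_cancel]
  have hgn : ∀ x y, ‖g x y‖ = ‖f x y‖ ^ (p - 1) * w x y := by
    intro x y
    simp only [g, norm_mul, RCLike.norm_conj, Complex.norm_real]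
    rw [Real.norm_of_nonneg (Real.rpow_nonneg (norm_nonneg _) _),
      Real.norm_of_nonneg (hw x y).le, ← mul_assoc]
    rcases eq_or_ne (f x y) 0 with h | h
    · simp [h, Real.zero_rpow hp1.ne']
    · rw [← Real.rpow_one_add' (norm_nonneg _) (by linarith)]
      ring_nf
  have hX : ravg n m n m' (fun x y => ‖f x y‖ ^ p * w x y) =
      ‖ravg n m n m' (fun x y => f x y * g x y)‖ := by
    have h1 := ravg_map (i := n) (j := n) (a := m) (b := m') Complex.ofRealLI.toLinearMap
      (fun x y => ‖f x y‖ ^ p * w x y)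
    simp_rw [hfg]
    have h0 : 0 ≤ ravg n m n m' (fun x y => ‖f x y‖ ^ p * w x y) := ravg_nonneg fun x y =>
      mul_nonneg (Real.rpow_nonneg (norm_nonneg _) _) (hw x y).le
    refine Eq.trans ?_ (congrArg norm h1).symm
    exact ((Complex.norm_real _).trans (Real.norm_of_nonneg h0)).symm
  set X := ravg n m n m' (fun x y => ‖f x y‖ ^ p * w x y) with hXdef
  have hX0 : 0 ≤ X := ravg_nonneg fun x y =>
    mul_nonneg (Real.rpow_nonneg (norm_nonneg _) _) (hw x y).le
  have hgX : ravg n m n m' (fun x y => ‖g x y‖ ^ (p / (p - 1)) * w x y ^ (-1 / (p - 1))) = X := by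
    rw [hXdef]
    congr 1; ext x y
    have h2 := hw x y
    rw [hgn, Real.mul_rpow (by positivity) h2.le, ← Real.rpow_mul (norm_nonneg _),
      mul_div_cancel₀ _ hp1.ne', mul_assoc, ← Real.rpow_add h2]
    have : p / (p - 1) + -1 / (p - 1) = 1 := by field_simp; ring
    rw [this, Real.rpow_one]
  have key := norm_ravg_mul_sub_le (n := n) (m := m) (m' := m') f g
  rw [← hX] at key
  simp only [hgn] at key
  refine key.trans (add_le_add ?_ le_rfl)
  have hP0 : ∀ x y, 0 ≤ gridSum n
      (fun i a j b => ‖rdiff i a j b f‖ ^ 2 * ravg i a j b w ^ (2 / p)) x y :=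
    gridSum_nonneg fun i a j b => mul_nonneg (sq_nonneg _) (Real.rpow_nonneg (ravg_pos hw).le _)
  have hR0 : ∀ x y, 0 ≤ gridSum n (fun i a j b => ‖rdiff i a j b g‖ ^ 2 *
        ravg i a j b (fun x y => w x y ^ (-1 / (p - 1))) ^ (2 / (p / (p - 1)))) x y :=
    gridSum_nonneg fun i a j b => mul_nonneg (sq_nonneg _) (Real.rpow_nonneg (ravg_pos hσ).le _)
  refine (ravg_mono fun x y _ _ => gridSum_mul_le hp hw (fun i a j b => norm_nonneg _)
    (fun i a j b => norm_nonneg _) x y).trans ?_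
  have hH := ravg_mul_le (i := n) (j := n) (a := m) (b := m') hp (w := fun _ _ => 1)
    (fun _ _ => zero_lt_one) (f := fun x y => √(gridSum n
      (fun i a j b => ‖rdiff i a j b f‖ ^ 2 * ravg i a j b w ^ (2 / p)) x y))
    (g := fun x y => √(gridSum n (fun i a j b => ‖rdiff i a j b g‖ ^ 2 *
        ravg i a j b (fun x y => w x y ^ (-1 / (p - 1))) ^ (2 / (p / (p - 1)))) x y))
    (fun _ _ => Real.sqrt_nonneg _) (fun _ _ => Real.sqrt_nonneg _)
  simp only [Real.one_rpow, mul_one, sqrt_rpow (hP0 _ _), sqrt_rpow (hR0 _ _)] at hH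
  -- The direct estimate for the dual weight, the conjugate exponent and `g`.
  have hT := ravg_tl_le_norm hp' hσ (hQ.dual hp hw) g m m'
  rw [hgX] at hT
  have hC : 0 ≤ tlConst (p / (p - 1)) (Q ^ (1 / (p - 1))) *
      squareConst (p / (p - 1)) (Q ^ (1 / (p - 1))) :=
    mul_nonneg (tlConst_nonneg (Real.rpow_nonneg (hQ.nonneg hw) _)) (squareConst_nonneg _ _)
  have hT' := Real.rpow_le_rpow (ravg_nonneg fun x y => Real.rpow_nonneg (hR0 x y) _) hT hθ.le
  rw [Real.mul_rpow hC hX0] at hT'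
  refine hH.trans ?_
  have := mul_le_mul_of_nonneg_left hT' (Real.rpow_nonneg
    (ravg_nonneg fun x y => Real.rpow_nonneg (hP0 x y) (p / 2) : 0 ≤ ravg n m n m' (fun x y => gridSum n
      (fun i a j b => ‖rdiff i a j b f‖ ^ 2 * ravg i a j b w ^ (2 / p)) x y ^ (p / 2))) (1 / p))
  refine this.trans_eq ?_
  rw [dualConst]
  ring


/-! ### Dyadic rectangles of the plane as rectangles of the grid; Haar coefficients. -/

/-- The position of the dyadic interval of length `2 ^ k` that contains `x`. -/
noncomputable def pos (k : ℤ) (x : ℝ) : ℤ := ⌊x / 2 ^ k⌋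

theorem measurable_pos (k : ℤ) : Measurable (pos k) :=
  Int.measurable_floor.comp (measurable_id.div_const _)

theorem pos_add (k : ℤ) (i : ℕ) (x : ℝ) : pos (k + i) x = pos k x / 2 ^ i := by
  have h : x / (2 : ℝ) ^ (k + (i : ℤ)) = x / 2 ^ k / ((2 ^ i : ℕ) : ℝ) := by
    rw [zpow_add₀ two_ne_zero, zpow_natCast, div_div]; push_cast; rfl
  rw [pos, pos, h, Int.floor_div_natCast]; push_cast; rfl

theorem DyadicInterval.toSet_eq (k m : ℤ) : (⟨k, m⟩ : DyadicInterval).toSet = pos k ⁻¹' {m} := by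
  ext x
  have h2 : (0 : ℝ) < 2 ^ k := zpow_pos two_pos _
  simp only [DyadicInterval.toSet, DyadicInterval.length, mem_Ico, mem_preimage, mem_singleton_iff,
    pos, Int.floor_eq_iff, le_div_iff₀ h2, div_lt_iff₀ h2]

theorem DyadicInterval.measurableSet_toSet (I : DyadicInterval) : MeasurableSet I.toSet :=
  measurableSet_Ico

theorem DyadicInterval.volume_toSet (I : DyadicInterval) :
    volume I.toSet = ENNReal.ofReal I.length := by
  rw [DyadicInterval.toSet, Real.volume_Ico]; ring_nf

theorem DyadicInterval.left_eq (k m : ℤ) :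
    (⟨k + 1, m⟩ : DyadicInterval).left = (⟨k, 2 * m⟩ : DyadicInterval).toSet := by
  simp only [DyadicInterval.left, DyadicInterval.toSet, DyadicInterval.length,
    zpow_add_one₀ (two_ne_zero' ℝ)]
  push_cast
  congr 1 <;> ring

theorem DyadicInterval.right_eq (k m : ℤ) :
    (⟨k + 1, m⟩ : DyadicInterval).right = (⟨k, 2 * m + 1⟩ : DyadicInterval).toSet := by
  simp only [DyadicInterval.right, DyadicInterval.toSet, DyadicInterval.length,
    zpow_add_one₀ (two_ne_zero' ℝ)]
  push_cast
  congr 1 <;> ring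

theorem DyadicInterval.toSet_succ (k m : ℤ) : (⟨k + 1, m⟩ : DyadicInterval).toSet =
    (⟨k, 2 * m⟩ : DyadicInterval).toSet ∪ (⟨k, 2 * m + 1⟩ : DyadicInterval).toSet := by
  ext x
  have h := pos_add k 1 x
  simp only [Nat.cast_one, pow_one] at h
  simp only [toSet_eq, mem_preimage, mem_singleton_iff, mem_union]
  omega

/-- The dyadic rectangle with sides of length `2 ^ k` and `2 ^ l` and position `(m, m')`. -/
def rect (k m l m' : ℤ) : DyadicRect := ⟨⟨k, m⟩, ⟨l, m'⟩⟩

theorem mem_rect {k m l m' : ℤ} {z : ℝ × ℝ} :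
    z ∈ (rect k m l m').toSet ↔ pos k z.1 = m ∧ pos l z.2 = m' := by
  rw [DyadicRect.toSet, rect, DyadicInterval.toSet_eq, DyadicInterval.toSet_eq]; rfl

theorem DyadicRect.measurableSet_toSet (R : DyadicRect) : MeasurableSet R.toSet :=
  R.I.measurableSet_toSet.prod R.J.measurableSet_toSet

/-- The area of the dyadic rectangles with sides of length `2 ^ k` and `2 ^ l`. -/
noncomputable def area (k l : ℤ) : ℝ := 2 ^ k * 2 ^ l

theorem area_pos (k l : ℤ) : 0 < area k l := mul_pos (zpow_pos two_pos _) (zpow_pos two_pos _)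

theorem volume_rect (k m l m' : ℤ) :
    volume (rect k m l m').toSet = ENNReal.ofReal (area k l) := by
  rw [DyadicRect.toSet, Measure.volume_eq_prod, Measure.prod_prod, DyadicInterval.volume_toSet,
    DyadicInterval.volume_toSet]
  exact (ENNReal.ofReal_mul (zpow_pos two_pos k).le).symm

theorem area_add (k l : ℤ) (i j : ℕ) : area (k + i) (l + j) = 2 ^ i * (2 ^ j * area k l) := by
  simp only [area, zpow_add₀ (two_ne_zero' ℝ), zpow_natCast]; ring

theorem rect_succ_left (k m l m' : ℤ) : (rect (k + 1) m l m').toSet =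
    (rect k (2 * m) l m').toSet ∪ (rect k (2 * m + 1) l m').toSet := by
  simp only [rect, DyadicRect.toSet, DyadicInterval.toSet_succ, union_prod]

theorem rect_succ_right (k m l m' : ℤ) : (rect k m (l + 1) m').toSet =
    (rect k m l (2 * m')).toSet ∪ (rect k m l (2 * m' + 1)).toSet := by
  simp only [rect, DyadicRect.toSet, DyadicInterval.toSet_succ, prod_union]

theorem disjoint_rect_left (k m l m' : ℤ) :
    Disjoint (rect k (2 * m) l m').toSet (rect k (2 * m + 1) l m').toSet := by
  rw [Set.disjoint_left]
  intro z
  simp only [mem_rect]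
  omega

theorem disjoint_rect_right (k m l m' : ℤ) :
    Disjoint (rect k m l (2 * m')).toSet (rect k m l (2 * m' + 1)).toSet := by
  rw [Set.disjoint_left]
  intro z
  simp only [mem_rect]
  omega

theorem lintegral_rect_succ_left (h : ℝ × ℝ → ℝ≥0∞) (k m l m' : ℤ) :
    ∫⁻ z in (rect (k + 1) m l m').toSet, h z =
      (∫⁻ z in (rect k (2 * m) l m').toSet, h z) +
        ∫⁻ z in (rect k (2 * m + 1) l m').toSet, h z := by
  rw [rect_succ_left, lintegral_union (DyadicRect.measurableSet_toSet _)
    (disjoint_rect_left _ _ _ _)]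

theorem lintegral_rect_succ_right (h : ℝ × ℝ → ℝ≥0∞) (k m l m' : ℤ) :
    ∫⁻ z in (rect k m (l + 1) m').toSet, h z =
      (∫⁻ z in (rect k m l (2 * m')).toSet, h z) +
        ∫⁻ z in (rect k m l (2 * m' + 1)).toSet, h z := by
  rw [rect_succ_right, lintegral_union (DyadicRect.measurableSet_toSet _)
    (disjoint_rect_right _ _ _ _)]

/-- An additive function of dyadic intervals is determined by its values on the finest ones. -/
theorem eq_two_pow_smul_bavg {E : Type*} [AddCommGroup E] [Module ℝ E] {Ψ : ℕ → ℤ → E}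
    (h : ∀ i m, Ψ (i + 1) m = Ψ i (2 * m) + Ψ i (2 * m + 1)) (i : ℕ) (m : ℤ) :
    Ψ i m = (2 ^ i : ℝ) • bavg i m (Ψ 0) := by
  induction i generalizing m with
  | zero => simp
  | succ i ih =>
    rw [h, ih, ih, bavg_succ, smul_smul, ← smul_add]
    congr 1
    rw [pow_succ]; ring

theorem eq_ofReal_two_pow_mul_bavg {Ψ : ℕ → ℤ → ℝ≥0∞} {F : ℤ → ℝ}
    (h : ∀ i m, Ψ (i + 1) m = Ψ i (2 * m) + Ψ i (2 * m + 1)) (hF : ∀ m, 0 ≤ F m)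
    (h0 : ∀ m, Ψ 0 m = ENNReal.ofReal (F m)) (i : ℕ) (m : ℤ) :
    Ψ i m = ENNReal.ofReal (2 ^ i * bavg i m F) := by
  induction i generalizing m with
  | zero => simpa using h0 m
  | succ i ih =>
    rw [h, ih, ih, ← ENNReal.ofReal_add (mul_nonneg (by positivity) (bavg_nonneg hF))
      (mul_nonneg (by positivity) (bavg_nonneg hF)), bavg_succ', pow_succ]
    ring_nf

/-- Integrals over dyadic rectangles, from integrals over the cells. -/
theorem lintegral_rect_eq {h : ℝ × ℝ → ℝ≥0∞} {a : ℤ} {F : ℤ → ℤ → ℝ} (hF : ∀ x y, 0 ≤ F x y)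
    (h0 : ∀ x y, ∫⁻ z in (rect a x a y).toSet, h z = ENNReal.ofReal (area a a * F x y))
    (i : ℕ) (m : ℤ) (j : ℕ) (m' : ℤ) :
    ∫⁻ z in (rect (a + i) m (a + j) m').toSet, h z =
      ENNReal.ofReal (area (a + i) (a + j) * ravg i m j m' F) := by
  have hA := (area_pos a a).le
  have h1 : ∀ x, ∫⁻ z in (rect a x (a + j) m').toSet, h z =
      ENNReal.ofReal (2 ^ j * bavg j m' fun y => area a a * F x y) := fun x =>
    eq_ofReal_two_pow_mul_bavg
      (Ψ := fun (j : ℕ) m' => ∫⁻ z in (rect a x (a + j) m').toSet, h z)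
      (fun j m' => by
        rw [Nat.cast_succ, ← add_assoc, lintegral_rect_succ_right])
      (fun y => mul_nonneg hA (hF x y)) (fun y => by simpa using h0 x y) j m'
  rw [eq_ofReal_two_pow_mul_bavg
      (Ψ := fun (i : ℕ) m => ∫⁻ z in (rect (a + i) m (a + j) m').toSet, h z)
      (fun i m => by
        rw [Nat.cast_succ, ← add_assoc, lintegral_rect_succ_left])
      (fun x => mul_nonneg (by positivity) (bavg_nonneg fun y => mul_nonneg hA (hF x y)))
      (F := fun x => 2 ^ j * bavg j m' fun y => area a a * F x y)
      (fun x => by rw [← h1 x, Nat.cast_zero, add_zero]) i m]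
  congr 1
  rw [area_add, ravg]
  simp only [bavg_mul_left]
  ring

section Bochner

variable {f : ℝ × ℝ → ℂ}

theorem integrableOn_rect (hf : LocallyIntegrable f) (k m l m' : ℤ) :
    IntegrableOn f (rect k m l m').toSet := by
  have hK : IsCompact ((Icc ((m : ℝ) * 2 ^ k) ((m + 1) * 2 ^ k)) ×ˢ
      (Icc ((m' : ℝ) * 2 ^ l) ((m' + 1) * 2 ^ l))) := isCompact_Icc.prod isCompact_Icc
  exact (hf.integrableOn_isCompact hK).mono_set (prod_mono Ico_subset_Icc_self Ico_subset_Icc_self)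

/-- The averages over the cells of length `2 ^ a`. -/
noncomputable def cellAvg (f : ℝ × ℝ → ℂ) (a x y : ℤ) : ℂ :=
  (area a a)⁻¹ • ∫ z in (rect a x a y).toSet, f z

theorem setIntegral_rect_eq (hf : LocallyIntegrable f) (a : ℤ) (i : ℕ) (m : ℤ) (j : ℕ) (m' : ℤ) :
    ∫ z in (rect (a + i) m (a + j) m').toSet, f z =
      area (a + i) (a + j) • ravg i m j m' (cellAvg f a) := by
  have h1 : ∀ x, ∫ z in (rect a x (a + j) m').toSet, f z =
      (2 ^ j : ℝ) • bavg j m' fun y => ∫ z in (rect a x a y).toSet, f z := fun x => by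
    have := eq_two_pow_smul_bavg (Ψ := fun (j : ℕ) m' => ∫ z in (rect a x (a + j) m').toSet, f z)
      (fun j m' => by
        rw [Nat.cast_succ, ← add_assoc, rect_succ_right, setIntegral_union
          (disjoint_rect_right _ _ _ _) (DyadicRect.measurableSet_toSet _)
          (integrableOn_rect hf _ _ _ _) (integrableOn_rect hf _ _ _ _)]) j m'
    simpa using this
  have h2 := eq_two_pow_smul_bavg
    (Ψ := fun (i : ℕ) m => ∫ z in (rect (a + i) m (a + j) m').toSet, f z)
    (fun i m => by
      rw [Nat.cast_succ, ← add_assoc, rect_succ_left, setIntegral_union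
        (disjoint_rect_left _ _ _ _) (DyadicRect.measurableSet_toSet _)
        (integrableOn_rect hf _ _ _ _) (integrableOn_rect hf _ _ _ _)]) i m
  have h3 : ∀ x y, ∫ z in (rect a x a y).toSet, f z = area a a • cellAvg f a x y := fun x y => by
    rw [cellAvg, smul_inv_smul₀ (area_pos a a).ne']
  rw [h2]
  simp only [CharP.cast_eq_zero, add_zero, h1]
  simp only [h3, bavg_smul, ravg, area_add, smul_smul]

theorem DyadicInterval.haar_eq (k m : ℤ) (x : ℝ) :
    (⟨k + 1, m⟩ : DyadicInterval).haar x = (√(2 ^ (k + 1)))⁻¹ *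
      ((⟨k, 2 * m + 1⟩ : DyadicInterval).toSet.indicator (fun _ => (1 : ℝ)) x -
        (⟨k, 2 * m⟩ : DyadicInterval).toSet.indicator (fun _ => (1 : ℝ)) x) := by
  rw [DyadicInterval.haar, DyadicInterval.left_eq, DyadicInterval.right_eq, div_eq_inv_mul]
  rfl

theorem haarCoeff_rect (hf : LocallyIntegrable f) (k m l m' : ℤ) :
    haarCoeff f (rect (k + 1) m (l + 1) m') = (√(2 ^ (k + 1)) * √(2 ^ (l + 1)))⁻¹ •
      (((∫ z in (rect k (2 * m + 1) l (2 * m' + 1)).toSet, f z) -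
        ∫ z in (rect k (2 * m + 1) l (2 * m')).toSet, f z) -
      ((∫ z in (rect k (2 * m) l (2 * m' + 1)).toSet, f z) -
        ∫ z in (rect k (2 * m) l (2 * m')).toSet, f z)) := by
  have hI : ∀ k m l m', Integrable ((rect k m l m').toSet.indicator f) := fun k m l m' =>
    (integrable_indicator_iff (DyadicRect.measurableSet_toSet _)).2 (integrableOn_rect hf k m l m')
  have hpt : ∀ z, f z * ((rect (k + 1) m (l + 1) m').haar z : ℂ) =
      (√(2 ^ (k + 1)) * √(2 ^ (l + 1)))⁻¹ •
      (((rect k (2 * m + 1) l (2 * m' + 1)).toSet.indicator f z -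
        (rect k (2 * m + 1) l (2 * m')).toSet.indicator f z) -
      ((rect k (2 * m) l (2 * m' + 1)).toSet.indicator f z -
        (rect k (2 * m) l (2 * m')).toSet.indicator f z)) := by
    intro z
    have hind : ∀ m m', (rect k m l m').toSet.indicator f z =
        (((⟨k, m⟩ : DyadicInterval).toSet.indicator (fun _ => (1 : ℝ)) z.1 : ℝ) : ℂ) *
        (((⟨l, m'⟩ : DyadicInterval).toSet.indicator (fun _ => (1 : ℝ)) z.2 : ℝ) : ℂ) * f z := by
      intro m m'
      by_cases h1 : z.1 ∈ (⟨k, m⟩ : DyadicInterval).toSet <;>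
        by_cases h2 : z.2 ∈ (⟨l, m'⟩ : DyadicInterval).toSet <;>
        simp [rect, DyadicRect.toSet, indicator, h1, h2]
    rw [DyadicRect.haar, rect, DyadicInterval.haar_eq, DyadicInterval.haar_eq, hind, hind, hind,
      hind, Complex.real_smul, mul_inv]
    push_cast
    ring
  rw [haarCoeff, integral_congr_ae (Filter.Eventually.of_forall hpt), integral_smul]
  have hsub : ∀ {g h : ℝ × ℝ → ℂ}, Integrable g → Integrable h →
      Integrable fun z => g z - h z := fun hg hh => hg.sub hh
  rw [integral_sub (hsub (hI _ _ _ _) (hI _ _ _ _)) (hsub (hI _ _ _ _) (hI _ _ _ _)),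
    integral_sub (hI _ _ _ _) (hI _ _ _ _), integral_sub (hI _ _ _ _) (hI _ _ _ _)]
  simp only [integral_indicator (DyadicRect.measurableSet_toSet _)]

/-- On a rectangle of area `A` the Haar function is `± A ^ (-1 / 2)` on quarters of area `A / 4`;
the factor `1 / 4` is the two halves in `rdiff`, so `√A` remains. Scales start at `a + 1` because
the quarters must be unions of cells. -/
theorem haarCoeff_eq_rdiff (hf : LocallyIntegrable f) (a : ℤ) (i : ℕ) (m : ℤ) (j : ℕ) (m' : ℤ) :
    haarCoeff f (rect (a + (i + 1 : ℕ)) m (a + (j + 1 : ℕ)) m') =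
      √(area (a + (i + 1 : ℕ)) (a + (j + 1 : ℕ))) •
        rdiff (i + 1) m (j + 1) m' (cellAvg f a) := by
  have h2 : ∀ k : ℤ, (0 : ℝ) < 2 ^ k := fun k => zpow_pos two_pos _
  rw [Nat.cast_succ, ← add_assoc, Nat.cast_succ, ← add_assoc, haarCoeff_rect hf]
  simp only [setIntegral_rect_eq hf]
  have hrd : rdiff (i + 1) m (j + 1) m' (cellAvg f a) = (1 / 4 : ℝ) •
      ((ravg i (2 * m + 1) j (2 * m' + 1) (cellAvg f a) -
        ravg i (2 * m + 1) j (2 * m') (cellAvg f a)) -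
      (ravg i (2 * m) j (2 * m' + 1) (cellAvg f a) -
        ravg i (2 * m) j (2 * m') (cellAvg f a))) := by
    simp only [rdiff, bdiff, Nat.add_sub_cancel, bavg_smul, bavg_sub, ravg]
    module
  rw [hrd, ← smul_sub, ← smul_sub, ← smul_sub, smul_smul, smul_smul]
  congr 1
  have e : area (a + i) (a + j) = area (a + i + 1) (a + j + 1) / 4 := by
    simp only [area, zpow_add_one₀ (two_ne_zero' ℝ)]; ring
  rw [← Real.sqrt_mul (h2 _).le, e]
  change (√(area (a + i + 1) (a + j + 1)))⁻¹ * (area (a + i + 1) (a + j + 1) / 4) = _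
  have hA := area_pos (a + i + 1) (a + j + 1)
  have hs := Real.sqrt_pos.2 hA
  have hsq := Real.mul_self_sqrt hA.le
  field_simp
  nlinarith

theorem enorm_haarCoeff_sq (hf : LocallyIntegrable f) (a : ℤ) {i j : ℕ} (hi : 1 ≤ i) (hj : 1 ≤ j)
    (m m' : ℤ) :
    ‖haarCoeff f (rect (a + i) m (a + j) m')‖ₑ ^ 2 *
        (volume (rect (a + i) m (a + j) m').toSet)⁻¹ =
      ENNReal.ofReal (‖rdiff i m j m' (cellAvg f a)‖ ^ 2) := by
  obtain ⟨i, rfl⟩ := Nat.exists_eq_succ_of_ne_zero (Nat.one_le_iff_ne_zero.1 hi)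
  obtain ⟨j, rfl⟩ := Nat.exists_eq_succ_of_ne_zero (Nat.one_le_iff_ne_zero.1 hj)
  have hA := area_pos (a + (i + 1 : ℕ)) (a + (j + 1 : ℕ))
  rw [Nat.succ_eq_add_one, Nat.succ_eq_add_one, haarCoeff_eq_rdiff hf, volume_rect,
    ← ofReal_norm, ← ENNReal.ofReal_pow (norm_nonneg _), ← ENNReal.ofReal_inv_of_pos hA,
    ← ENNReal.ofReal_mul (by positivity), norm_smul, Real.norm_of_nonneg (Real.sqrt_nonneg _),
    mul_pow, Real.sq_sqrt hA.le]
  congr 1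
  field_simp

end Bochner


/-! ### Weights on the plane and their cell averages. -/

theorem ofReal_area_ne_zero (k l : ℤ) : ENNReal.ofReal (area k l) ≠ 0 :=
  (ENNReal.ofReal_pos.2 (area_pos k l)).ne'

theorem lintegral_eq_avg (v : ℝ × ℝ → ℝ) (k m l m' : ℤ) :
    ∫⁻ z in (rect k m l m').toSet, ENNReal.ofReal (v z) =
      ENNReal.ofReal (area k l) * (rect k m l m').avg v := by
  rw [DyadicRect.avg, volume_rect, ← mul_assoc, ENNReal.mul_inv_cancel (ofReal_area_ne_zero k l)
    ENNReal.ofReal_ne_top, one_mul]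

/-- The average of a weight over a cell of length `2 ^ a`, as a real number. -/
noncomputable def weightCell (v : ℝ × ℝ → ℝ) (a x y : ℤ) : ℝ := ((rect a x a y).avg v).toReal

theorem weightCell_nonneg (v : ℝ × ℝ → ℝ) (a x y : ℤ) : 0 ≤ weightCell v a x y :=
  ENNReal.toReal_nonneg

/-- The integral over a dyadic rectangle of a function that is constant on cells. -/
theorem lintegral_rect_mul_eq {v : ℝ × ℝ → ℝ} {a : ℤ} (hv : ∀ x y, (rect a x a y).avg v ≠ ∞)
    {φ : ℤ → ℤ → ℝ} (hφ : ∀ x y, 0 ≤ φ x y) (i : ℕ) (m : ℤ) (j : ℕ) (m' : ℤ) :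
    ∫⁻ z in (rect (a + i) m (a + j) m').toSet,
        ENNReal.ofReal (φ (pos a z.1) (pos a z.2)) * ENNReal.ofReal (v z) =
      ENNReal.ofReal (area (a + i) (a + j) *
        ravg i m j m' fun x y => φ x y * weightCell v a x y) := by
  refine lintegral_rect_eq (fun x y => mul_nonneg (hφ x y) (weightCell_nonneg _ _ _ _))
    (fun x y => ?_) i m j m'
  have h1 : ∫⁻ z in (rect a x a y).toSet,
      ENNReal.ofReal (φ (pos a z.1) (pos a z.2)) * ENNReal.ofReal (v z) =
      ∫⁻ z in (rect a x a y).toSet, ENNReal.ofReal (φ x y) * ENNReal.ofReal (v z) := by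
    refine setLIntegral_congr_fun (DyadicRect.measurableSet_toSet _) fun z hz => ?_
    rw [mem_rect] at hz
    rw [hz.1, hz.2]
  rw [h1, lintegral_const_mul' _ _ ENNReal.ofReal_ne_top, lintegral_eq_avg,
    ← ENNReal.ofReal_toReal (hv x y), ← ENNReal.ofReal_mul (area_pos a a).le,
    ← ENNReal.ofReal_mul (hφ x y)]
  congr 1
  rw [weightCell]
  ring

theorem avg_rect_eq {v : ℝ × ℝ → ℝ} {a : ℤ} (hv : ∀ x y, (rect a x a y).avg v ≠ ∞)
    (i : ℕ) (m : ℤ) (j : ℕ) (m' : ℤ) :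
    (rect (a + i) m (a + j) m').avg v = ENNReal.ofReal (ravg i m j m' (weightCell v a)) := by
  have h := lintegral_rect_mul_eq hv (φ := fun _ _ => 1) (fun _ _ => zero_le_one) i m j m'
  simp only [ENNReal.ofReal_one, one_mul] at h
  rw [lintegral_eq_avg, ENNReal.ofReal_mul (area_pos _ _).le] at h
  exact (ENNReal.mul_right_inj (ofReal_area_ne_zero _ _) ENNReal.ofReal_ne_top).1 h

theorem avg_one (k m l m' : ℤ) : (rect k m l m').avg (fun _ => 1) = 1 := by
  rw [DyadicRect.avg, volume_rect]
  simp only [ENNReal.ofReal_one, lintegral_const, Measure.restrict_apply_univ, one_mul, volume_rect]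
  exact ENNReal.inv_mul_cancel (ofReal_area_ne_zero _ _) ENNReal.ofReal_ne_top

theorem lintegral_rect_const_eq {a : ℤ} {φ : ℤ → ℤ → ℝ} (hφ : ∀ x y, 0 ≤ φ x y) (i : ℕ) (m : ℤ)
    (j : ℕ) (m' : ℤ) :
    ∫⁻ z in (rect (a + i) m (a + j) m').toSet, ENNReal.ofReal (φ (pos a z.1) (pos a z.2)) =
      ENNReal.ofReal (area (a + i) (a + j) * ravg i m j m' φ) := by
  have h := lintegral_rect_mul_eq (v := fun _ => 1) (a := a)
    (fun x y => by rw [avg_one]; exact ENNReal.one_ne_top) hφ i m j m'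
  simpa only [ENNReal.ofReal_one, mul_one, weightCell, avg_one, ENNReal.toReal_one] using h

/-- The plane is the disjoint union of the dyadic squares of a given size. -/
theorem lintegral_eq_tsum_rect (k : ℤ) (h : ℝ × ℝ → ℝ≥0∞) :
    ∫⁻ z, h z = ∑' m : ℤ × ℤ, ∫⁻ z in (rect k m.1 k m.2).toSet, h z := by
  rw [← lintegral_iUnion (fun m : ℤ × ℤ => DyadicRect.measurableSet_toSet (rect k m.1 k m.2)),
    ← setLIntegral_univ]
  · congr 2
    ext z
    simp only [mem_univ, mem_iUnion, mem_rect, true_iff]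
    exact ⟨(_, _), rfl, rfl⟩
  · intro m n hmn
    simp only [Function.onFun, Set.disjoint_left, mem_rect]
    rintro z ⟨h1, h2⟩ ⟨h3, h4⟩
    exact hmn (Prod.ext (h1.symm.trans h3) (h2.symm.trans h4))

/-- Hölder for the splitting `g = (g * w ^ (1 / p)) * w ^ (-(1 / p))`. -/
theorem setLIntegral_le_Lp_mul_Lq {p : ℝ} (hp : 1 < p) {w : ℝ × ℝ → ℝ} (hwm : AEMeasurable w)
    (hw : ∀ᵐ x, 0 < w x) {g : ℝ × ℝ → ℝ≥0∞} (hg : AEMeasurable g) (S : Set (ℝ × ℝ)) :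
    ∫⁻ z in S, g z ≤ (∫⁻ z in S, g z ^ p * ENNReal.ofReal (w z)) ^ (1 / p) *
      (∫⁻ z in S, ENNReal.ofReal (w z ^ (-1 / (p - 1)))) ^ (1 - 1 / p) := by
  have hp0 : 0 < p := by linarith
  have hp1 : 0 < p - 1 := by linarith
  have hpq : p.HolderConjugate (p / (p - 1)) := Real.HolderConjugate.conjExponent hp
  have hW : AEMeasurable (fun z => ENNReal.ofReal (w z)) (volume.restrict S) :=
    hwm.restrict.ennreal_ofReal
  have h := ENNReal.lintegral_mul_le_Lp_mul_Lq (volume.restrict S) hpq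
    (f := fun z => g z * ENNReal.ofReal (w z) ^ (1 / p))
    (g := fun z => ENNReal.ofReal (w z) ^ (-(1 / p)))
    (hg.restrict.mul (hW.pow_const _)) (hW.pow_const _)
  have e : 1 / (p / (p - 1)) = 1 - 1 / p := by field_simp
  rw [e] at h
  refine le_trans (le_of_eq ?_) (h.trans (le_of_eq ?_))
  · refine lintegral_congr_ae ?_
    filter_upwards [ae_restrict_of_ae hw] with z hz
    have h0 := (ENNReal.ofReal_pos.2 hz).ne'
    simp only [Pi.mul_apply]
    rw [mul_assoc, ← ENNReal.rpow_add _ _ h0 ENNReal.ofReal_ne_top, add_neg_cancel,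
      ENNReal.rpow_zero, mul_one]
  · congr 2
    · refine lintegral_congr fun z => ?_
      rw [ENNReal.mul_rpow_of_nonneg _ _ hp0.le, ← ENNReal.rpow_mul, one_div_mul_cancel hp0.ne',
        ENNReal.rpow_one]
    · refine lintegral_congr_ae ?_
      filter_upwards [ae_restrict_of_ae hw] with z hz
      rw [← ENNReal.rpow_mul, ENNReal.ofReal_rpow_of_pos hz]
      congr 2
      field_simp

namespace IsDyadicApWeight

variable {p : ℝ} {w : ℝ × ℝ → ℝ}

theorem aemeasurable (h : IsDyadicApWeight p w) : AEMeasurable w :=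
  h.locallyIntegrable.aestronglyMeasurable.aemeasurable

theorem avg_ne_top (h : IsDyadicApWeight p w) (k m l m' : ℤ) : (rect k m l m').avg w ≠ ∞ := by
  have hK : IsCompact ((Icc ((m : ℝ) * 2 ^ k) ((m + 1) * 2 ^ k)) ×ˢ
      (Icc ((m' : ℝ) * 2 ^ l) ((m' + 1) * 2 ^ l))) := isCompact_Icc.prod isCompact_Icc
  have h1 : IntegrableOn w (rect k m l m').toSet :=
    (h.locallyIntegrable.integrableOn_isCompact hK).mono_set
      (prod_mono Ico_subset_Icc_self Ico_subset_Icc_self)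
  have h2 := (Integrable.lintegral_lt_top h1).ne
  rw [DyadicRect.avg, volume_rect]
  exact ENNReal.mul_ne_top (ENNReal.inv_ne_top.2 (ofReal_area_ne_zero _ _)) h2

theorem avg_ne_zero (h : IsDyadicApWeight p w) (k m l m' : ℤ) : (rect k m l m').avg w ≠ 0 := by
  intro h0
  have h1 := lintegral_eq_avg w k m l m'
  rw [h0, mul_zero, lintegral_eq_zero_iff' h.aemeasurable.restrict.ennreal_ofReal] at h1
  have h2 : ∀ᵐ z ∂volume.restrict (rect k m l m').toSet, False := by
    filter_upwards [h1, ae_restrict_of_ae h.ae_pos] with z hz hz'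
    exact (ENNReal.ofReal_pos.2 hz').ne' hz
  rw [Filter.eventually_false_iff_eq_bot, ae_eq_bot, Measure.restrict_eq_zero, volume_rect] at h2
  exact ofReal_area_ne_zero _ _ h2

theorem avg_mul_le (_h : IsDyadicApWeight p w) (R : DyadicRect) :
    R.avg w * R.avg (fun x => w x ^ (-1 / (p - 1))) ^ (p - 1) ≤ apChar p w :=
  le_iSup (fun R : DyadicRect => R.avg w * R.avg (fun x => w x ^ (-1 / (p - 1))) ^ (p - 1)) R

theorem avg_dual_ne_top (hp : 1 < p) (h : IsDyadicApWeight p w) (k m l m' : ℤ) :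
    (rect k m l m').avg (fun x => w x ^ (-1 / (p - 1))) ≠ ∞ := by
  have hp1 : 0 < p - 1 := by linarith
  intro ht
  have := (h.avg_mul_le (rect k m l m')).trans_lt h.apChar_lt_top
  rw [ht, ENNReal.top_rpow_of_pos hp1, ENNReal.mul_top (h.avg_ne_zero _ _ _ _)] at this
  exact this.ne rfl

theorem weightCell_pos (h : IsDyadicApWeight p w) (a x y : ℤ) : 0 < weightCell w a x y :=
  ENNReal.toReal_pos (h.avg_ne_zero _ _ _ _) (h.avg_ne_top _ _ _ _)

/-- Jensen's inequality, as Hölder for the constant one. Passing to cell averages preserves the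
averages of `w` over larger rectangles and can only lower those of the dual weight, so the
characteristic does not grow; this is what `isGridAp` uses. -/
theorem weightCell_rpow_le (hp : 1 < p) (h : IsDyadicApWeight p w) (a x y : ℤ) :
    weightCell w a x y ^ (-1 / (p - 1)) ≤ weightCell (fun x => w x ^ (-1 / (p - 1))) a x y := by
  have hp0 : 0 < p := by linarith
  have hp1 : 0 < p - 1 := by linarith
  have hθ : 0 < 1 - 1 / p := by rw [sub_pos, div_lt_one hp0]; exact hp
  have hH := setLIntegral_le_Lp_mul_Lq hp h.aemeasurable h.ae_pos (g := fun _ => 1)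
    aemeasurable_const (rect a x a y).toSet
  simp only [ENNReal.one_rpow, one_mul, lintegral_const, Measure.restrict_apply_univ] at hH
  have hA := area_pos a a
  have hw := h.weightCell_pos a x y
  have hs := weightCell_nonneg (fun x => w x ^ (-1 / (p - 1))) a x y
  rw [lintegral_eq_avg, lintegral_eq_avg, volume_rect,
    ← ENNReal.ofReal_toReal (h.avg_ne_top a x a y),
    ← ENNReal.ofReal_toReal (h.avg_dual_ne_top hp a x a y)] at hH
  change _ ≤ (_ * ENNReal.ofReal (weightCell w a x y)) ^ (1 / p) *
    (_ * ENNReal.ofReal (weightCell (fun x => w x ^ (-1 / (p - 1))) a x y)) ^ (1 - 1 / p) at hH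
  set W := weightCell w a x y
  set s := weightCell (fun x => w x ^ (-1 / (p - 1))) a x y
  rw [← ENNReal.ofReal_mul hA.le, ← ENNReal.ofReal_mul hA.le,
    ENNReal.ofReal_rpow_of_nonneg (by positivity) (by positivity),
    ENNReal.ofReal_rpow_of_nonneg (by positivity) hθ.le,
    ← ENNReal.ofReal_mul (by positivity), ENNReal.ofReal_le_ofReal_iff (by positivity),
    Real.mul_rpow hA.le hw.le, Real.mul_rpow hA.le hs] at hH
  have e : area a a ^ (1 / p) * W ^ (1 / p) * (area a a ^ (1 - 1 / p) * s ^ (1 - 1 / p)) =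
      area a a * (W ^ (1 / p) * s ^ (1 - 1 / p)) := by
    have : area a a ^ (1 / p) * area a a ^ (1 - 1 / p) = area a a := by
      rw [← Real.rpow_add hA, add_sub_cancel, Real.rpow_one]
    linear_combination (W ^ (1 / p) * s ^ (1 - 1 / p)) * this
  rw [e] at hH
  have h1 : 1 ≤ W ^ (1 / p) * s ^ (1 - 1 / p) := by
    by_contra hlt
    push Not at hlt
    nlinarith
  have h2 := Real.rpow_le_rpow zero_le_one h1 (show 0 ≤ p / (p - 1) by positivity)
  rw [Real.one_rpow, Real.mul_rpow (by positivity) (by positivity), ← Real.rpow_mul hw.le,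
    ← Real.rpow_mul hs] at h2
  have e1 : 1 / p * (p / (p - 1)) = 1 / (p - 1) := by field_simp
  have e2 : (1 - 1 / p) * (p / (p - 1)) = 1 := by field_simp
  rw [e1, e2, Real.rpow_one] at h2
  rw [neg_div, Real.rpow_neg hw.le, inv_le_iff_one_le_mul₀ (Real.rpow_pos_of_pos hw _)]
  linarith

theorem isGridAp (hp : 1 < p) (h : IsDyadicApWeight p w) (n : ℕ) (a : ℤ) :
    IsGridAp n p (apChar p w).toReal (weightCell w a) := by
  have hp1 : 0 < p - 1 := by linarith
  intro i _ j _ m m'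
  have h1 := h.avg_mul_le (rect (a + i) m (a + j) m')
  rw [avg_rect_eq (fun x y => h.avg_ne_top a x a y),
    avg_rect_eq (fun x y => h.avg_dual_ne_top hp a x a y),
    ENNReal.ofReal_rpow_of_nonneg (ravg_nonneg fun x y => weightCell_nonneg _ _ _ _) hp1.le,
    ← ENNReal.ofReal_mul (ravg_nonneg fun x y => weightCell_nonneg _ _ _ _),
    ENNReal.ofReal_le_iff_le_toReal h.apChar_lt_top.ne] at h1
  refine le_trans (mul_le_mul_of_nonneg_left (Real.rpow_le_rpow
    (ravg_nonneg fun x y => Real.rpow_nonneg (weightCell_nonneg _ _ _ _) _)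
    (ravg_mono fun x y _ _ => h.weightCell_rpow_le hp a x y) hp1.le)
    (ravg_nonneg fun x y => weightCell_nonneg _ _ _ _)) h1

/-- Replacing a function by its averages over the cells does not increase its weighted norm by
more than a constant. -/
theorem enorm_cellAvg_rpow_mul_le (hp : 1 < p) (h : IsDyadicApWeight p w) {f : ℝ × ℝ → ℂ}
    (hf : LocallyIntegrable f) (a x y : ℤ) :
    ‖cellAvg f a x y‖ₑ ^ p * ∫⁻ z in (rect a x a y).toSet, ENNReal.ofReal (w z) ≤
      apChar p w * ∫⁻ z in (rect a x a y).toSet, ‖f z‖ₑ ^ p * ENNReal.ofReal (w z) := by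
  have hp0 : 0 < p := by linarith
  have hp1 : 0 < p - 1 := by linarith
  have hH := setLIntegral_le_Lp_mul_Lq hp h.aemeasurable h.ae_pos
    hf.aestronglyMeasurable.enorm (rect a x a y).toSet
  set X := ∫⁻ z in (rect a x a y).toSet, ‖f z‖ₑ ^ p * ENNReal.ofReal (w z)
  rw [lintegral_eq_avg] at hH ⊢
  set A := ENNReal.ofReal (area a a) with hAdef
  have hA0 : A ≠ 0 := ofReal_area_ne_zero _ _
  have hAt : A ≠ ∞ := ENNReal.ofReal_ne_top
  set s := (rect a x a y).avg (fun x => w x ^ (-1 / (p - 1)))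
  have h1 : ‖cellAvg f a x y‖ₑ ≤ A⁻¹ * (X ^ (1 / p) * (A * s) ^ (1 - 1 / p)) := by
    rw [cellAvg, enorm_smul, Real.enorm_of_nonneg (inv_nonneg.2 (area_pos a a).le),
      ENNReal.ofReal_inv_of_pos (area_pos a a)]
    gcongr
    exact (enorm_integral_le_lintegral_enorm _).trans hH
  have h2 : ‖cellAvg f a x y‖ₑ ^ p ≤ A⁻¹ * (X * s ^ (p - 1)) := by
    refine (ENNReal.rpow_le_rpow h1 hp0.le).trans_eq ?_
    rw [ENNReal.mul_rpow_of_nonneg _ _ hp0.le, ENNReal.mul_rpow_of_nonneg _ _ hp0.le,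
      ← ENNReal.rpow_mul, ← ENNReal.rpow_mul, one_div_mul_cancel hp0.ne', ENNReal.rpow_one]
    have e : (1 - 1 / p) * p = p - 1 := by field_simp
    rw [e, ENNReal.mul_rpow_of_nonneg _ _ hp1.le, ENNReal.inv_rpow]
    have e2 : A ^ p = A * A ^ (p - 1) := by
      conv_rhs => rw [← ENNReal.rpow_one A, ENNReal.rpow_one A]
      rw [show p = 1 + (p - 1) by ring, ENNReal.rpow_add _ _ hA0 hAt, ENNReal.rpow_one]
      ring_nf
    have hB0 : A ^ (p - 1) ≠ 0 := by simp [hA0, hAt]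
    have hBt : A ^ (p - 1) ≠ ∞ := ENNReal.rpow_ne_top_of_nonneg hp1.le hAt
    rw [e2, ENNReal.mul_inv (Or.inl hA0) (Or.inl hAt)]
    calc A⁻¹ * (A ^ (p - 1))⁻¹ * (X * (A ^ (p - 1) * s ^ (p - 1)))
        = A⁻¹ * (X * s ^ (p - 1)) * ((A ^ (p - 1))⁻¹ * A ^ (p - 1)) := by ring
      _ = _ := by rw [ENNReal.inv_mul_cancel hB0 hBt, mul_one]
  calc ‖cellAvg f a x y‖ₑ ^ p * (A * (rect a x a y).avg w)
      ≤ A⁻¹ * (X * s ^ (p - 1)) * (A * (rect a x a y).avg w) := by gcongr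
    _ = ((rect a x a y).avg w * s ^ (p - 1)) * X * (A⁻¹ * A) := by ring
    _ = ((rect a x a y).avg w * s ^ (p - 1)) * X := by
        rw [ENNReal.inv_mul_cancel hA0 hAt, mul_one]
    _ ≤ _ := by gcongr; exact h.avg_mul_le _

end IsDyadicApWeight


/-! ### Truncated square functions and the first two estimates on the plane. -/

open Filter Topology

/-- The sum of `ψ R` over the dyadic rectangles `R` that contain `z`, with sides longer than `2 ^ a`
and not longer than `2 ^ (a + n)`. -/
noncomputable def truncSum (ψ : DyadicRect → ℝ≥0∞) (a : ℤ) (n : ℕ) (z : ℝ × ℝ) : ℝ≥0∞ :=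
  ∑ k ∈ Finset.Icc 1 n ×ˢ Finset.Icc 1 n,
    ψ (rect (a + k.1) (pos (a + k.1) z.1) (a + k.2) (pos (a + k.2) z.2))

/-- Dyadic rectangles are given by two scales and two positions. -/
def rectEquiv : (ℤ × ℤ) × ℤ × ℤ ≃ DyadicRect where
  toFun q := rect q.1.1 q.2.1 q.1.2 q.2.2
  invFun R := ((R.I.k, R.J.k), R.I.m, R.J.m)
  left_inv _ := rfl
  right_inv _ := rfl

instance : Countable DyadicRect := rectEquiv.symm.injective.countable

/-- For each pair of scales exactly one rectangle contains `z`. -/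
theorem tsum_indicator_eq (ψ : DyadicRect → ℝ≥0∞) (z : ℝ × ℝ) :
    ∑' R : DyadicRect, ψ R * R.toSet.indicator (fun _ => (volume R.toSet)⁻¹) z =
      ∑' k : ℤ × ℤ, ψ (rect k.1 (pos k.1 z.1) k.2 (pos k.2 z.2)) *
        (volume (rect k.1 (pos k.1 z.1) k.2 (pos k.2 z.2)).toSet)⁻¹ := by
  rw [← rectEquiv.tsum_eq, ENNReal.tsum_prod']
  refine tsum_congr fun k => ?_
  rw [tsum_eq_single (pos k.1 z.1, pos k.2 z.2)]
  · change ψ (rect _ _ _ _) * (rect _ _ _ _).toSet.indicator _ z = _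
    rw [indicator_of_mem (mem_rect.2 ⟨rfl, rfl⟩)]
    rfl
  · intro m hm
    change ψ (rect _ _ _ _) * (rect _ _ _ _).toSet.indicator _ z = _
    rw [indicator_of_notMem, mul_zero]
    rw [mem_rect]
    rintro ⟨h1, h2⟩
    exact hm (Prod.ext h1.symm h2.symm)

theorem truncSum_eq_sum (ψ : DyadicRect → ℝ≥0∞) (a : ℤ) (n : ℕ) (z : ℝ × ℝ) :
    truncSum ψ a n z = ∑ k ∈ Finset.Ioc a (a + n) ×ˢ Finset.Ioc a (a + n),
      ψ (rect k.1 (pos k.1 z.1) k.2 (pos k.2 z.2)) := by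
  refine Finset.sum_bij (fun k _ => (a + k.1, a + k.2)) (fun k hk => ?_) (fun k _ l _ h => ?_)
    (fun k hk => ?_) (fun k _ => rfl)
  · simp only [Finset.mem_product, Finset.mem_Icc, Finset.mem_Ioc] at hk ⊢
    omega
  · simp only [Prod.mk.injEq] at h
    exact Prod.ext (by omega) (by omega)
  · simp only [Finset.mem_product, Finset.mem_Ioc] at hk
    refine ⟨((k.1 - a).toNat, (k.2 - a).toNat), ?_, Prod.ext ?_ ?_⟩
    · simp only [Finset.mem_product, Finset.mem_Icc]
      omega
    all_goals simp only; omega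

theorem truncSum_le (ψ : DyadicRect → ℝ≥0∞) (a : ℤ) (n : ℕ) (z : ℝ × ℝ) :
    truncSum ψ a n z ≤ ∑' k : ℤ × ℤ, ψ (rect k.1 (pos k.1 z.1) k.2 (pos k.2 z.2)) := by
  rw [truncSum_eq_sum]
  exact ENNReal.sum_le_tsum _

theorem tendsto_truncSum (ψ : DyadicRect → ℝ≥0∞) (z : ℝ × ℝ) :
    Tendsto (fun N : ℕ => truncSum ψ (-N) (2 * N) z) atTop
      (𝓝 (∑' k : ℤ × ℤ, ψ (rect k.1 (pos k.1 z.1) k.2 (pos k.2 z.2)))) := by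
  have h := (ENNReal.summable (f := fun k : ℤ × ℤ =>
    ψ (rect k.1 (pos k.1 z.1) k.2 (pos k.2 z.2)))).hasSum
  have ht : Tendsto (fun N : ℕ => Finset.Ioc (-N : ℤ) N ×ˢ Finset.Ioc (-N : ℤ) N) atTop atTop := by
    refine tendsto_atTop_finset_of_monotone (fun M N hMN => ?_) fun k => ?_
    · have : (M : ℤ) ≤ N := by exact_mod_cast hMN
      exact Finset.product_subset_product (Finset.Ioc_subset_Ioc (by omega) this)
        (Finset.Ioc_subset_Ioc (by omega) this)
    · refine ⟨k.1.natAbs + k.2.natAbs + 1, ?_⟩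
      simp only [Finset.mem_product, Finset.mem_Ioc]
      omega
  refine (h.comp ht).congr fun N => ?_
  rw [truncSum_eq_sum]
  have : (-(N : ℤ) + ((2 * N : ℕ) : ℤ)) = N := by push_cast; ring
  rw [this]
  rfl

theorem measurable_comp_pos {α : Type*} [MeasurableSpace α] (k l : ℤ) (φ : ℤ → ℤ → α) :
    Measurable fun z : ℝ × ℝ => φ (pos k z.1) (pos l z.2) :=
  (Measurable.of_discrete (f := fun q : ℤ × ℤ => φ q.1 q.2)).comp
    (((measurable_pos k).comp measurable_fst).prodMk ((measurable_pos l).comp measurable_snd))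

theorem measurable_truncSum (ψ : DyadicRect → ℝ≥0∞) (a : ℤ) (n : ℕ) :
    Measurable (truncSum ψ a n) :=
  Finset.measurable_fun_sum _ fun k _ =>
    measurable_comp_pos (a + k.1) (a + k.2) fun m m' => ψ (rect (a + k.1) m (a + k.2) m')

/-- The terms of the square of the square function. -/
noncomputable def sqTerm (f : ℝ × ℝ → ℂ) (R : DyadicRect) : ℝ≥0∞ :=
  ‖haarCoeff f R‖ₑ ^ 2 * (volume R.toSet)⁻¹

/-- The terms of the square of the Triebel–Lizorkin square function. -/
noncomputable def tlTerm (p : ℝ) (w : ℝ × ℝ → ℝ) (f : ℝ × ℝ → ℂ) (R : DyadicRect) : ℝ≥0∞ :=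
  ‖haarCoeff f R‖ₑ ^ 2 * R.avg w ^ (2 / p) * (volume R.toSet)⁻¹

theorem squareFn_rpow (f : ℝ × ℝ → ℂ) (p : ℝ) (z : ℝ × ℝ) :
    squareFn f z ^ p =
      (∑' k : ℤ × ℤ, sqTerm f (rect k.1 (pos k.1 z.1) k.2 (pos k.2 z.2))) ^ (p / 2) := by
  rw [squareFn, tsum_indicator_eq (fun R => ‖haarCoeff f R‖ₑ ^ 2), ← ENNReal.rpow_mul]
  simp only [sqTerm]
  ring_nf

theorem tlSquareFn_rpow (w : ℝ × ℝ → ℝ) (f : ℝ × ℝ → ℂ) (p : ℝ) (z : ℝ × ℝ) :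
    tlSquareFn p w f z ^ p =
      (∑' k : ℤ × ℤ, tlTerm p w f (rect k.1 (pos k.1 z.1) k.2 (pos k.2 z.2))) ^ (p / 2) := by
  rw [tlSquareFn, tsum_indicator_eq (fun R => ‖haarCoeff f R‖ₑ ^ 2 * R.avg w ^ (2 / p)),
    ← ENNReal.rpow_mul]
  simp only [tlTerm]
  ring_nf

theorem truncSum_sqTerm {f : ℝ × ℝ → ℂ} (hf : LocallyIntegrable f) (a : ℤ) (n : ℕ) (z : ℝ × ℝ) :
    truncSum (sqTerm f) a n z = ENNReal.ofReal
      (gridSum n (fun i m j m' => ‖rdiff i m j m' (cellAvg f a)‖ ^ 2) (pos a z.1) (pos a z.2)) := by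
  unfold truncSum gridSum
  rw [ENNReal.ofReal_sum_of_nonneg fun k _ => sq_nonneg _]
  refine Finset.sum_congr rfl fun k hk => ?_
  rw [Finset.mem_product, Finset.mem_Icc, Finset.mem_Icc] at hk
  rw [sqTerm, enorm_haarCoeff_sq hf a hk.1.1 hk.2.1, pos_add, pos_add]

theorem truncSum_tlTerm {p : ℝ} {w : ℝ × ℝ → ℝ} (hp : 1 < p) (hw : IsDyadicApWeight p w)
    {f : ℝ × ℝ → ℂ} (hf : LocallyIntegrable f) (a : ℤ) (n : ℕ) (z : ℝ × ℝ) :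
    truncSum (tlTerm p w f) a n z = ENNReal.ofReal
      (gridSum n (fun i m j m' => ‖rdiff i m j m' (cellAvg f a)‖ ^ 2 *
        ravg i m j m' (weightCell w a) ^ (2 / p)) (pos a z.1) (pos a z.2)) := by
  have hr : ∀ i m j m', 0 ≤ ravg i m j m' (weightCell w a) := fun i m j m' =>
    ravg_nonneg fun x y => weightCell_nonneg _ _ _ _
  unfold truncSum gridSum
  rw [ENNReal.ofReal_sum_of_nonneg fun k _ =>
    mul_nonneg (sq_nonneg _) (Real.rpow_nonneg (hr _ _ _ _) _)]
  refine Finset.sum_congr rfl fun k hk => ?_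
  rw [Finset.mem_product, Finset.mem_Icc, Finset.mem_Icc] at hk
  rw [tlTerm, mul_right_comm, enorm_haarCoeff_sq hf a hk.1.1 hk.2.1, pos_add, pos_add,
    avg_rect_eq (fun x y => hw.avg_ne_top a x a y),
    ENNReal.ofReal_rpow_of_nonneg (hr _ _ _ _) (by positivity),
    ← ENNReal.ofReal_mul (sq_nonneg _)]

/-- The `p`-th power of the norm of the truncated Triebel–Lizorkin square function on a large
square. -/
theorem lintegral_truncSum_tlTerm {p : ℝ} {w : ℝ × ℝ → ℝ} (hp : 1 < p)
    (hw : IsDyadicApWeight p w) {f : ℝ × ℝ → ℂ} (hf : LocallyIntegrable f) (a : ℤ) (n : ℕ)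
    (m m' : ℤ) :
    ∫⁻ z in (rect (a + n) m (a + n) m').toSet, truncSum (tlTerm p w f) a n z ^ (p / 2) =
      ENNReal.ofReal (area (a + n) (a + n) * ravg n m n m' fun x y =>
        gridSum n (fun i m j m' => ‖rdiff i m j m' (cellAvg f a)‖ ^ 2 *
          ravg i m j m' (weightCell w a) ^ (2 / p)) x y ^ (p / 2)) := by
  have hg : ∀ x y, 0 ≤ gridSum n (fun i m j m' => ‖rdiff i m j m' (cellAvg f a)‖ ^ 2 *
      ravg i m j m' (weightCell w a) ^ (2 / p)) x y := gridSum_nonneg fun i m j m' =>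
    mul_nonneg (sq_nonneg _) (Real.rpow_nonneg (ravg_nonneg fun x y => weightCell_nonneg _ _ _ _) _)
  rw [← lintegral_rect_const_eq fun x y => Real.rpow_nonneg (hg x y) _]
  refine lintegral_congr fun z => ?_
  rw [truncSum_tlTerm hp hw hf, ENNReal.ofReal_rpow_of_nonneg (hg _ _) (by positivity)]

/-- A bound for the integral over the plane that holds for all truncations holds in the limit. -/
theorem lintegral_tlSquareFn_rpow_le {p : ℝ} {w : ℝ × ℝ → ℝ} {f : ℝ × ℝ → ℂ}
    {B : ℝ≥0∞} (h : ∀ a n, ∫⁻ z, truncSum (tlTerm p w f) a n z ^ (p / 2) ≤ B) :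
    ∫⁻ z, tlSquareFn p w f z ^ p ≤ B := by
  have ht : ∀ z, Tendsto (fun N : ℕ => truncSum (tlTerm p w f) (-N) (2 * N) z ^ (p / 2)) atTop
      (𝓝 (tlSquareFn p w f z ^ p)) := by
    intro z
    rw [tlSquareFn_rpow]
    exact (ENNReal.continuous_rpow_const.tendsto _).comp (tendsto_truncSum _ z)
  calc ∫⁻ z, tlSquareFn p w f z ^ p
      = ∫⁻ z, liminf (fun N : ℕ => truncSum (tlTerm p w f) (-N) (2 * N) z ^ (p / 2)) atTop :=
        lintegral_congr fun z => (ht z).liminf_eq.symm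
    _ ≤ liminf (fun N : ℕ => ∫⁻ z, truncSum (tlTerm p w f) (-N) (2 * N) z ^ (p / 2)) atTop :=
        lintegral_liminf_le fun N => (measurable_truncSum _ _ _).pow_const _
    _ ≤ B := liminf_le_of_le (by isBoundedDefault) fun b hb => by
        obtain ⟨N, hN⟩ := hb.exists
        exact hN.trans (h _ _)

/-- Truncated sums are constant on cells and equal to grid sums, so `w` may be replaced by its cell
averages without error. The grid bound holds on each square of side `2 ^ (a + n)`; these tile the
plane, and its constant is independent of `a` and `n`. -/
theorem lintegral_tlSquareFn_le_squareFn {p : ℝ} {w : ℝ × ℝ → ℝ} (hp : 1 < p)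
    (hw : IsDyadicApWeight p w) {f : ℝ × ℝ → ℂ} (hf : LocallyIntegrable f) :
    ∫⁻ z, tlSquareFn p w f z ^ p ≤ ENNReal.ofReal (tlConst p (apChar p w).toReal) *
      ∫⁻ z, squareFn f z ^ p * ENNReal.ofReal (w z) := by
  refine lintegral_tlSquareFn_rpow_le fun a n => ?_
  have hC : 0 ≤ tlConst p (apChar p w).toReal := tlConst_nonneg ENNReal.toReal_nonneg
  refine le_trans ?_ (mul_le_mul_right (lintegral_mono (f := fun z =>
    truncSum (sqTerm f) a n z ^ (p / 2) * ENNReal.ofReal (w z)) fun z => ?_) _)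
  · rw [lintegral_eq_tsum_rect (a + n), lintegral_eq_tsum_rect (a + n), ← ENNReal.tsum_mul_left]
    refine ENNReal.tsum_le_tsum fun m => ?_
    have hg : ∀ x y, 0 ≤ gridSum n (fun i m j m' => ‖rdiff i m j m' (cellAvg f a)‖ ^ 2) x y :=
      gridSum_nonneg fun i m j m' => sq_nonneg _
    have e : ∫⁻ z in (rect (a + n) m.1 (a + n) m.2).toSet,
        truncSum (sqTerm f) a n z ^ (p / 2) * ENNReal.ofReal (w z) =
        ENNReal.ofReal (area (a + n) (a + n) * ravg n m.1 n m.2 fun x y =>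
          gridSum n (fun i m j m' => ‖rdiff i m j m' (cellAvg f a)‖ ^ 2) x y ^ (p / 2) *
            weightCell w a x y) := by
      rw [← lintegral_rect_mul_eq (fun x y => hw.avg_ne_top a x a y)
        fun x y => Real.rpow_nonneg (hg x y) _]
      refine lintegral_congr fun z => ?_
      rw [truncSum_sqTerm hf, ENNReal.ofReal_rpow_of_nonneg (hg _ _) (by positivity)]
    rw [e, lintegral_truncSum_tlTerm hp hw hf, ← ENNReal.ofReal_mul hC]
    refine ENNReal.ofReal_le_ofReal ?_
    have := mul_le_mul_of_nonneg_left (ravg_tl_le hp (hw.weightCell_pos a) (hw.isGridAp hp n a)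
      (c := fun i m j m' => ‖rdiff i m j m' (cellAvg f a)‖ ^ 2) (fun _ _ _ _ => sq_nonneg _)
      m.1 m.2) (area_pos (a + n) (a + n)).le
    linarith
  · dsimp only
    rw [squareFn_rpow]
    gcongr
    exact truncSum_le _ _ _ _

/-- The function that is constant on cells, with the averages of `f` as values. -/
noncomputable def cellFn (f : ℝ × ℝ → ℂ) (a : ℤ) (z : ℝ × ℝ) : ℂ :=
  cellAvg f a (pos a z.1) (pos a z.2)

theorem lintegral_cellFn_rpow_rect {p : ℝ} {w : ℝ × ℝ → ℝ} (hw : IsDyadicApWeight p w)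
    (f : ℝ × ℝ → ℂ) {q : ℝ} (hq : 0 ≤ q) (a : ℤ) (n : ℕ) (m m' : ℤ) :
    ∫⁻ z in (rect (a + n) m (a + n) m').toSet, ‖cellFn f a z‖ₑ ^ q * ENNReal.ofReal (w z) =
      ENNReal.ofReal (area (a + n) (a + n) * ravg n m n m' fun x y =>
        ‖cellAvg f a x y‖ ^ q * weightCell w a x y) := by
  rw [← lintegral_rect_mul_eq (fun x y => hw.avg_ne_top a x a y)
    fun x y => Real.rpow_nonneg (norm_nonneg _) _]
  refine lintegral_congr fun z => ?_
  rw [cellFn, ← ofReal_norm, ENNReal.ofReal_rpow_of_nonneg (norm_nonneg _) hq]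

theorem lintegral_cellFn_rpow_le {p : ℝ} {w : ℝ × ℝ → ℝ} (hp : 1 < p)
    (hw : IsDyadicApWeight p w) {f : ℝ × ℝ → ℂ} (hf : LocallyIntegrable f) (a : ℤ) :
    ∫⁻ z, ‖cellFn f a z‖ₑ ^ p * ENNReal.ofReal (w z) ≤
      apChar p w * ∫⁻ z, ‖f z‖ₑ ^ p * ENNReal.ofReal (w z) := by
  rw [lintegral_eq_tsum_rect a, lintegral_eq_tsum_rect a, ← ENNReal.tsum_mul_left]
  refine ENNReal.tsum_le_tsum fun m => le_trans (le_of_eq ?_)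
    (hw.enorm_cellAvg_rpow_mul_le hp hf a m.1 m.2)
  rw [← lintegral_const_mul' _ _ (ENNReal.rpow_ne_top_of_nonneg (by linarith) enorm_ne_top)]
  refine setLIntegral_congr_fun (DyadicRect.measurableSet_toSet _) fun z hz => ?_
  rw [mem_rect] at hz
  simp only [cellFn, hz.1, hz.2]

/-- As before, with one more loss: the grid bound controls the norm of the cell averages of `f`, and
averaging over cells is bounded on `L ^ p (w)` by `A_p`. -/
theorem lintegral_tlSquareFn_le {p : ℝ} {w : ℝ × ℝ → ℝ} (hp : 1 < p)
    (hw : IsDyadicApWeight p w) {f : ℝ × ℝ → ℂ} (hf : LocallyIntegrable f) :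
    ∫⁻ z, tlSquareFn p w f z ^ p ≤ ENNReal.ofReal (tlConst p (apChar p w).toReal *
      squareConst p (apChar p w).toReal) * apChar p w *
      ∫⁻ z, ‖f z‖ₑ ^ p * ENNReal.ofReal (w z) := by
  refine lintegral_tlSquareFn_rpow_le fun a n => ?_
  have hC : 0 ≤ tlConst p (apChar p w).toReal * squareConst p (apChar p w).toReal :=
    mul_nonneg (tlConst_nonneg ENNReal.toReal_nonneg) (squareConst_nonneg _ _)
  rw [mul_assoc]
  refine le_trans ?_ (mul_le_mul_right (lintegral_cellFn_rpow_le hp hw hf a) _)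
  rw [lintegral_eq_tsum_rect (a + n),
    lintegral_eq_tsum_rect (a + n) fun z => ‖cellFn f a z‖ₑ ^ p * ENNReal.ofReal (w z),
    ← ENNReal.tsum_mul_left]
  refine ENNReal.tsum_le_tsum fun m => ?_
  rw [lintegral_cellFn_rpow_rect hw f (by linarith), lintegral_truncSum_tlTerm hp hw hf,
    ← ENNReal.ofReal_mul hC]
  refine ENNReal.ofReal_le_ofReal ?_
  have := mul_le_mul_of_nonneg_left (ravg_tl_le_norm hp (hw.weightCell_pos a) (hw.isGridAp hp n a)
    (cellAvg f a) m.1 m.2) (area_pos (a + n) (a + n)).le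
  linarith


/-! ### The third estimate on the plane. -/

theorem tsum_rpow_mul_rpow_le {ι : Type*} {p : ℝ} (hp : 1 < p) (f g : ι → ℝ≥0∞) :
    ∑' i, f i ^ (1 / p) * g i ^ (1 - 1 / p) ≤ (∑' i, f i) ^ (1 / p) * (∑' i, g i) ^ (1 - 1 / p) := by
  have hp0 : 0 < p := by linarith
  have hp1 : 0 < p - 1 := by linarith
  have hθ : 0 < 1 - 1 / p := by rw [sub_pos, div_lt_one hp0]; exact hp
  rw [ENNReal.tsum_eq_iSup_sum]
  refine iSup_le fun s => ?_
  have h := ENNReal.inner_le_Lp_mul_Lq s (fun i => f i ^ (1 / p)) (fun i => g i ^ (1 - 1 / p))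
    (Real.HolderConjugate.conjExponent hp)
  have e : 1 / Real.conjExponent p = 1 - 1 / p := by
    rw [Real.conjExponent]; field_simp
  have e1 : 1 / p * p = 1 := one_div_mul_cancel hp0.ne'
  have e2 : (1 - 1 / p) * Real.conjExponent p = 1 := by
    rw [Real.conjExponent]; field_simp
  simp only [← ENNReal.rpow_mul, e, e1, e2, ENNReal.rpow_one] at h
  refine h.trans (mul_le_mul' (ENNReal.rpow_le_rpow (ENNReal.sum_le_tsum s) (by positivity))
    (ENNReal.rpow_le_rpow (ENNReal.sum_le_tsum s) hθ.le))

/-- Divide by a power of `X`; this is where finiteness is indispensable. -/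
theorem ennreal_le_rpow_mul_of_le {p : ℝ} (hp : 1 < p) {c X Y : ℝ≥0∞} (hX : X ≠ ∞)
    (h : X ≤ c * (Y ^ (1 / p) * X ^ (1 - 1 / p))) : X ≤ c ^ p * Y := by
  have hp0 : 0 < p := by linarith
  have hθ : 0 < 1 - 1 / p := by rw [sub_pos, div_lt_one hp0]; exact hp
  rcases eq_or_ne X 0 with rfl | hX0
  · exact zero_le
  have hZ0 : X ^ (1 - 1 / p) ≠ 0 := by simp [hX0, hX]
  have hZt : X ^ (1 - 1 / p) ≠ ∞ := ENNReal.rpow_ne_top_of_nonneg hθ.le hX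
  have h1 : X ^ (1 / p) ≤ c * Y ^ (1 / p) := by
    rw [← ENNReal.mul_le_mul_iff_left hZ0 hZt, ← ENNReal.rpow_add _ _ hX0 hX, add_sub_cancel,
      ENNReal.rpow_one, mul_assoc]
    exact h
  have h2 := ENNReal.rpow_le_rpow h1 hp0.le
  rwa [ENNReal.mul_rpow_of_nonneg _ _ hp0.le, ← ENNReal.rpow_mul, ← ENNReal.rpow_mul,
    one_div_mul_cancel hp0.ne', ENNReal.rpow_one, ENNReal.rpow_one] at h2

section cellFn

variable {f : ℝ × ℝ → ℂ}

theorem locallyIntegrable_of_memLp_top (hf : MemLp f ∞ volume) : LocallyIntegrable f :=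
  hf.locallyIntegrable le_top

theorem measurable_cellFn (f : ℝ × ℝ → ℂ) (a : ℤ) : Measurable (cellFn f a) :=
  measurable_comp_pos a a (cellAvg f a)

theorem enorm_cellFn_le (f : ℝ × ℝ → ℂ) (a : ℤ) (z : ℝ × ℝ) :
    ‖cellFn f a z‖ₑ ≤ eLpNorm f ∞ volume := by
  have hb : ∀ᵐ z', ‖f z'‖ₑ ≤ eLpNorm f ∞ volume := by
    rw [eLpNorm_exponent_top]
    exact ae_le_eLpNormEssSup
  rw [cellFn, cellAvg, enorm_smul, Real.enorm_of_nonneg (inv_nonneg.2 (area_pos a a).le),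
    ENNReal.ofReal_inv_of_pos (area_pos a a)]
  refine (mul_le_mul_right ((enorm_integral_le_lintegral_enorm _).trans
    (lintegral_mono_ae (ae_restrict_of_ae hb))) _).trans ?_
  rw [lintegral_const, Measure.restrict_apply_univ, volume_rect, mul_comm (eLpNorm f ∞ volume),
    ← mul_assoc, ENNReal.inv_mul_cancel (ofReal_area_ne_zero _ _) ENNReal.ofReal_ne_top, one_mul]

theorem exists_cellFn_eq_zero (hc : HasCompactSupport f) (a : ℤ) :
    ∃ r : ℝ, ∀ z, z ∉ Metric.closedBall (0 : ℝ × ℝ) r → cellFn f a z = 0 := by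
  obtain ⟨r, hr⟩ := hc.isCompact.isBounded.subset_closedBall (0 : ℝ × ℝ)
  refine ⟨r + 2 ^ a, fun z hz => ?_⟩
  rw [cellFn, cellAvg]
  have h0 : ∫ z' in (rect a (pos a z.1) a (pos a z.2)).toSet, f z' = 0 := by
    refine setIntegral_eq_zero_of_forall_eq_zero fun z' hz' => ?_
    by_contra hne
    refine hz ?_
    have h1 : z' ∈ Metric.closedBall (0 : ℝ × ℝ) r := hr (subset_tsupport f hne)
    rw [mem_rect] at hz'
    have h2 : (0 : ℝ) < 2 ^ a := zpow_pos two_pos _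
    have hd : ∀ s t : ℝ, pos a s = pos a t → dist s t ≤ 2 ^ a := by
      intro s t hst
      have := Int.abs_sub_lt_one_of_floor_eq_floor hst
      rw [← sub_div, abs_div, abs_of_pos h2, div_lt_one h2] at this
      exact this.le
    have h3 : dist z z' ≤ 2 ^ a := by
      rw [Prod.dist_eq]
      exact max_le (hd _ _ hz'.1.symm) (hd _ _ hz'.2.symm)
    rw [Metric.mem_closedBall] at h1 ⊢
    linarith [dist_triangle z z' 0]
  rw [h0, smul_zero]

/-- Makes the absorption legitimate and the error term finite; here boundedness and compact support
of `f` enter. -/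
theorem lintegral_cellFn_ne_top (hf : MemLp f ∞ volume) (hc : HasCompactSupport f) {v : ℝ × ℝ → ℝ}
    (hv : LocallyIntegrable v) {q : ℝ} (hq : 0 < q) (a : ℤ) :
    ∫⁻ z, ‖cellFn f a z‖ₑ ^ q * ENNReal.ofReal (v z) ≠ ∞ := by
  obtain ⟨r, hr⟩ := exists_cellFn_eq_zero hc a
  have h1 : ∀ z, ‖cellFn f a z‖ₑ ^ q * ENNReal.ofReal (v z) ≤
      (Metric.closedBall (0 : ℝ × ℝ) r).indicator
        (fun z => eLpNorm f ∞ volume ^ q * ENNReal.ofReal (v z)) z := by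
    intro z
    by_cases hz : z ∈ Metric.closedBall (0 : ℝ × ℝ) r
    · rw [indicator_of_mem hz]
      gcongr
      exact enorm_cellFn_le f a z
    · rw [indicator_of_notMem hz, hr z hz, enorm_zero, ENNReal.zero_rpow_of_pos hq, zero_mul]
  have hM : eLpNorm f ∞ volume ^ q ≠ ∞ := ENNReal.rpow_ne_top_of_nonneg hq.le hf.2.ne
  refine ((lintegral_mono h1).trans_lt ?_).ne
  rw [lintegral_indicator Metric.isClosed_closedBall.measurableSet, lintegral_const_mul' _ _ hM]
  exact ENNReal.mul_lt_top hM.lt_top (Integrable.lintegral_lt_top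
    (hv.integrableOn_isCompact (isCompact_closedBall 0 r)))

theorem lintegral_cellFn_rect (f : ℝ × ℝ → ℂ) (a : ℤ) (n : ℕ) (m m' : ℤ) :
    ∫⁻ z in (rect (a + n) m (a + n) m').toSet, ‖cellFn f a z‖ₑ =
      ENNReal.ofReal (area (a + n) (a + n) * ravg n m n m' fun x y => ‖cellAvg f a x y‖) := by
  rw [← lintegral_rect_const_eq fun x y => norm_nonneg _]
  refine lintegral_congr fun z => ?_
  rw [cellFn, ← ofReal_norm]

variable {p : ℝ} {w : ℝ × ℝ → ℝ}

/-- The grid estimate times the area of the square. The error contains two averages, so turning both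
into integrals divides `2 ^ n` by `4 ^ n * area a a`: the factor `(1 / 2) ^ n` appears. -/
theorem lintegral_cellFn_rect_le (hp : 1 < p) (hw : IsDyadicApWeight p w)
    (hf : LocallyIntegrable f) (a : ℤ) (n : ℕ) (m m' : ℤ) :
    ∫⁻ z in (rect (a + n) m (a + n) m').toSet, ‖cellFn f a z‖ₑ ^ p * ENNReal.ofReal (w z) ≤
      ENNReal.ofReal (dualConst p (apChar p w).toReal) *
        ((∫⁻ z in (rect (a + n) m (a + n) m').toSet, truncSum (tlTerm p w f) a n z ^ (p / 2)) ^
            (1 / p) *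
          (∫⁻ z in (rect (a + n) m (a + n) m').toSet,
            ‖cellFn f a z‖ₑ ^ p * ENNReal.ofReal (w z)) ^ (1 - 1 / p)) +
      ENNReal.ofReal (3 / area a a * (1 / 2) ^ n) *
        ((∫⁻ z in (rect (a + n) m (a + n) m').toSet, ‖cellFn f a z‖ₑ) *
          ∫⁻ z in (rect (a + n) m (a + n) m').toSet,
            ‖cellFn f a z‖ₑ ^ (p - 1) * ENNReal.ofReal (w z)) := by
  have hp0 : 0 < p := by linarith
  have hp1 : 0 < p - 1 := by linarith
  have hθ : 0 < 1 - 1 / p := by rw [sub_pos, div_lt_one hp0]; exact hp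
  have key := ravg_norm_rpow_le_tl hp (hw.weightCell_pos a) (hw.isGridAp hp n a) (cellAvg f a) m m'
  rw [lintegral_cellFn_rpow_rect hw f hp0.le, lintegral_cellFn_rpow_rect hw f hp1.le,
    lintegral_truncSum_tlTerm hp hw hf, lintegral_cellFn_rect]
  have hA := area_pos (a + n) (a + n)
  have hA' := area_pos a a
  have hX0 : 0 ≤ ravg n m n m' (fun x y => ‖cellAvg f a x y‖ ^ p * weightCell w a x y) :=
    ravg_nonneg fun x y => mul_nonneg (Real.rpow_nonneg (norm_nonneg _) _) (weightCell_nonneg _ _ _ _)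
  have hB0 : 0 ≤ ravg n m n m' (fun x y => ‖cellAvg f a x y‖ ^ (p - 1) * weightCell w a x y) :=
    ravg_nonneg fun x y => mul_nonneg (Real.rpow_nonneg (norm_nonneg _) _) (weightCell_nonneg _ _ _ _)
  have hα0 : 0 ≤ ravg n m n m' (fun x y => ‖cellAvg f a x y‖) := ravg_nonneg fun _ _ => norm_nonneg _
  have hS0 : 0 ≤ ravg n m n m' (fun x y =>
      gridSum n (fun i m j m' => ‖rdiff i m j m' (cellAvg f a)‖ ^ 2 *
        ravg i m j m' (weightCell w a) ^ (2 / p)) x y ^ (p / 2)) :=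
    ravg_nonneg fun x y => Real.rpow_nonneg (gridSum_nonneg (fun i m j m' =>
      mul_nonneg (sq_nonneg _) (Real.rpow_nonneg
        (ravg_nonneg fun x y => weightCell_nonneg _ _ _ _) _)) x y) _
  have hD : 0 ≤ dualConst p (apChar p w).toReal :=
    Real.rpow_nonneg (mul_nonneg (tlConst_nonneg (Real.rpow_nonneg ENNReal.toReal_nonneg _))
      (squareConst_nonneg _ _)) _
  set X := ravg n m n m' (fun x y => ‖cellAvg f a x y‖ ^ p * weightCell w a x y)
  set β := ravg n m n m' (fun x y => ‖cellAvg f a x y‖ ^ (p - 1) * weightCell w a x y)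
  set α := ravg n m n m' (fun x y => ‖cellAvg f a x y‖)
  set s := ravg n m n m' (fun x y =>
      gridSum n (fun i m j m' => ‖rdiff i m j m' (cellAvg f a)‖ ^ 2 *
        ravg i m j m' (weightCell w a) ^ (2 / p)) x y ^ (p / 2))
  rw [ENNReal.ofReal_rpow_of_nonneg (mul_nonneg hA.le hS0) (by positivity),
    ENNReal.ofReal_rpow_of_nonneg (mul_nonneg hA.le hX0) hθ.le,
    ← ENNReal.ofReal_mul (by positivity), ← ENNReal.ofReal_mul (mul_nonneg hA.le hα0),
    ← ENNReal.ofReal_mul hD, ← ENNReal.ofReal_mul (by positivity),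
    ← ENNReal.ofReal_add (by positivity) (by positivity)]
  refine ENNReal.ofReal_le_ofReal ?_
  refine (mul_le_mul_of_nonneg_left key hA.le).trans_eq ?_
  rw [Real.mul_rpow hA.le hS0, Real.mul_rpow hA.le hX0]
  have e1 : area (a + n) (a + n) ^ (1 / p) * area (a + n) (a + n) ^ (1 - 1 / p) =
      area (a + n) (a + n) := by
    rw [← Real.rpow_add hA, add_sub_cancel, Real.rpow_one]
  have e2 : 3 / area a a * (1 / 2) ^ n * area (a + n) (a + n) = 3 * 2 ^ n := by
    rw [area_add, one_div, inv_pow]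
    field_simp
  linear_combination (-(dualConst p (apChar p w).toReal * s ^ (1 / p) * X ^ (1 - 1 / p))) * e1 -
    (area (a + n) (a + n) * α * β) * e2

/-- Sum the local estimates over the tiling squares by Hölder, let the squares grow with the cells
fixed, and absorb. -/
theorem lintegral_cellFn_le_tl (hp : 1 < p) (hw : IsDyadicApWeight p w)
    (hf : MemLp f ∞ volume) (hc : HasCompactSupport f) (a : ℤ) :
    ∫⁻ z, ‖cellFn f a z‖ₑ ^ p * ENNReal.ofReal (w z) ≤
      ENNReal.ofReal (dualConst p (apChar p w).toReal) ^ p * ∫⁻ z, tlSquareFn p w f z ^ p := by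
  have hp0 : 0 < p := by linarith
  have hp1 : 0 < p - 1 := by linarith
  have hX := lintegral_cellFn_ne_top hf hc hw.locallyIntegrable hp0 a
  have hB := lintegral_cellFn_ne_top hf hc hw.locallyIntegrable hp1 a
  have hA := lintegral_cellFn_ne_top hf hc (locallyIntegrable_const (1 : ℝ)) one_pos a
  simp only [ENNReal.rpow_one, ENNReal.ofReal_one, mul_one] at hA
  refine ennreal_le_rpow_mul_of_le hp hX ?_
  set X := ∫⁻ z, ‖cellFn f a z‖ₑ ^ p * ENNReal.ofReal (w z) with hXdef
  set B := ∫⁻ z, ‖cellFn f a z‖ₑ ^ (p - 1) * ENNReal.ofReal (w z) with hBdef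
  set A := ∫⁻ z, ‖cellFn f a z‖ₑ
  set D := ENNReal.ofReal (dualConst p (apChar p w).toReal)
  set S := ∫⁻ z, tlSquareFn p w f z ^ p
  have hθ : 0 < 1 - 1 / p := by rw [sub_pos, div_lt_one hp0]; exact hp
  -- In the error one local integral is enlarged to `A`, so that summing over the squares gives `A *
  -- B`.
  have step : ∀ n : ℕ, X ≤ D * (S ^ (1 / p) * X ^ (1 - 1 / p)) +
      ENNReal.ofReal (3 / area a a * (1 / 2) ^ n) * (A * B) := by
    intro n
    have hS : ∑' m : ℤ × ℤ, ∫⁻ z in (rect (a + n) m.1 (a + n) m.2).toSet,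
        truncSum (tlTerm p w f) a n z ^ (p / 2) ≤ S := by
      rw [← lintegral_eq_tsum_rect]
      refine lintegral_mono fun z => ?_
      rw [tlSquareFn_rpow]
      gcongr
      exact truncSum_le _ _ _ _
    have hXs := lintegral_eq_tsum_rect (a + n) fun z => ‖cellFn f a z‖ₑ ^ p * ENNReal.ofReal (w z)
    have hBs := lintegral_eq_tsum_rect (a + n) fun z =>
      ‖cellFn f a z‖ₑ ^ (p - 1) * ENNReal.ofReal (w z)
    rw [← hXdef] at hXs
    rw [← hBdef] at hBs
    calc X = ∑' m : ℤ × ℤ, ∫⁻ z in (rect (a + n) m.1 (a + n) m.2).toSet,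
          ‖cellFn f a z‖ₑ ^ p * ENNReal.ofReal (w z) := hXs
      _ ≤ ∑' m : ℤ × ℤ, (D * ((∫⁻ z in (rect (a + n) m.1 (a + n) m.2).toSet,
              truncSum (tlTerm p w f) a n z ^ (p / 2)) ^ (1 / p) *
            (∫⁻ z in (rect (a + n) m.1 (a + n) m.2).toSet,
              ‖cellFn f a z‖ₑ ^ p * ENNReal.ofReal (w z)) ^ (1 - 1 / p)) +
          ENNReal.ofReal (3 / area a a * (1 / 2) ^ n) *
            (A * ∫⁻ z in (rect (a + n) m.1 (a + n) m.2).toSet,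
              ‖cellFn f a z‖ₑ ^ (p - 1) * ENNReal.ofReal (w z))) := by
          refine ENNReal.tsum_le_tsum fun m => (lintegral_cellFn_rect_le hp hw
            (locallyIntegrable_of_memLp_top hf) a n m.1 m.2).trans ?_
          gcongr
          exact setLIntegral_le_lintegral _ _
      _ ≤ _ := by
          rw [ENNReal.tsum_add, ENNReal.tsum_mul_left, ENNReal.tsum_mul_left,
            ENNReal.tsum_mul_left, ← hBs]
          gcongr
          refine (tsum_rpow_mul_rpow_le hp _ _).trans ?_
          rw [← hXs]
          gcongr
  have hlim : Tendsto (fun n : ℕ => D * (S ^ (1 / p) * X ^ (1 - 1 / p)) +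
      ENNReal.ofReal (3 / area a a * (1 / 2) ^ n) * (A * B)) atTop
      (𝓝 (D * (S ^ (1 / p) * X ^ (1 - 1 / p)) + 0)) := by
    refine tendsto_const_nhds.add ?_
    have h1 : Tendsto (fun n : ℕ => 3 / area a a * (1 / 2 : ℝ) ^ n) atTop (𝓝 0) := by
      have := (tendsto_pow_atTop_nhds_zero_of_lt_one (r := (1 / 2 : ℝ)) (by norm_num)
        (by norm_num)).const_mul (3 / area a a)
      simpa using this
    have h2 := ENNReal.Tendsto.mul_const (ENNReal.tendsto_ofReal h1)
      (Or.inr (ENNReal.mul_ne_top hA hB))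
    simpa using h2
  rw [add_zero] at hlim
  exact ge_of_tendsto' hlim step

/-- Lebesgue differentiation along dyadic squares. -/
theorem ae_tendsto_cellFn (hf : LocallyIntegrable f) :
    ∀ᵐ z, Tendsto (fun N : ℕ => cellFn f (-N) z) atTop (𝓝 (f z)) := by
  filter_upwards [IsUnifLocDoublingMeasure.ae_tendsto_average (volume : Measure (ℝ × ℝ)) hf 1]
    with z hz
  let c : ℤ → ℝ → ℝ := fun a s => (pos a s + 1 / 2) * 2 ^ a
  have h2 : ∀ a : ℤ, (0 : ℝ) < 2 ^ a := fun a => zpow_pos two_pos _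
  have hball : ∀ (a : ℤ) (s : ℝ), Metric.closedBall (c a s) (2 ^ a / 2) =
      Icc ((pos a s : ℝ) * 2 ^ a) ((pos a s + 1) * 2 ^ a) := by
    intro a s
    rw [Real.closedBall_eq_Icc]
    congr 1 <;> simp only [c] <;> ring
  -- Up to a null set, a square cell is a closed ball of the sup metric about its centre, so the
  -- differentiation theorem for balls containing `z` applies.
  have hcell : ∀ a : ℤ, (rect a (pos a z.1) a (pos a z.2)).toSet =ᵐ[volume]
      Metric.closedBall (c a z.1, c a z.2) (2 ^ a / 2) := by
    intro a
    rw [← closedBall_prod_same, hball, hball]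
    exact Measure.set_prod_ae_eq Ico_ae_eq_Icc Ico_ae_eq_Icc
  have hδ : Tendsto (fun N : ℕ => (2 : ℝ) ^ (-(N : ℤ)) / 2) atTop (𝓝[>] 0) := by
    refine tendsto_nhdsWithin_iff.2 ⟨?_, Eventually.of_forall fun N => half_pos (h2 _)⟩
    have := (tendsto_pow_atTop_nhds_zero_of_lt_one (r := (1 / 2 : ℝ)) (by norm_num)
      (by norm_num)).div_const 2
    rw [zero_div] at this
    refine this.congr fun N => ?_
    rw [zpow_neg, zpow_natCast, one_div, inv_pow]
  refine (hz (l := atTop) (fun N : ℕ => (c (-(N : ℤ)) z.1, c (-(N : ℤ)) z.2)) _ hδ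
    (Eventually.of_forall fun N => ?_)).congr fun N => ?_
  · rw [one_mul, ← closedBall_prod_same, hball, hball]
    have hm : ∀ (a : ℤ) (s : ℝ), s ∈ Icc ((pos a s : ℝ) * 2 ^ a) ((pos a s + 1) * 2 ^ a) := by
      intro a s
      have : s ∈ (⟨a, pos a s⟩ : DyadicInterval).toSet := by
        rw [DyadicInterval.toSet_eq]; rfl
      exact Ico_subset_Icc_self this
    exact ⟨hm _ _, hm _ _⟩
  · rw [← setAverage_congr (hcell _), setAverage_eq, measureReal_def, volume_rect,
      ENNReal.toReal_ofReal (area_pos _ _).le]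
    rfl

theorem lintegral_norm_le_tl (hp : 1 < p) (hw : IsDyadicApWeight p w)
    (hf : MemLp f ∞ volume) (hc : HasCompactSupport f) :
    ∫⁻ z, ‖f z‖ₑ ^ p * ENNReal.ofReal (w z) ≤
      ENNReal.ofReal (dualConst p (apChar p w).toReal) ^ p * ∫⁻ z, tlSquareFn p w f z ^ p := by
  calc ∫⁻ z, ‖f z‖ₑ ^ p * ENNReal.ofReal (w z)
      = ∫⁻ z, liminf (fun N : ℕ => ‖cellFn f (-N) z‖ₑ ^ p * ENNReal.ofReal (w z)) atTop := by
        refine lintegral_congr_ae ?_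
        filter_upwards [ae_tendsto_cellFn (locallyIntegrable_of_memLp_top hf)] with z hz
        refine (Tendsto.liminf_eq ?_).symm
        exact ENNReal.Tendsto.mul_const ((ENNReal.continuous_rpow_const.tendsto _).comp
          ((continuous_enorm.tendsto _).comp hz)) (Or.inr ENNReal.ofReal_ne_top)
    _ ≤ liminf (fun N : ℕ => ∫⁻ z, ‖cellFn f (-N) z‖ₑ ^ p * ENNReal.ofReal (w z)) atTop :=
        lintegral_liminf_le' fun N => ((measurable_cellFn f _).enorm.pow_const _).aemeasurable.mul
          hw.aemeasurable.ennreal_ofReal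
    _ ≤ _ := liminf_le_of_le (by isBoundedDefault) fun b hb => by
        obtain ⟨N, hN⟩ := hb.exists
        exact hN.trans (lintegral_cellFn_le_tl hp hw hf hc _)

end cellFn

/-! ### Norms and the theorem. -/

theorem measurable_squareFn (f : ℝ × ℝ → ℂ) : Measurable (squareFn f) :=
  (Measurable.tsum fun R => measurable_const.mul
    (measurable_const.indicator (DyadicRect.measurableSet_toSet R))).pow_const _

theorem eLpNorm_weightMeasure {E : Type*} [TopologicalSpace E] [ContinuousENorm E] {p : ℝ}
    (hp : 0 < p) {w : ℝ × ℝ → ℝ} (hw : AEMeasurable w) {f : ℝ × ℝ → E}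
    (hf : AEMeasurable (fun z => ‖f z‖ₑ)) :
    eLpNorm f (ENNReal.ofReal p) (weightMeasure w) =
      (∫⁻ z, ‖f z‖ₑ ^ p * ENNReal.ofReal (w z)) ^ (1 / p) := by
  rw [eLpNorm_eq_lintegral_rpow_enorm_toReal (ENNReal.ofReal_pos.2 hp).ne' ENNReal.ofReal_ne_top,
    ENNReal.toReal_ofReal hp.le, weightMeasure,
    lintegral_withDensity_eq_lintegral_mul₀ hw.ennreal_ofReal (hf.pow_const _)]
  simp only [Pi.mul_apply, mul_comm]

theorem eLpNorm_tlSquareFn {p : ℝ} (hp : 0 < p) (w : ℝ × ℝ → ℝ) (f : ℝ × ℝ → ℂ) :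
    eLpNorm (tlSquareFn p w f) (ENNReal.ofReal p) volume =
      (∫⁻ z, tlSquareFn p w f z ^ p) ^ (1 / p) := by
  rw [eLpNorm_eq_lintegral_rpow_enorm_toReal (ENNReal.ofReal_pos.2 hp).ne' ENNReal.ofReal_ne_top,
    ENNReal.toReal_ofReal hp.le]
  simp only [enorm_eq_self]

/-- The sum of the constants in the three estimates. -/
noncomputable def finalConst (p : ℝ) (Q : ℝ≥0∞) : ℝ≥0∞ :=
  ENNReal.ofReal (tlConst p Q.toReal) +
    ENNReal.ofReal (tlConst p Q.toReal * squareConst p Q.toReal) * Q +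
    ENNReal.ofReal (dualConst p Q.toReal) ^ p

theorem finalConst_ne_top {p : ℝ} (hp : 0 ≤ p) {Q : ℝ≥0∞} (hQ : Q ≠ ∞) : finalConst p Q ≠ ∞ :=
  ENNReal.add_ne_top.2 ⟨ENNReal.add_ne_top.2 ⟨ENNReal.ofReal_ne_top,
    ENNReal.mul_ne_top ENNReal.ofReal_ne_top hQ⟩,
    ENNReal.rpow_ne_top_of_nonneg hp ENNReal.ofReal_ne_top⟩

theorem rpow_le_finalConst_mul {p : ℝ} (hp : 0 < p) {Q c X Y : ℝ≥0∞} (hQ : Q ≠ ∞)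
    (hc : c ≤ finalConst p Q) (h : X ≤ c * Y) :
    X ^ (1 / p) ≤ ((finalConst p Q ^ (1 / p)).toNNReal : ℝ≥0∞) * Y ^ (1 / p) := by
  rw [ENNReal.coe_toNNReal (ENNReal.rpow_ne_top_of_nonneg (by positivity)
    (finalConst_ne_top hp.le hQ)), ← ENNReal.mul_rpow_of_nonneg _ _ (by positivity)]
  exact ENNReal.rpow_le_rpow (h.trans (mul_le_mul_left hc _)) (by positivity)

end Biparam

theorem lemma2p1 :
    ∃ C : ℝ → ℝ≥0∞ → ℝ≥0, ∀ (p : ℝ) (w : ℝ × ℝ → ℝ), 1 < p → Biparam.IsDyadicApWeight p w →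
      (∀ f : ℝ × ℝ → ℂ, LocallyIntegrable f volume →
        eLpNorm (Biparam.tlSquareFn p w f) (ENNReal.ofReal p) volume ≤
          C p (Biparam.apChar p w) *
            eLpNorm (Biparam.squareFn f) (ENNReal.ofReal p) (Biparam.weightMeasure w)) ∧
      (∀ f : ℝ × ℝ → ℂ, MemLp f ∞ volume → HasCompactSupport f →
        eLpNorm (Biparam.tlSquareFn p w f) (ENNReal.ofReal p) volume ≤
          C p (Biparam.apChar p w) *
            eLpNorm f (ENNReal.ofReal p) (Biparam.weightMeasure w)) ∧
      (∀ f : ℝ × ℝ → ℂ, MemLp f ∞ volume → HasCompactSupport f →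
        eLpNorm f (ENNReal.ofReal p) (Biparam.weightMeasure w) ≤
          C p (Biparam.apChar p w) *
            eLpNorm (Biparam.tlSquareFn p w f) (ENNReal.ofReal p) volume) := by
  -- The estimates concern `p`-th powers, hence the root. `toNNReal` loses nothing because the
  -- characteristic, and with it the constant, is finite.
  refine ⟨fun p Q => (Biparam.finalConst p Q ^ (1 / p)).toNNReal, fun p w hp hw => ?_⟩
  have hp0 : 0 < p := by linarith
  have hQ := hw.apChar_lt_top.ne
  refine ⟨fun f hf => ?_, fun f hf hc => ?_, fun f hf hc => ?_⟩
  · rw [Biparam.eLpNorm_tlSquareFn hp0, Biparam.eLpNorm_weightMeasure hp0 hw.aemeasurable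
      (by simpa only [enorm_eq_self] using (Biparam.measurable_squareFn f).aemeasurable)]
    simp only [enorm_eq_self]
    exact Biparam.rpow_le_finalConst_mul hp0 hQ (le_self_add.trans le_self_add)
      (Biparam.lintegral_tlSquareFn_le_squareFn hp hw hf)
  · rw [Biparam.eLpNorm_tlSquareFn hp0,
      Biparam.eLpNorm_weightMeasure hp0 hw.aemeasurable hf.1.enorm]
    exact Biparam.rpow_le_finalConst_mul hp0 hQ (le_add_self.trans le_self_add)
      (Biparam.lintegral_tlSquareFn_le hp hw (Biparam.locallyIntegrable_of_memLp_top hf))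
  · rw [Biparam.eLpNorm_tlSquareFn hp0,
      Biparam.eLpNorm_weightMeasure hp0 hw.aemeasurable hf.1.enorm]
    exact Biparam.rpow_le_finalConst_mul hp0 hQ le_add_self
      (Biparam.lintegral_norm_le_tl hp hw hf hc)
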